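/- **Setting.** A *2XOR instance* $\mathcal I$ is a finite loopless multigraph $(V,E)$ with edge signs $\mathrm{wt}:E\to\{\pm1\}$; its adjacency matrix $A$ has as entry $A[u,v]$ the sum of the signs of all edges joining $u$ and $v$. Its *eigenvalue bound* is $\mathrm{EIG}(\mathcal I)=\frac{|V|}{2|E|}\lambda_{\max}(A)$, and its *SDP value* is $$\mathrm{SDP}(\mathcal I)=\max_{m,\;x:V\to S^{m-1}}\ \frac1{|E|}\sum_{e=\{u,v\}\in E}\mathrm{wt}(e)\langle x_u,x_v\rangle .$$ If the graph is bipartite, its *quantum value* is the supremum of $\frac1{|E|}\sum_{e=(u,v)\in E}\mathrm{wt}(e)\,\langle\psi,(A_u\otimes B_v)\psi\rangle$ over all finite dimensions $p,q$, unit vectors $\psi\in\mathbb C^p\otimes\mathbb C^q$ and Hermitian matrices $A_u\in\mathbb C^{p\times p}$, $B_v\in\mathbb C^{q\times q}$ with $A_u^2=I$, $B_v^2=I$. For $k\ge 0$ let $H_k=\begin{pmatrix}1&1\\1&-1\end{pmatrix}^{\otimes k}$. The constraint $\mathrm{Forrelation}_k(x,y)=2^{-2k}x^\top H_k y$, $x,y\in\{\pm1\}^{2^k}$,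 is viewed as the complete bipartite graph on the $r=2^{k+1}$ variables $x_s,y_t$ whose edge $\{x_s,y_t\}$ has sign $H_k[s,t]$. A *random $c$-constraint-regular instance* $\mathcal I_n$ of the $\mathrm{Forrelation}_k$-CSP has $rn$ variables $(i,a)$ and $cn$ constraints $f=(j,b)$, where $i$ ranges over the $r$ variables of the constraint, $j\in[c]$ and $a,b\in[n]$. Choose independent uniformly random permutations $\sigma_{ij}$ of $[n]$ and, independently of these, sign vectors $\xi^{f}\in\{\pm1\}^r$ that are independent over the constraints $f$; the law of $\xi^f$ may depend on $f$ and $n$ and its coordinates may be correlated, but for each edge $\{i,i'\}$ of $\mathrm{Forrelation}_k$ the product $\xi^f_i\xi^f_{i'}$ is $\pm1$ with probability $1/2$ each. (Negating each whole constraint with probability $1/2$, and applying each constraint to uniformly random literals, are special cases.) For each constraint $f=(j,b)$, place a copy of the $\mathrm{Forrelation}_k$ graph on the variables $(i,\sigma_{ij}(b))_i$, with the sign of each edge $\{i,i'\}$ multiplied by $\xi^f_i\xi^f_{i'}$. **Theorem.** Let $k\ge0$ and $c\ge2$ be fixed integers and let $\varepsilon>0$. For random $c$-constraint-regular instances $\mathcal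 I_n$ of the $\mathrm{Forrelation}_k$-CSP, with probability tending to $1$ as $n\to\infty$, the SDP value, the quantum value and the eigenvalue bound of $\mathcal I_n$ all lie in the range $$\frac{2\sqrt{c-1}}{c\cdot 2^{k/2}}\pm\varepsilon .$$ -/

import Mathlib

open Filter Topology MeasureTheory
open scoped Kronecker Matrix ENNReal

noncomputable section

/-- A 2XOR instance on the variable set `V`: a finite loopless multigraph with edge signs.  Each
edge is recorded with an ordering `(src e, tgt e)` of its endpoints; the adjacency matrix, the
eigenvalue bound and the SDP value do not depend on that ordering. -/
structure XorInstance (V : Type) where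
  E : Type
  [fintypeE : Fintype E]
  src : E → V
  tgt : E → V
  src_ne_tgt : ∀ e, src e ≠ tgt e
  sign : E → ℤˣ

attribute [instance] XorInstance.fintypeE

namespace XorInstance

variable {V : Type}

/-- The signed adjacency matrix; parallel edges add up. -/
def adj [DecidableEq V] (I : XorInstance V) : Matrix V V ℝ := fun u v =>
  ∑ e : I.E,
    if (I.src e = u ∧ I.tgt e = v) ∨ (I.src e = v ∧ I.tgt e = u) then ((I.sign e : ℤ) : ℝ) else 0

/-- The largest eigenvalue of the adjacency matrix. -/
def lambdaMax [Fintype V] [DecidableEq V] (I : XorInstance V) : ℝ :=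
  sSup {μ : ℝ | Module.End.HasEigenvalue (Matrix.toLin' I.adj) μ}

/-- The eigenvalue bound `|V| / (2 |E|) * λ_max(A)`. -/
def eig [Fintype V] [DecidableEq V] (I : XorInstance V) : ℝ :=
  (Fintype.card V : ℝ) / (2 * (Fintype.card I.E : ℝ)) * I.lambdaMax

/-- The SDP value: the maximum, over all dimensions `m` and all assignments of unit vectors of
`ℝ^m` to the variables, of the edge average of `sign(e) * ⟨x_u, x_v⟩`. -/
def sdp (I : XorInstance V) : ℝ :=
  sSup {t : ℝ | ∃ (m : ℕ) (x : V → EuclideanSpace ℝ (Fin m)), (∀ v, ‖x v‖ = 1) ∧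
    t = (∑ e : I.E, ((I.sign e : ℤ) : ℝ) * inner ℝ (x (I.src e)) (x (I.tgt e))) /
      (Fintype.card I.E : ℝ)}

/-- The quantum value of the nonlocal game in which the referee draws a uniformly random edge `e`,
sends `src e` to Alice and `tgt e` to Bob, and pays `sign(e)` times the product of their `±1`
answers.  The players share a unit vector `ψ ∈ ℂ^p ⊗ ℂ^q` and answer by measuring `±1`-valued
observables (Hermitian matrices with square `1`).  Only meant for instances whose edges all have
their source in one part and their target in the other part of a bipartition. -/
def quantumValue (I : XorInstance V) : ℝ :=
  sSup {t : ℝ | ∃ (p q : ℕ) (ψ : Fin p × Fin q → ℂ)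
    (A : V → Matrix (Fin p) (Fin p) ℂ) (B : V → Matrix (Fin q) (Fin q) ℂ),
    star ψ ⬝ᵥ ψ = 1 ∧
    (∀ v, (A v).IsHermitian ∧ A v * A v = 1) ∧
    (∀ v, (B v).IsHermitian ∧ B v * B v = 1) ∧
    t = (∑ e : I.E, ((I.sign e : ℤ) : ℝ) *
        (star ψ ⬝ᵥ ((A (I.src e) ⊗ₖ B (I.tgt e)) *ᵥ ψ)).re) / (Fintype.card I.E : ℝ)}

end XorInstance

/-- The `k`th Walsh–Hadamard matrix, the `k`th Kronecker power of `(1, 1; 1, -1)`, with rows and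
columns indexed by `{0,1}^k`. -/
def walshHadamard (k : ℕ) : Matrix (Fin k → Fin 2) (Fin k → Fin 2) ℤˣ := fun x y =>
  ∏ i, (!![1, 1; 1, -1] : Matrix (Fin 2) (Fin 2) ℤˣ) (x i) (y i)

/-- The `2^k + 2^k` variables of the Forrelation constraint. -/
abbrev ForrVar (k : ℕ) : Type := (Fin k → Fin 2) ⊕ (Fin k → Fin 2)

/-- The constraint `Forrelation_k(x, y) = 2^(-2k) xᵀ H_k y`, as a 2XOR instance: it is the average
of the `2^(2k)` terms `H_k[s,t] x_s y_t`. -/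
def forrelation (k : ℕ) : XorInstance (ForrVar k) where
  E := (Fin k → Fin 2) × (Fin k → Fin 2)
  src e := Sum.inl e.1
  tgt e := Sum.inr e.2
  src_ne_tgt _ := Sum.inl_ne_inr
  sign e := walshHadamard k e.1 e.2

/-- An `n`-lift of the complete bipartite graph between the variable set `ι` and `c` atoms: a
permutation for each base edge.  The constraint vertex `(j, b)` is adjacent to the variable vertex
`(i, σ (i, j) b)`, for every `i`. -/
abbrev ConstraintLift (ι : Type) (c n : ℕ) : Type := ι × Fin c → Equiv.Perm (Fin n)

/-- A choice of signs `ξ^f_i`, for all constraint vertices `f` and all `i : ι`. -/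
abbrev Negations (ι : Type) (c n : ℕ) : Type := Fin c × Fin n → ι → ℤˣ

/-- The instance graph of a constraint graph with negations: for each constraint vertex `f = (j, b)`
a copy of the atom `A j` is placed on the neighbours of `f`, with the sign of each edge `{i, i'}`
multiplied by `ξ^f_i ξ^f_i'`. -/
def additiveLift {ι : Type} {c n : ℕ} (A : Fin c → XorInstance ι)
    (σ : ConstraintLift ι c n) (ξ : Negations ι c n) : XorInstance (ι × Fin n) where
  E := (j : Fin c) × (Fin n × (A j).E)
  src e := ((A e.1).src e.2.2, σ ((A e.1).src e.2.2, e.1) e.2.1)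
  tgt e := ((A e.1).tgt e.2.2, σ ((A e.1).tgt e.2.2, e.1) e.2.1)
  src_ne_tgt e h := (A e.1).src_ne_tgt e.2.2 (congrArg Prod.fst h)
  sign e := (A e.1).sign e.2.2 *
    (ξ (e.1, e.2.1) ((A e.1).src e.2.2) * ξ (e.1, e.2.1) ((A e.1).tgt e.2.2))

/-- A random vector of signs on the variables of the atom `A` is a 1-wise uniform negation if every
edge of `A` gets negated with probability `1/2`.  Signs of different edges may be correlated. -/
def IsOneWiseUniform {ι : Type} (A : XorInstance ι) (ν : Measure (ι → ℤˣ)) : Prop :=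
  ∀ e : A.E, ν {ξ | ξ (A.src e) * ξ (A.tgt e) = -1} = 1 / 2

instance permFinMeasurableSpace (n : ℕ) : MeasurableSpace (Equiv.Perm (Fin n)) := ⊤

/-- The law of a random `n`-lift (independent uniform permutations) together with independent
negations, the negation at the constraint vertex `f` having law `ν f`. -/
def randomLiftLaw (ι : Type) (c n : ℕ) (ν : Fin c × Fin n → Measure (ι → ℤˣ)) :
    Measure (ConstraintLift ι c n × Negations ι c n) :=
  (ProbabilityTheory.uniformOn (Set.univ : Set (ConstraintLift ι c n))).prod (Measure.pi ν)

end

/-! Write the adjacency matrix as `A = ∑ j, B_j`, where `B_j` comes from the constraints of kind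
`j`. Orthogonality of the rows of `H_k` gives `B_j² = 2^k`, whatever the permutations and signs
(`block_mul_self`). In a random lift the `B_j` look locally free, so `A` should behave like a sum of
`c` free involutions scaled by `2^(k/2)`, whose spectrum ends at `2s` with `s² = 2^k (c-1)`. As the
eigenvalue bound is `λ_max / (c 2^k)`, the common limit is `2s / (c 2^k)`.

Upper bound. The sums of all products of the `B_j` over words with distinct neighbouring letters
obey a three-term recurrence, so they are polynomials in `A`. At an eigenvalue `≥ s(y + 1/y)` the
polynomial for words of length `L` is at least `(sy)^L` (`le_nbPoly`), hence the squared Frobenius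
norm of the sum is at least `(sy)^(2L)` (`le_sum_sq_nbSum`). In expectation over the signs, only
pairs of words with common ends that visit no constraint exactly once contribute
(`integral_pair_le`). Let `L = m r` with `r` of order `log n` and `m` constant. In most lifts, walks
of length `4L` have boundedly many collisions, and walks of length `r` at most one
(`card_not_isSparse_le`). The closed walk of a pair is then determined by its start, boundedly many
exceptional events of polynomial cost in `r`, and one label for each step between fresh vertices
(`card_walks_le`). As at most `L` distinct constraints occur, the labels contribute at most `((c-1)
2^k)^L = s^(2L)`. For large `m` the factor `y^(2L)` beats the `n` starting points, and Markov's
inequality applies.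

Lower bound. At a vertex with a tree-like neighbourhood, the rows of the non-backtracking sums of
different lengths are orthogonal with known norms, and after normalization `A` acts between them as
on a path with edge weight `s`. A normalized sum of `m+1` such rows has Rayleigh quotient `2s
m/(m+1)`. Assigning to each variable its own row gives an SDP solution of nearly this value, because
few vertices are not tree-like (`le_sdp_additiveLift`); the signs play no role here.

Finally the SDP value is at most the eigenvalue bound (`sdp_le_eig`), and it equals the quantum
value by Tsirelson's theorem (`quantumValue_eq_sdp`), so the two bounds trap all three quantities.
-/

/-! ### Walks, fresh vertices and collisions -/

namespace WalkCount

variable {X : Type*}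

/-- The vertex visited at time `t` has not been visited before. -/
def Fresh (w : ℕ → X) (t : ℕ) : Prop := ∀ s < t, w s ≠ w t

/-- The (undirected) edge traversed in step `t` has not been traversed before. -/
def NewEdge (w : ℕ → X) (t : ℕ) : Prop := ∀ s < t, s(w s, w (s + 1)) ≠ s(w t, w (t + 1))

/-- Step `t` traverses a new edge, but arrives at an old vertex. -/
def IsCollision (w : ℕ → X) (t : ℕ) : Prop := NewEdge w t ∧ ¬ Fresh w (t + 1)

open Classical in
/-- The times of the collisions among the first `N` steps. -/
noncomputable def collisionTimes (w : ℕ → X) (N : ℕ) : Finset ℕ :=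
  (Finset.range N).filter (IsCollision w)

/-- The number of collisions among the first `N` steps. -/
noncomputable def collisions (w : ℕ → X) (N : ℕ) : ℕ := (collisionTimes w N).card

theorem mem_collisionTimes {w : ℕ → X} {N t : ℕ} :
    t ∈ collisionTimes w N ↔ t < N ∧ IsCollision w t := by
  classical
  simp [collisionTimes]

theorem fresh_zero (w : ℕ → X) : Fresh w 0 := fun s hs => absurd hs (Nat.not_lt_zero s)

/-- A step from a vertex visited for the first time that does not backtrack uses a new edge. -/
theorem Fresh.newEdge_of_ne {w : ℕ → X} {t : ℕ} (h : Fresh w t)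
    (hnb : ∀ s, s + 1 = t → w s ≠ w (t + 1)) : NewEdge w t := by
  intro s hs he
  rw [Sym2.eq_iff] at he
  rcases he with ⟨h1, _⟩ | ⟨h1, h2⟩
  · exact h s hs h1
  · rcases Nat.lt_or_ge (s + 1) t with h3 | h3
    · exact h (s + 1) h3 h2
    · exact hnb s (by omega) h1

theorem Fresh.fresh_or_collision {w : ℕ → X} {t : ℕ} (h : Fresh w t)
    (hnb : ∀ s, s + 1 = t → w s ≠ w (t + 1)) : Fresh w (t + 1) ∨ IsCollision w t := by
  by_cases h1 : Fresh w (t + 1)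
  · exact Or.inl h1
  · exact Or.inr ⟨h.newEdge_of_ne hnb, h1⟩

/-- A non-backtracking walk without collisions never revisits a vertex. -/
theorem fresh_of_collisions_eq_zero {w : ℕ → X} {N : ℕ}
    (hnb : ∀ t, t + 2 ≤ N → w t ≠ w (t + 2)) (hcol : collisions w N = 0) :
    ∀ t ≤ N, Fresh w t := by
  intro t
  induction t with
  | zero => intro _; exact fresh_zero w
  | succ t ih =>
    intro ht
    rcases (ih (by omega)).fresh_or_collision (by
      rintro s rfl
      exact hnb s (by omega)) with h | h
    · exact h
    · have : t ∈ collisionTimes w N := mem_collisionTimes.2 ⟨by omega, h⟩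
      rw [collisions, Finset.card_eq_zero] at hcol
      simp [hcol] at this

theorem exists_newEdge_eq (w : ℕ → X) (t : ℕ) :
    ∃ s ≤ t, NewEdge w s ∧ s(w s, w (s + 1)) = s(w t, w (t + 1)) := by
  induction t using Nat.strong_induction_on with
  | _ t ih =>
    by_cases h : NewEdge w t
    · exact ⟨t, le_rfl, h, rfl⟩
    · simp only [NewEdge, not_forall, not_not] at h
      obtain ⟨s, hs, he⟩ := h
      obtain ⟨s', hs', h1, h2⟩ := ih s hs
      exact ⟨s', by omega, h1, h2.trans he⟩

/-- In a set of traversed edges without vertices of degree one, the edge discovered last is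
discovered in a collision. -/
theorem exists_collision_of_minDegree {w : ℕ → X} (S : Set (Sym2 X)) {q t₀ : ℕ}
    (hS₀ : s(w t₀, w (t₀ + 1)) ∈ S)
    (hS : ∀ e ∈ S, ∃ i < q, s(w i, w (i + 1)) = e)
    (hdeg : ∀ e ∈ S, ∀ x ∈ e, ∃ e' ∈ S, e' ≠ e ∧ x ∈ e') :
    ∃ m < q, IsCollision w m ∧ ∀ e ∈ S, ∃ i ≤ m, NewEdge w i ∧ s(w i, w (i + 1)) = e := by
  classical
  have hfirst : ∀ e ∈ S, ∃ i < q, NewEdge w i ∧ s(w i, w (i + 1)) = e := by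
    intro e he
    obtain ⟨i, hi, h⟩ := hS e he
    obtain ⟨i', hi', h1, h2⟩ := exists_newEdge_eq w i
    exact ⟨i', by omega, h1, h2.trans h⟩
  -- `J` holds the discovery times of the edges of `S`, and `m` will be the last of them. If the
  -- step at time `m` reached a fresh vertex, a second edge of `S` at that vertex would have to be
  -- discovered later.
  set J := (Finset.range q).filter (fun i => NewEdge w i ∧ s(w i, w (i + 1)) ∈ S) with hJ
  have hmem : ∀ e ∈ S, ∃ i ∈ J, s(w i, w (i + 1)) = e := by
    intro e he
    obtain ⟨i, hi, h1, h2⟩ := hfirst e he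
    exact ⟨i, by simp [hJ, hi, h1, h2, he], h2⟩
  obtain ⟨i₀, hi₀, -⟩ := hmem _ hS₀
  obtain ⟨m, hm, hmax⟩ := J.exists_max_image id ⟨i₀, hi₀⟩
  simp only [id] at hmax
  have hm' : m < q ∧ NewEdge w m ∧ s(w m, w (m + 1)) ∈ S := by simpa [hJ] using hm
  refine ⟨m, hm'.1, ⟨hm'.2.1, ?_⟩, ?_⟩
  · intro hf
    obtain ⟨e', he', hne, hx⟩ := hdeg _ hm'.2.2 (w (m + 1)) (Sym2.mem_mk_right _ _)
    obtain ⟨i, hi, rfl⟩ := hmem e' he'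
    have him : i ≤ m := hmax i hi
    have him' : i ≠ m := by rintro rfl; exact hne rfl
    rw [Sym2.mem_iff] at hx
    rcases hx with hx | hx
    · exact hf i (by omega) hx.symm
    · exact hf (i + 1) (by omega) hx.symm
  · intro e he
    obtain ⟨i, hi, h⟩ := hmem e he
    have hi' : i < q ∧ NewEdge w i ∧ s(w i, w (i + 1)) ∈ S := by simpa [hJ] using hi
    exact ⟨i, hmax i hi, hi'.2.1, h⟩

/-- Bookkeeping for a walk that closes a cycle of length `p = t + 1 - s` at time `t + 1` and then
runs around it up to time `t₂`. -/
theorem exists_cycle_position {u : ℕ → X} {s t t₂ p : ℕ} (hp : s + p = t + 1) (hp1 : 1 ≤ p)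
    (hper : ∀ i, t < i → i ≤ t₂ → u i = u (i - p)) :
    ∀ i, t < i → i ≤ t₂ → ∃ m, s < m ∧ m ≤ t + 1 ∧ u i = u m ∧ u (i - 1) = u (m - 1) ∧
      u (i + 1 - p) = u (if m = t + 1 then s + 1 else m + 1) := by
  intro i
  induction i using Nat.strong_induction_on with
  | _ i ih =>
    intro h1 h2
    -- Subtract periods until the position lies on the first lap. The `if` in the conclusion is the
    -- wrap-around: on the cycle, the successor of position `t + 1` is position `s + 1`.
    rcases Nat.lt_or_ge (t + 1) i with h3 | h3
    · have hi : u i = u (i - p) := hper i h1 h2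
      have hi1 : u (i - 1) = u (i - p - 1) := by
        rw [hper (i - 1) (by omega) (by omega)]; congr 1; omega
      rcases Nat.lt_or_ge t (i - p) with h4 | h4
      · obtain ⟨m, hm1, hm2, hm3, hm4, hm5⟩ := ih (i - p) (by omega) h4 (by omega)
        refine ⟨m, hm1, hm2, hi.trans hm3, hi1.trans hm4, ?_⟩
        rw [← hm5, hper (i + 1 - p) (by omega) (by omega)]
        congr 1; omega
      · refine ⟨i - p, by omega, by omega, hi, hi1, ?_⟩
        rw [if_neg (by omega)]
        congr 1; omega
    · obtain rfl : i = t + 1 := by omega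
      refine ⟨t + 1, by omega, le_rfl, rfl, rfl, ?_⟩
      rw [if_pos rfl]
      congr 1; omega

/-- After leaving the only cycle, a non-backtracking walk does not revisit vertices. -/
theorem injective_after_cycle {u : ℕ → X} {q s t t₂ p : ℕ}
    (hne : ∀ t < q, u t ≠ u (t + 1)) (hnb : ∀ t, t + 2 ≤ q → u t ≠ u (t + 2))
    (huniq : ∀ m < q, IsCollision u m → m = t) (hinj : ∀ i j, i < j → j ≤ t → u i ≠ u j)
    (hp : s + p = t + 1) (hp1 : 3 ≤ p) (hclose : u (t + 1) = u s)
    (hper : ∀ i, t < i → i ≤ t₂ → u i = u (i - p)) (ht₂ : t < t₂) (ht₂q : t₂ < q)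
    (hleave : u (t₂ + 1) ≠ u (t₂ + 1 - p)) :
    ∀ i j, t₂ ≤ i → i < j → j ≤ q → u i ≠ u j := by
  intro a b hab1 hab hbq heq
  obtain ⟨m, hm1, hm2, hm3, hm4, hm5⟩ := exists_cycle_position hp (by omega) hper t₂ ht₂ le_rfl
  -- `S` is the cycle together with the walk from the exit time `t₂` to the supposed repetition at
  -- `b`. The repetition gives every vertex of `S` degree at least two, so the last discovered edge
  -- of `S` is discovered in a collision, which can only be the one at time `t`.
  set S : Set (Sym2 X) := {e | ∃ i, ((s ≤ i ∧ i ≤ t) ∨ (t₂ ≤ i ∧ i < b)) ∧ s(u i, u (i + 1)) = e}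
    with hS
  have hedge : ∀ i, i + 2 ≤ q → s(u i, u (i + 1)) ≠ s(u (i + 1), u (i + 1 + 1)) := by
    intro i hi h
    rw [Sym2.eq_iff] at h
    rcases h with ⟨h1, _⟩ | ⟨h1, _⟩
    · exact hne i (by omega) h1
    · exact hnb i hi h1
  -- the vertices of the cycle have degree at least two
  have hcyc : ∀ m, s ≤ m → m ≤ t → ∀ e ∈ S, ∃ e' ∈ S, e' ≠ e ∧ u m ∈ e' := by
    intro m hm1 hm2 e _
    have key : ∃ e₁ ∈ S, ∃ e₂ ∈ S, e₁ ≠ e₂ ∧ u m ∈ e₁ ∧ u m ∈ e₂ := by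
      rcases Nat.lt_or_ge s m with h | h
      · obtain ⟨m', rfl⟩ : ∃ m', m = m' + 1 := ⟨m - 1, by omega⟩
        exact ⟨_, ⟨m', Or.inl ⟨by omega, by omega⟩, rfl⟩, _, ⟨m' + 1, Or.inl ⟨by omega, by omega⟩, rfl⟩,
          hedge m' (by omega), Sym2.mem_mk_right _ _, Sym2.mem_mk_left _ _⟩
      · obtain rfl : m = s := by omega
        refine ⟨_, ⟨m, Or.inl ⟨by omega, by omega⟩, rfl⟩, _, ⟨t, Or.inl ⟨by omega, by omega⟩, rfl⟩,
          ?_, Sym2.mem_mk_left _ _, ?_⟩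
        · rw [hclose]
          intro h
          rw [Sym2.eq_iff] at h
          rcases h with ⟨h1, _⟩ | ⟨_, h1⟩
          · exact hinj m t (by omega) le_rfl h1
          · exact hinj (m + 1) t (by omega) le_rfl h1
        · rw [hclose]; exact Sym2.mem_mk_right _ _
    obtain ⟨e₁, h1, e₂, h2, h12, hx1, hx2⟩ := key
    by_cases h : e₁ = e
    · exact ⟨e₂, h2, fun h' => h12 (h.trans h'.symm), hx2⟩
    · exact ⟨e₁, h1, h, hx1⟩
  have hpath : ∀ m, t₂ < m → m < b → ∀ e ∈ S, ∃ e' ∈ S, e' ≠ e ∧ u m ∈ e' := by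
    intro m hm1 hm2 e _
    obtain ⟨m', rfl⟩ : ∃ m', m = m' + 1 := ⟨m - 1, by omega⟩
    by_cases h : s(u m', u (m' + 1)) = e
    · refine ⟨_, ⟨m' + 1, Or.inr ⟨by omega, by omega⟩, rfl⟩, ?_, Sym2.mem_mk_left _ _⟩
      rw [← h]
      exact (hedge m' (by omega)).symm
    · exact ⟨_, ⟨m', Or.inr ⟨by omega, by omega⟩, rfl⟩, h, Sym2.mem_mk_right _ _⟩
  have hvt₂ : ∃ m', s ≤ m' ∧ m' ≤ t ∧ u t₂ = u m' := by
    rcases Nat.lt_or_ge t m with h | h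
    · obtain rfl : m = t + 1 := by omega
      exact ⟨s, le_rfl, by omega, hm3.trans hclose⟩
    · exact ⟨m, by omega, h, hm3⟩
  have hvert : ∀ m, (s ≤ m ∧ m ≤ t + 1) ∨ (t₂ ≤ m ∧ m ≤ b) →
      ∀ e ∈ S, ∃ e' ∈ S, e' ≠ e ∧ u m ∈ e' := by
    have base : ∀ m, (s ≤ m ∧ m ≤ t + 1) ∨ (t₂ ≤ m ∧ m < b) →
        ∀ e ∈ S, ∃ e' ∈ S, e' ≠ e ∧ u m ∈ e' := by
      rintro m (⟨h1, h2⟩ | ⟨h1, h2⟩)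
      · rcases Nat.lt_or_ge t m with h | h
        · obtain rfl : m = t + 1 := by omega
          rw [hclose]
          exact hcyc s le_rfl (by omega)
        · exact hcyc m h1 h
      · rcases Nat.lt_or_ge t₂ m with h | h
        · exact hpath m h h2
        · obtain rfl : m = t₂ := by omega
          obtain ⟨m', h3, h4, h5⟩ := hvt₂
          rw [h5]
          exact hcyc m' h3 h4
    rintro m (h | ⟨h1, h2⟩)
    · exact base m (Or.inl h)
    · rcases Nat.lt_or_ge m b with h | h
      · exact base m (Or.inr ⟨h1, h⟩)
      · obtain rfl : m = b := by omega
        rw [← heq]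
        exact base a (Or.inr ⟨hab1, hab⟩)
  have hdeg : ∀ e ∈ S, ∀ x ∈ e, ∃ e' ∈ S, e' ≠ e ∧ x ∈ e' := by
    intro e he x hx
    obtain ⟨i, hi, rfl⟩ := he
    have he : s(u i, u (i + 1)) ∈ S := ⟨i, hi, rfl⟩
    rw [Sym2.mem_iff] at hx
    rcases hx with rfl | rfl
    · exact hvert i (by omega) _ he
    · exact hvert (i + 1) (by omega) _ he
  -- The exit edge belongs to `S`, so it was already traversed by time `t`, when only the tail and
  -- the cycle had been seen.
  have he₀ : s(u t₂, u (t₂ + 1)) ∈ S := ⟨t₂, Or.inr ⟨le_rfl, by omega⟩, rfl⟩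
  obtain ⟨m₀, hm₀q, hm₀, hfirst⟩ := exists_collision_of_minDegree (q := q) S he₀
    (by rintro e ⟨i, hi, rfl⟩; exact ⟨i, by omega, rfl⟩) hdeg
  obtain rfl := huniq m₀ hm₀q hm₀
  -- no edge of `S` lies before the cycle
  have htail : ∀ i, i < s → s(u i, u (i + 1)) ∉ S := by
    intro i
    induction i using Nat.strong_induction_on with
    | _ i ih =>
      intro his hiS
      obtain ⟨e', he', hne', hx⟩ := hdeg _ hiS (u i) (Sym2.mem_mk_left _ _)
      obtain ⟨i₂, hi₂, _, rfl⟩ := hfirst e' he'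
      have h1 : i₂ ≠ i := by rintro rfl; exact hne' rfl
      rw [Sym2.mem_iff] at hx
      rcases Nat.lt_or_ge i₂ i with h2 | h2
      · exact ih i₂ h2 (by omega) he'
      · rcases hx with hx | hx
        · exact hinj i i₂ (by omega) hi₂ hx
        · rcases Nat.lt_or_ge i₂ m₀ with h3 | h3
          · exact hinj i (i₂ + 1) (by omega) (by omega) hx
          · obtain rfl : i₂ = m₀ := by omega
            rw [hclose] at hx
            exact hinj i s his (by omega) hx
  obtain ⟨i₁, hi₁, _, he₁⟩ := hfirst _ he₀
  have hi₁s : s ≤ i₁ := by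
    by_contra h
    exact htail i₁ (by omega) (by rw [he₁]; exact he₀)
  have hinj' : ∀ i j, i ≤ m₀ → j ≤ m₀ → u i = u j → i = j := by
    intro i j hi hj h
    rcases Nat.lt_trichotomy i j with h1 | h1 | h1
    · exact absurd h (hinj i j h1 hj)
    · exact h1
    · exact absurd h.symm (hinj j i h1 hi)
  -- The exit edge is therefore a cycle edge. Traversed forwards it continues the periodic motion,
  -- contrary to `hleave`; traversed backwards it undoes the step into `u t₂`.
  rw [Sym2.eq_iff] at he₁
  rcases he₁ with ⟨h1, h2⟩ | ⟨h1, h2⟩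
  · apply hleave
    rw [hm5, ← h2]
    rw [hm3] at h1
    split_ifs with h
    · subst h
      rw [hclose] at h1
      rw [hinj' i₁ s hi₁ (by omega) h1]
    · rw [hinj' i₁ m hi₁ (by omega) h1]
  · have h3 : u (t₂ - 1) ≠ u (t₂ + 1) := by
      have := hnb (t₂ - 1) (by omega)
      rwa [show t₂ - 1 + 2 = t₂ + 1 by omega] at this
    apply h3
    rw [hm4, ← h1]
    rw [hm3] at h2
    rcases Nat.lt_or_ge i₁ m₀ with h4 | h4
    · rcases Nat.lt_or_ge m₀ m with h5 | h5
      · obtain rfl : m = m₀ + 1 := by omega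
        rw [hclose] at h2
        have := hinj' _ _ (by omega) (by omega) h2
        omega
      · have := hinj' _ _ (by omega) (by omega) h2
        congr 1; omega
    · obtain rfl : i₁ = m₀ := by omega
      rcases Nat.lt_or_ge i₁ m with h5 | h5
      · congr 1; omega
      · rw [hclose] at h2
        have := hinj' _ _ (by omega) (by omega) h2
        omega

/-- A non-backtracking walk with at most one collision consists of a self-avoiding part, a part
which runs periodically around a cycle, and a second self-avoiding part. -/
theorem exists_window_structure {u : ℕ → X} {q : ℕ} (hne : ∀ t < q, u t ≠ u (t + 1))
    (hnb : ∀ t, t + 2 ≤ q → u t ≠ u (t + 2)) (hcol : collisions u q ≤ 1) :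
    ∃ t t₂ p, t ≤ t₂ ∧ t₂ ≤ q ∧ 1 ≤ p ∧ p ≤ q + 1 ∧ (∀ i j, i < j → j ≤ t → u i ≠ u j) ∧
      (∀ i, t < i → i ≤ t₂ → p ≤ i ∧ u i = u (i - p)) ∧
      (∀ i j, t₂ ≤ i → i < j → j ≤ q → u i ≠ u j) := by
  classical
  by_cases hinj : ∀ j ≤ q, Fresh u j
  -- Without any revisit the periodic part is empty, and the period `1` is a dummy value.
  · exact ⟨q, q, 1, le_rfl, le_rfl, le_rfl, by omega, fun i j hij hj => hinj j hj i hij,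
      fun i h1 h2 => by omega, fun i j h1 h2 h3 => by omega⟩
  have hex : ∃ j, j ≤ q ∧ ¬ Fresh u j := by push Not at hinj; simpa using hinj
  obtain ⟨hjq, hjf⟩ := Nat.find_spec hex
  have hjmin : ∀ i < Nat.find hex, Fresh u i := by
    intro i hi
    by_contra hf
    exact Nat.find_min hex hi ⟨by omega, hf⟩
  set j₀ := Nat.find hex with hj₀
  clear_value j₀
  obtain ⟨t, rfl⟩ : ∃ t, j₀ = t + 1 := by
    refine ⟨j₀ - 1, ?_⟩
    rcases Nat.eq_zero_or_pos j₀ with h | h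
    · exact absurd (h ▸ fresh_zero u) hjf
    · omega
  have hinj' : ∀ i j, i < j → j ≤ t → u i ≠ u j := fun i j hij hj => hjmin j (by omega) i hij
  obtain ⟨s, hs, hclose⟩ : ∃ s < t + 1, u s = u (t + 1) := by
    simpa [Fresh] using hjf
  -- Consecutive vertices differ and there is no backtracking, so the first cycle has length at
  -- least three.
  have hs2 : s + 2 ≤ t := by
    by_contra h
    obtain rfl | h1 : s = t ∨ s + 1 = t := by omega
    · exact hne s (by omega) hclose
    · subst h1
      exact hnb s (by omega) hclose
  have hcolt : IsCollision u t := by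
    rcases (hjmin t (by omega)).fresh_or_collision (by
      rintro i rfl
      exact hnb i (by omega)) with h | h
    · exact absurd h hjf
    · exact h
  have huniq : ∀ m < q, IsCollision u m → m = t := by
    intro m hm h
    exact Finset.card_le_one.1 hcol m (mem_collisionTimes.2 ⟨hm, h⟩) t
      (mem_collisionTimes.2 ⟨by omega, hcolt⟩)
  by_cases hper : ∀ i, t < i → i ≤ q → u i = u (i - (t + 1 - s))
  · exact ⟨t, q, t + 1 - s, by omega, le_rfl, by omega, by omega, hinj',
      fun i h1 h2 => ⟨by omega, hper i h1 h2⟩, fun i j h1 h2 h3 => by omega⟩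
  -- The first failure of periodicity is the exit from the cycle; the periodic part ends one step
  -- earlier.
  have hex2 : ∃ i, t < i ∧ i ≤ q ∧ u i ≠ u (i - (t + 1 - s)) := by push Not at hper; exact hper
  obtain ⟨h1, h2, h3⟩ := Nat.find_spec hex2
  have hmin : ∀ i < Nat.find hex2, t < i → u i = u (i - (t + 1 - s)) := by
    intro i hi hti
    by_contra hf
    exact Nat.find_min hex2 hi ⟨hti, by omega, hf⟩
  set m := Nat.find hex2 with hm
  clear_value m
  have hm1 : m ≠ t + 1 := by
    rintro rfl
    apply h3
    rw [← hclose]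
    congr 1; omega
  refine ⟨t, m - 1, t + 1 - s, by omega, by omega, by omega, by omega, hinj',
      fun i h1 h2 => ⟨by omega, hmin i (by omega) h1⟩, ?_⟩
  refine injective_after_cycle (s := s) (t := t) (p := t + 1 - s) hne hnb huniq hinj' (by omega)
    (by omega) hclose.symm (fun i h1 h2 => hmin i (by omega) h1) (by omega) (by omega) ?_
  rwa [show m - 1 + 1 = m by omega]

end WalkCount

namespace WalkCount

variable {X : Type*}

/-! ### Encoding walks with few collisions -/

open Classical in
theorem exists_firstVisit (w : ℕ → X) (t : ℕ) : ∃ s, w s = w t := ⟨t, rfl⟩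

open Classical in
/-- The time of the first visit to the vertex visited at time `t`. -/
noncomputable def firstVisit (w : ℕ → X) (t : ℕ) : ℕ := Nat.find (exists_firstVisit w t)

theorem apply_firstVisit (w : ℕ → X) (t : ℕ) : w (firstVisit w t) = w t := by
  classical
  exact Nat.find_spec (exists_firstVisit w t)

theorem firstVisit_le (w : ℕ → X) (t : ℕ) : firstVisit w t ≤ t := by
  classical
  exact Nat.find_min' (exists_firstVisit w t) rfl

theorem ne_of_lt_firstVisit {w : ℕ → X} {s t : ℕ} (h : s < firstVisit w t) : w s ≠ w t := by
  classical
  exact Nat.find_min (exists_firstVisit w t) h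

theorem Fresh.firstVisit_eq {w : ℕ → X} {s t : ℕ} (h : Fresh w s) (hst : w s = w t) :
    firstVisit w t = s := by
  rcases Nat.lt_trichotomy (firstVisit w t) s with h1 | h1 | h1
  · exact absurd ((apply_firstVisit w t).trans hst.symm) (h _ h1)
  · exact h1
  · exact absurd hst (ne_of_lt_firstVisit h1)

theorem firstVisit_lt {w : ℕ → X} {t : ℕ} (h : ¬ Fresh w t) : firstVisit w t < t := by
  simp only [Fresh, not_forall, not_not] at h
  obtain ⟨s, hs, hst⟩ := h
  by_contra h1
  exact ne_of_lt_firstVisit (lt_of_lt_of_le hs (not_lt.1 h1)) hst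

theorem fresh_congr {u v : ℕ → X} {t : ℕ} (h : ∀ s ≤ t, u s = v s) : Fresh u t ↔ Fresh v t := by
  constructor <;> intro hf s hs
  · rw [← h s hs.le, ← h t le_rfl]; exact hf s hs
  · rw [h s hs.le, h t le_rfl]; exact hf s hs

theorem firstVisit_congr {u v : ℕ → X} {t : ℕ} (h : ∀ s ≤ t, u s = v s) :
    firstVisit u t = firstVisit v t := by
  have hf : Fresh v (firstVisit u t) := by
    intro s hs
    have h1 := firstVisit_le u t
    rw [← h s (by omega), ← h _ h1, apply_firstVisit u t]
    exact ne_of_lt_firstVisit hs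
  refine (hf.firstVisit_eq ?_).symm
  rw [← h _ (firstVisit_le u t), ← h t le_rfl, apply_firstVisit u t]

open Classical in
/-- The default continuation at an old vertex: proceed along the edges used at the first visit. -/
def Forced (w : ℕ → X) (t : ℕ) : Prop :=
  w (t + 1) = if w (t - 1) = w (firstVisit w t - 1) then w (firstVisit w t + 1)
    else w (firstVisit w t - 1)

/-- According to the window data `P`, step `t` repeats an earlier step. The data of a window of
length `r` are the beginning, the end and the period of its periodic part. -/
def Copying (r : ℕ) (P : ℕ → ℕ × ℕ × ℕ) (t : ℕ) : Prop :=
  (P (t / r)).1 < t % r + 1 ∧ t % r + 1 ≤ (P (t / r)).2.1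

/-- `P` describes the periodic parts of the windows of `w`. -/
def IsWindowData (w : ℕ → X) (m r : ℕ) (P : ℕ → ℕ × ℕ × ℕ) : Prop :=
  ∀ i < m, 1 ≤ (P i).2.2 ∧
    (∀ a b, a < b → b ≤ (P i).1 → w (i * r + a) ≠ w (i * r + b)) ∧
    (∀ a, (P i).1 < a → a ≤ (P i).2.1 →
      (P i).2.2 ≤ a ∧ w (i * r + a) = w (i * r + (a - (P i).2.2))) ∧
    (∀ a b, (P i).2.1 ≤ a → a < b → b ≤ r → w (i * r + a) ≠ w (i * r + b))

theorem IsWindowData.copy {w : ℕ → X} {m r : ℕ} {P : ℕ → ℕ × ℕ × ℕ} (h : IsWindowData w m r P)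
    {t : ℕ} (ht : t < m * r) (hc : Copying r P t) :
    1 ≤ (P (t / r)).2.2 ∧ (P (t / r)).2.2 ≤ t + 1 ∧ w (t + 1) = w (t + 1 - (P (t / r)).2.2) := by
  have hi : t / r < m := Nat.div_lt_of_lt_mul (by rwa [mul_comm] at ht)
  obtain ⟨h1, -, h2, -⟩ := h _ hi
  obtain ⟨h3, h4⟩ := h2 _ hc.1 hc.2
  have h5 : t / r * r + t % r = t := Nat.div_add_mod' t r
  refine ⟨h1, by omega, ?_⟩
  rw [show t / r * r + (t % r + 1) = t + 1 by omega] at h4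
  rw [h4]
  congr 1; omega

/-- A step which is not determined by the default rules. -/
def IsEvent (w : ℕ → X) (r mid : ℕ) (P : ℕ → ℕ × ℕ × ℕ) (t : ℕ) : Prop :=
  ¬ Copying r P t ∧ (t = 0 ∨ t = mid ∨ ¬ (Fresh w t ↔ Fresh w (t + 1)) ∨
    (¬ Fresh w t ∧ ¬ Fresh w (t + 1) ∧ ¬ Forced w t))

/-- A step from a vertex visited for the first time to another such vertex, by default. -/
def IsRegular (w : ℕ → X) (r mid : ℕ) (P : ℕ → ℕ × ℕ × ℕ) (t : ℕ) : Prop :=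
  ¬ Copying r P t ∧ ¬ IsEvent w r mid P t ∧ Fresh w t

open Classical in
/-- The information recorded at an event: a label of the next vertex if it is new, and the time of
the first visit to the next vertex if it is old. -/
noncomputable def eventData (nb : X → X → ℕ) (w : ℕ → X) (t : ℕ) : ℕ ⊕ ℕ :=
  if Fresh w (t + 1) then Sum.inl (nb (w t) (w (t + 1))) else Sum.inr (firstVisit w (t + 1))

open Classical in
/-- The list of all events among the first `N` steps. -/
noncomputable def eventTimes (w : ℕ → X) (r mid N : ℕ) (P : ℕ → ℕ × ℕ × ℕ) : Finset ℕ :=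
  (Finset.range N).filter (IsEvent w r mid P)

open Classical in
/-- All events among the first `N` steps, with the recorded information. -/
noncomputable def eventCode (nb : X → X → ℕ) (w : ℕ → X) (r mid N : ℕ) (P : ℕ → ℕ × ℕ × ℕ) :
    Finset (ℕ × (ℕ ⊕ ℕ)) :=
  (eventTimes w r mid N P).image (fun t => (t, eventData nb w t))

theorem mem_eventTimes {w : ℕ → X} {r mid N t : ℕ} {P : ℕ → ℕ × ℕ × ℕ} :
    t ∈ eventTimes w r mid N P ↔ t < N ∧ IsEvent w r mid P t := by
  classical
  simp [eventTimes]

theorem mem_eventCode {nb : X → X → ℕ} {w : ℕ → X} {r mid N : ℕ} {P : ℕ → ℕ × ℕ × ℕ} {t : ℕ}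
    {d : ℕ ⊕ ℕ} : (t, d) ∈ eventCode nb w r mid N P ↔
      t < N ∧ IsEvent w r mid P t ∧ d = eventData nb w t := by
  classical
  simp only [eventCode, Finset.mem_image, Prod.mk.injEq, mem_eventTimes]
  constructor
  · rintro ⟨t', ⟨h1, h2⟩, rfl, rfl⟩; exact ⟨h1, h2, rfl⟩
  · rintro ⟨h1, h2, rfl⟩; exact ⟨t, ⟨h1, h2⟩, rfl, rfl⟩

section Determination

variable {nb : X → X → ℕ} {u v : ℕ → X} {r mid m N : ℕ} {P : ℕ → ℕ × ℕ × ℕ}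

theorem isEvent_congr (hcode : eventCode nb u r mid N P = eventCode nb v r mid N P) {t : ℕ}
    (ht : t < N) : IsEvent u r mid P t ↔ IsEvent v r mid P t := by
  constructor <;> intro h
  · have : (t, eventData nb u t) ∈ eventCode nb u r mid N P := mem_eventCode.2 ⟨ht, h, rfl⟩
    rw [hcode] at this
    exact (mem_eventCode.1 this).2.1
  · have : (t, eventData nb v t) ∈ eventCode nb v r mid N P := mem_eventCode.2 ⟨ht, h, rfl⟩
    rw [← hcode] at this
    exact (mem_eventCode.1 this).2.1

theorem eventData_congr (hcode : eventCode nb u r mid N P = eventCode nb v r mid N P) {t : ℕ}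
    (ht : t < N) (h : IsEvent u r mid P t) : eventData nb u t = eventData nb v t := by
  have : (t, eventData nb u t) ∈ eventCode nb u r mid N P := mem_eventCode.2 ⟨ht, h, rfl⟩
  rw [hcode] at this
  exact (mem_eventCode.1 this).2.2

theorem IsWindowData.not_fresh (hu : IsWindowData u m r P) {t : ℕ} (ht : t < m * r)
    (hc : Copying r P t) : ¬ Fresh u (t + 1) := by
  obtain ⟨h1, h2, h3⟩ := hu.copy ht hc
  intro hf
  exact hf (t + 1 - (P (t / r)).2.2) (by omega) h3.symm

/-- Freshness can be decoded step by step: a copying step reaches an old vertex, an event records by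
`inl` or `inr` whether its target is new, and every other step leaves the freshness status
unchanged. -/
theorem fresh_iff_of_eventCode (hu : IsWindowData u m r P) (hv : IsWindowData v m r P)
    (hcode : eventCode nb u r mid (m * r) P = eventCode nb v r mid (m * r) P) :
    ∀ t ≤ m * r, (Fresh u t ↔ Fresh v t) := by
  intro t
  induction t with
  | zero => intro _; exact iff_of_true (fresh_zero u) (fresh_zero v)
  | succ t ih =>
    intro ht
    by_cases hc : Copying r P t
    · exact iff_of_false (hu.not_fresh (by omega) hc) (hv.not_fresh (by omega) hc)
    by_cases he : IsEvent u r mid P t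
    · have := eventData_congr hcode (by omega) he
      unfold eventData at this
      split_ifs at this <;> simp_all
    · have he' := (isEvent_congr hcode (by omega)).not.1 he
      have h1 : Fresh u t ↔ Fresh u (t + 1) := by
        by_contra h; exact he ⟨hc, Or.inr (Or.inr (Or.inl h))⟩
      have h2 : Fresh v t ↔ Fresh v (t + 1) := by
        by_contra h; exact he' ⟨hc, Or.inr (Or.inr (Or.inl h))⟩
      rw [← h1, ← h2]
      exact ih (by omega)

theorem isRegular_iff_of_eventCode (hu : IsWindowData u m r P) (hv : IsWindowData v m r P)
    (hcode : eventCode nb u r mid (m * r) P = eventCode nb v r mid (m * r) P) :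
    ∀ t < m * r, (IsRegular u r mid P t ↔ IsRegular v r mid P t) := by
  intro t ht
  unfold IsRegular
  rw [isEvent_congr hcode ht, fresh_iff_of_eventCode hu hv hcode t ht.le]

theorem IsRegular.fresh_succ {t : ℕ} (h : IsRegular u r mid P t) : Fresh u (t + 1) := by
  by_contra h1
  exact h.2.1 ⟨h.1, Or.inr (Or.inr (Or.inl (by simp [h.2.2, h1])))⟩

theorem IsRegular.ne_zero {t : ℕ} (h : IsRegular u r mid P t) : t ≠ 0 := by
  intro h1
  exact h.2.1 ⟨h.1, Or.inl h1⟩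

theorem IsRegular.ne_mid {t : ℕ} (h : IsRegular u r mid P t) : t ≠ mid := by
  intro h1
  exact h.2.1 ⟨h.1, Or.inr (Or.inl h1)⟩

/-- Decoding is by induction on time. A copying step repeats an earlier vertex, an event reads the
next vertex from the code, a regular step uses its label among the continuations `Nx`, and any other
step starts at an old vertex and is forced by the past. -/
theorem eq_of_code_eq {nx : X → X → X → ℕ} (Nb : X → Set X) (Nx : X → X → Set X)
    (hnb : ∀ x, Set.InjOn (nb x) (Nb x)) (hnx : ∀ x y, Set.InjOn (nx x y) (Nx x y))
    (hu : IsWindowData u m r P) (hv : IsWindowData v m r P)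
    (hu1 : ∀ t < m * r, u (t + 1) ∈ Nb (u t)) (hv1 : ∀ t < m * r, v (t + 1) ∈ Nb (v t))
    (hu2 : ∀ t < m * r, t ≠ 0 → t ≠ mid → u (t + 1) ∈ Nx (u (t - 1)) (u t))
    (hv2 : ∀ t < m * r, t ≠ 0 → t ≠ mid → v (t + 1) ∈ Nx (v (t - 1)) (v t))
    (h0 : u 0 = v 0) (hcode : eventCode nb u r mid (m * r) P = eventCode nb v r mid (m * r) P)
    (hlab : ∀ t < m * r, IsRegular u r mid P t →
      nx (u (t - 1)) (u t) (u (t + 1)) = nx (v (t - 1)) (v t) (v (t + 1))) :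
    ∀ t ≤ m * r, u t = v t := by
  suffices h : ∀ t ≤ m * r, ∀ s ≤ t, u s = v s from fun t ht => h t ht t le_rfl
  intro t
  induction t with
  | zero => intro _ s hs; obtain rfl : s = 0 := by omega
            exact h0
  | succ t ih =>
    intro ht s hs
    have IH := ih (by omega)
    rcases Nat.lt_or_ge t s with h1 | h1
    swap
    · exact IH s h1
    obtain rfl : s = t + 1 := by omega
    have hfr := fresh_iff_of_eventCode hu hv hcode
    by_cases hc : Copying r P t
    · obtain ⟨h2, h3, h4⟩ := hu.copy (by omega) hc
      obtain ⟨-, -, h5⟩ := hv.copy (by omega) hc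
      rw [h4, h5]
      exact IH _ (by omega)
    by_cases he : IsEvent u r mid P t
    · have hd := eventData_congr hcode (by omega) he
      unfold eventData at hd
      by_cases hf : Fresh u (t + 1)
      · rw [if_pos hf, if_pos ((hfr _ ht).1 hf), Sum.inl.injEq, IH t le_rfl] at hd
        exact hnb _ (by rw [← IH t le_rfl]; exact hu1 t (by omega)) (hv1 t (by omega)) hd
      · have hf' := (hfr _ ht).not.1 hf
        rw [if_neg hf, if_neg hf', Sum.inr.injEq] at hd
        rw [← apply_firstVisit u, ← apply_firstVisit v, hd]
        have := firstVisit_lt hf'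
        exact IH _ (by omega)
    · have he' := (isEvent_congr hcode (by omega)).not.1 he
      have ht0 : t ≠ 0 := fun h => he ⟨hc, Or.inl h⟩
      have htm : t ≠ mid := fun h => he ⟨hc, Or.inr (Or.inl h)⟩
      by_cases hf : Fresh u t
      · have h2 := hlab t (by omega) ⟨hc, he, hf⟩
        rw [IH (t - 1) (by omega), IH t le_rfl] at h2
        refine hnx _ _ ?_ (hv2 t (by omega) ht0 htm) h2
        rw [← IH (t - 1) (by omega), ← IH t le_rfl]
        exact hu2 t (by omega) ht0 htm
      · have hf' := (hfr t (by omega)).not.1 hf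
        have h1 : Fresh u t ↔ Fresh u (t + 1) := by
          by_contra h; exact he ⟨hc, Or.inr (Or.inr (Or.inl h))⟩
        have h2 : Fresh v t ↔ Fresh v (t + 1) := by
          by_contra h; exact he' ⟨hc, Or.inr (Or.inr (Or.inl h))⟩
        have h3 : Forced u t := by
          by_contra h; exact he ⟨hc, Or.inr (Or.inr (Or.inr ⟨hf, h1.not.1 hf, h⟩))⟩
        have h4 : Forced v t := by
          by_contra h; exact he' ⟨hc, Or.inr (Or.inr (Or.inr ⟨hf', h2.not.1 hf', h⟩))⟩
        unfold Forced at h3 h4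
        have h5 := firstVisit_lt hf
        have h6 : firstVisit u t = firstVisit v t := firstVisit_congr IH
        rw [h3, h4, ← h6, IH (t - 1) (by omega), IH (firstVisit u t - 1) (by omega),
          IH (firstVisit u t + 1) (by omega)]

end Determination

/-! ### Counting events -/

open Classical in
/-- The times at which a walk leaves the explored part. -/
noncomputable def restartTimes (w : ℕ → X) (N : ℕ) : Finset ℕ :=
  (Finset.range N).filter (fun t => ¬ Fresh w t ∧ Fresh w (t + 1))

open Classical in
/-- The vertices at which the explored part of the walk may branch. -/
noncomputable def branchVertices (w : ℕ → X) (N : ℕ) : Finset X :=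
  {w 0} ∪ (restartTimes w N).image w ∪ (collisionTimes w N).image w ∪
    (collisionTimes w N).image (fun t => w (t + 1))

-- For a predicate that holds at time `0`, falls and rises alternate, beginning with a fall; the
-- correction term is the last fall if it is not followed by a rise.
open Classical in
theorem rises_add_eq_falls (F : ℕ → Prop) (h0 : F 0) (N : ℕ) :
    ((Finset.range N).filter (fun t => ¬ F t ∧ F (t + 1))).card + (if F N then 0 else 1) =
      ((Finset.range N).filter (fun t => F t ∧ ¬ F (t + 1))).card := by
  induction N with
  | zero => simp [h0]
  | succ N ih =>
    rw [Finset.range_add_one, Finset.filter_insert, Finset.filter_insert]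
    by_cases h1 : F N <;> by_cases h2 : F (N + 1) <;> simp [h1, h2] at ih ⊢ <;> omega

section Events

variable {w : ℕ → X} {N mid T : ℕ}

theorem Fresh.isCollision_of_not_fresh (hnb : ∀ t, t + 2 ≤ N → t + 1 ≠ mid → w t ≠ w (t + 2))
    {t : ℕ} (ht : t < N) (htm : t ≠ mid) (h1 : Fresh w t) (h2 : ¬ Fresh w (t + 1)) :
    IsCollision w t := by
  rcases h1.fresh_or_collision (by
    rintro s rfl
    exact hnb s (by omega) htm) with h | h
  · exact absurd h h2
  · exact h

/-- Each restart is preceded by its own passage from a fresh vertex to an old one. Such a passage is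
a collision unless it happens at `mid`, the only place where backtracking is allowed. -/
theorem card_restartTimes_le (hnb : ∀ t, t + 2 ≤ N → t + 1 ≠ mid → w t ≠ w (t + 2))
    (hcol : collisions w N ≤ T) : (restartTimes w N).card ≤ T + 1 := by
  classical
  have h := rises_add_eq_falls (Fresh w) (fresh_zero w) N
  have h1 : ((Finset.range N).filter (fun t => Fresh w t ∧ ¬ Fresh w (t + 1))) ⊆
      insert mid (collisionTimes w N) := by
    intro t ht
    simp only [Finset.mem_filter, Finset.mem_range] at ht
    rw [Finset.mem_insert, mem_collisionTimes]
    by_cases htm : t = mid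
    · exact Or.inl htm
    · exact Or.inr ⟨ht.1, ht.2.1.isCollision_of_not_fresh hnb ht.1 htm ht.2.2⟩
  have h2 := (Finset.card_le_card h1).trans (Finset.card_insert_le _ _)
  unfold collisions at hcol
  unfold restartTimes
  omega

/-- The count is `1 + (T + 1) + T + T`: the start, the restarts, and both ends of the collision
steps. -/
theorem card_branchVertices_le (hnb : ∀ t, t + 2 ≤ N → t + 1 ≠ mid → w t ≠ w (t + 2))
    (hcol : collisions w N ≤ T) : (branchVertices w N).card ≤ 3 * T + 2 := by
  classical
  have h1 := card_restartTimes_le hnb hcol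
  unfold collisions at hcol
  unfold branchVertices
  refine (Finset.card_union_le _ _).trans ?_
  have h2 := Finset.card_union_le ({w 0} ∪ (restartTimes w N).image w) ((collisionTimes w N).image w)
  have h3 := Finset.card_union_le {w 0} ((restartTimes w N).image w)
  have h4 := Finset.card_image_le (s := restartTimes w N) (f := w)
  have h5 := Finset.card_image_le (s := collisionTimes w N) (f := w)
  have h6 := Finset.card_image_le (s := collisionTimes w N) (f := fun t => w (t + 1))
  rw [Finset.card_singleton] at h3
  omega

/-- Outside the branch vertices the explored graph has degree at most two. Consider the first
traversal of an edge at such a vertex: since it is no collision, its head is fresh. If the vertex is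
the head, this is its first visit; if it is the tail, it cannot be a restart, so the edge leaves it
at its first visit. -/
theorem eq_or_eq_of_not_mem_branchVertices {t i : ℕ} (hi : i < N) {y : X}
    (hx : w t ∉ branchVertices w N) (he : s(w i, w (i + 1)) = s(w t, y)) :
    y = w (firstVisit w t - 1) ∨ y = w (firstVisit w t + 1) := by
  classical
  obtain ⟨j, hj, hnew, hje⟩ := exists_newEdge_eq w i
  rw [← hje] at he
  simp only [branchVertices, restartTimes, Finset.mem_union, Finset.mem_image, Finset.mem_filter,
    Finset.mem_range, mem_collisionTimes, not_or, not_exists, not_and, and_imp,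
    Finset.mem_singleton] at hx
  obtain ⟨⟨⟨_, h1⟩, h2⟩, h3⟩ := hx
  rw [Sym2.eq_iff] at he
  have hf : Fresh w (j + 1) := by
    by_contra hf
    rcases he with ⟨h4, _⟩ | ⟨_, h4⟩
    · exact h2 j (by omega) ⟨hnew, hf⟩ h4
    · exact h3 j (by omega) ⟨hnew, hf⟩ h4
  rcases he with ⟨h4, h5⟩ | ⟨h4, h5⟩
  · right
    have hfj : Fresh w j := by
      by_contra h
      exact h1 j (by omega) h hf h4
    rw [hfj.firstVisit_eq h4, h5]
  · left
    rw [hf.firstVisit_eq h5, ← h4]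
    rfl

/-- At a vertex with at most two explored edges, a walk that arrives by one and does not backtrack
must leave by the other. -/
theorem forced_of_not_mem_branchVertices
    (hnb : ∀ t, t + 2 ≤ N → t + 1 ≠ mid → w t ≠ w (t + 2)) {t : ℕ} (ht : t < N) (ht0 : t ≠ 0)
    (htm : t ≠ mid) (hx : w t ∉ branchVertices w N) : Forced w t := by
  obtain ⟨t, rfl⟩ : ∃ s, t = s + 1 := ⟨t - 1, by omega⟩
  have h1 := eq_or_eq_of_not_mem_branchVertices (i := t + 1) ht hx rfl
  have h2 := eq_or_eq_of_not_mem_branchVertices (i := t) (by omega) hx Sym2.eq_swap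
  have h3 := hnb t (by omega) htm
  unfold Forced
  rw [Nat.add_sub_cancel]
  split_ifs with h
  · rcases h1 with h1 | h1
    · exact absurd (h.trans h1.symm) h3
    · exact h1
  · rcases h1 with h1 | h1
    · exact h1
    · rcases h2 with h2 | h2
      · exact absurd h2 h
      · exact absurd (h2.trans h1.symm) h3

/-- Besides `0`, `mid`, collisions and restarts, an event can only occur at a branch vertex and
outside the periodic part of its window. Each window has two self-avoiding parts, and each of them
meets every branch vertex at most once. -/
theorem card_eventTimes_le {m r : ℕ} {P : ℕ → ℕ × ℕ × ℕ} (hr : 0 < r)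
    (hP : IsWindowData w m r P)
    (hnb : ∀ t, t + 2 ≤ m * r → t + 1 ≠ mid → w t ≠ w (t + 2))
    (hcol : collisions w (m * r) ≤ T) :
    (eventTimes w r mid (m * r) P).card ≤ 2 + T + (T + 1) + m * (2 * (3 * T + 2)) := by
  classical
  set N := m * r with hN
  set Br := branchVertices w N with hBr
  set I₁ : ℕ → Finset ℕ := fun i =>
    ((Finset.range r).filter (fun a => a < (P i).1 ∧ w (i * r + a) ∈ Br)).image (fun a => i * r + a)
  set I₂ : ℕ → Finset ℕ := fun i =>
    ((Finset.range r).filter (fun a => (P i).2.1 ≤ a ∧ w (i * r + a) ∈ Br)).image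
      (fun a => i * r + a)
  have hsub : eventTimes w r mid N P ⊆ ({0, mid} ∪ collisionTimes w N ∪ restartTimes w N) ∪
      (Finset.range m).biUnion (fun i => I₁ i ∪ I₂ i) := by
    intro t ht
    obtain ⟨htN, hc, he⟩ := mem_eventTimes.1 ht
    rw [Finset.mem_union]
    by_contra hcon
    rw [not_or] at hcon
    obtain ⟨hc1, hc2⟩ := hcon
    simp only [Finset.mem_union, Finset.mem_insert, Finset.mem_singleton, not_or,
      mem_collisionTimes, restartTimes, Finset.mem_filter, Finset.mem_range, not_and] at hc1
    obtain ⟨⟨⟨h0, hm⟩, hcl⟩, hrs⟩ := hc1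
    have hbr : w t ∈ Br := by
      by_contra hb
      have hF := forced_of_not_mem_branchVertices hnb htN h0 hm hb
      rcases he with he | he | he | ⟨_, _, he⟩
      · exact h0 he
      · exact hm he
      · by_cases hf : Fresh w t
        · by_cases hf1 : Fresh w (t + 1)
          · exact he (iff_of_true hf hf1)
          · exact hcl htN (hf.isCollision_of_not_fresh hnb htN hm hf1)
        · exact he (iff_of_false hf (hrs htN hf))
      · exact he hF
    apply hc2
    have h5 : t / r * r + t % r = t := Nat.div_add_mod' t r
    have h6 : t % r < r := Nat.mod_lt _ hr
    rw [Finset.mem_biUnion]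
    refine ⟨t / r, Finset.mem_range.2 (Nat.div_lt_of_lt_mul (by rw [mul_comm, ← hN]; exact htN)), ?_⟩
    rw [Finset.mem_union]
    simp only [Copying, not_and_or, not_lt, not_le] at hc
    rcases hc with hc | hc
    · left
      exact Finset.mem_image.2 ⟨t % r, by simp [h6, h5, hbr]; omega, h5⟩
    · right
      exact Finset.mem_image.2 ⟨t % r, by simp [h6, h5, hbr]; omega, h5⟩
  have hBc : Br.card ≤ 3 * T + 2 := card_branchVertices_le hnb hcol
  have hI : ∀ i ∈ Finset.range m, (I₁ i ∪ I₂ i).card ≤ 2 * (3 * T + 2) := by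
    intro i hi
    obtain ⟨-, hA, -, hB⟩ := hP i (Finset.mem_range.1 hi)
    have h1 : (I₁ i).card ≤ Br.card := by
      refine Finset.card_image_le.trans (Finset.card_le_card_of_injOn (fun a => w (i * r + a)) ?_ ?_)
      · intro a ha; simp at ha; simpa using ha.2.2
      · intro a ha b hb hab
        simp at ha hb
        rcases Nat.lt_trichotomy a b with h | h | h
        · exact absurd hab (hA a b h hb.2.1.le)
        · exact h
        · exact absurd hab.symm (hA b a h ha.2.1.le)
    have h2 : (I₂ i).card ≤ Br.card := by
      refine Finset.card_image_le.trans (Finset.card_le_card_of_injOn (fun a => w (i * r + a)) ?_ ?_)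
      · intro a ha; simp at ha; simpa using ha.2.2
      · intro a ha b hb hab
        simp at ha hb
        rcases Nat.lt_trichotomy a b with h | h | h
        · exact absurd hab (hB a b ha.2.1 h hb.1.le)
        · exact h
        · exact absurd hab.symm (hB b a hb.2.1 h ha.1.le)
    have := Finset.card_union_le (I₁ i) (I₂ i)
    omega
  refine (Finset.card_le_card hsub).trans ((Finset.card_union_le _ _).trans ?_)
  have h1 := Finset.card_biUnion_le_card_mul (Finset.range m) (fun i => I₁ i ∪ I₂ i) _ hI
  rw [Finset.card_range] at h1
  have h2 := card_restartTimes_le hnb hcol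
  have h3 := Finset.card_union_le ({0, mid} ∪ collisionTimes w N) (restartTimes w N)
  have h4 := Finset.card_union_le {0, mid} (collisionTimes w N)
  have h5 : ({0, mid} : Finset ℕ).card ≤ 2 := Finset.card_le_two
  unfold collisions at hcol
  omega

end Events

end WalkCount

namespace WalkCount

variable {X : Type*}

/-! ### The number of walks with few collisions -/

theorem sum_choose_le_pow (x M : ℕ) : ∑ i ∈ Finset.range (M + 1), x.choose i ≤ (x + 1) ^ M := by
  rw [add_pow]
  refine Finset.sum_le_sum fun i hi => ?_
  rw [one_pow, mul_one]
  have h1 : 1 ≤ M.choose i := Nat.choose_pos (by simpa [Nat.lt_succ_iff] using hi)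
  exact (Nat.choose_le_pow x i).trans (Nat.le_mul_of_pos_right _ h1)

theorem card_powerset_filter_card_le {Y : Type*} (s : Finset Y) (M : ℕ) :
    (s.powerset.filter (fun t => t.card ≤ M)).card ≤ (s.card + 1) ^ M := by
  classical
  refine le_trans ?_ (sum_choose_le_pow s.card M)
  have : s.powerset.filter (fun t => t.card ≤ M) ⊆
      (Finset.range (M + 1)).biUnion (fun i => s.powersetCard i) := by
    intro t ht
    simp only [Finset.mem_filter, Finset.mem_powerset] at ht
    simp only [Finset.mem_biUnion, Finset.mem_range, Finset.mem_powersetCard]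
    exact ⟨t.card, by omega, ht.1, rfl⟩
  refine (Finset.card_le_card this).trans (Finset.card_biUnion_le.trans ?_)
  simp [Finset.card_powersetCard]

theorem exists_label (s : Finset X) : ∃ f : X → ℕ, Set.InjOn f s ∧ ∀ x ∈ s, f x < s.card := by
  classical
  refine ⟨fun x => if h : x ∈ s then (s.equivFin ⟨x, h⟩ : ℕ) else 0, ?_, ?_⟩
  · intro x hx y hy hxy
    simp only [Finset.mem_coe] at hx hy
    simp only [hx, hy, dif_pos] at hxy
    have := s.equivFin.injective (Fin.ext hxy)
    simpa using this
  · intro x hx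
    simp only [hx, dif_pos]
    exact (s.equivFin ⟨x, hx⟩).2

/-- Window data given by finitely many bounded numbers. -/
def extendWindowData {m r : ℕ} (p : Fin m → Fin (r + 2) × Fin (r + 2) × Fin (r + 2)) (i : ℕ) :
    ℕ × ℕ × ℕ :=
  if h : i < m then ((p ⟨i, h⟩).1, (p ⟨i, h⟩).2.1, (p ⟨i, h⟩).2.2) else 0

/-- As `r` divides `mid`, the only possible backtrack lies at a window boundary. Inside the windows
the walk is non-backtracking, and `exists_window_structure` applies. The period may be as large as
`r + 1`, hence the range `Fin (r + 2)`. -/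
theorem exists_windowData {w : ℕ → X} {m r mid : ℕ} (hmid : r ∣ mid)
    (hne : ∀ t < m * r, w t ≠ w (t + 1))
    (hnb : ∀ t, t + 2 ≤ m * r → t + 1 ≠ mid → w t ≠ w (t + 2))
    (hwin : ∀ i < m, collisions (fun a => w (i * r + a)) r ≤ 1) :
    ∃ p : Fin m → Fin (r + 2) × Fin (r + 2) × Fin (r + 2),
      IsWindowData w m r (extendWindowData p) := by
  have key : ∀ i : Fin m, ∃ p : Fin (r + 2) × Fin (r + 2) × Fin (r + 2), 1 ≤ (p.2.2 : ℕ) ∧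
    (∀ a b, a < b → b ≤ (p.1 : ℕ) → w (i * r + a) ≠ w (i * r + b)) ∧
    (∀ a, (p.1 : ℕ) < a → a ≤ (p.2.1 : ℕ) →
      (p.2.2 : ℕ) ≤ a ∧ w (i * r + a) = w (i * r + (a - (p.2.2 : ℕ)))) ∧
    (∀ a b, (p.2.1 : ℕ) ≤ a → a < b → b ≤ r → w (i * r + a) ≠ w (i * r + b)) := by
    rintro ⟨i, hi⟩
    have hir : i * r + r ≤ m * r := by
      have : (i + 1) * r ≤ m * r := Nat.mul_le_mul_right r hi
      linarith
    obtain ⟨t, t₂, p, h1, h2, h3, h4, h5, h6, h7⟩ := exists_window_structure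
      (u := fun a => w (i * r + a)) (q := r) (fun t ht => hne _ (by omega))
      (fun t ht => hnb _ (by omega) (by
        obtain ⟨d, rfl⟩ := hmid
        intro h
        have h1 : i * r < r * d := by omega
        have h2 : r * d < (i + 1) * r := by linarith
        rw [mul_comm r d] at h1 h2
        have h3 := lt_of_mul_lt_mul_right h1 (Nat.zero_le r)
        have h4 := lt_of_mul_lt_mul_right h2 (Nat.zero_le r)
        omega)) (hwin i hi)
    exact ⟨(⟨t, by omega⟩, ⟨t₂, by omega⟩, ⟨p, by omega⟩), h3, h5, h6, h7⟩
  choose p hp using key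
  refine ⟨p, fun i hi => ?_⟩
  simp only [extendWindowData, hi, dif_pos]
  exact hp ⟨i, hi⟩

/-- The bound on the number of events used in `card_walks_le`. -/
def eventBound (T m : ℕ) : ℕ := 2 + T + (T + 1) + m * (2 * (3 * T + 2))

/-- A regular step joins two fresh vertices, one of them at an odd time. Sending the step to that
vertex is injective, because fresh vertices at different times are different. -/
theorem card_regular_le {w : ℕ → X} {N r mid ℓ : ℕ} {P : ℕ → ℕ × ℕ × ℕ} (Y : Finset X)
    (hodd : ∀ t ≤ N, Odd t → w t ∈ Y) (hY : Y.card ≤ ℓ) (I : Finset ℕ)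
    (hI : ∀ t ∈ I, t < N ∧ IsRegular w r mid P t) (e : ℕ)
    (he : e ≤ 1) (hpar : ∀ t ∈ I, Odd (t + e)) : I.card ≤ ℓ := by
  refine le_trans (Finset.card_le_card_of_injOn (fun t => w (t + e)) ?_ ?_) hY
  · intro t ht
    exact hodd _ (by have := (hI t ht).1; omega) (hpar t ht)
  · have hfr : ∀ t ∈ I, Fresh w (t + e) := by
      intro t ht
      obtain rfl | rfl : e = 0 ∨ e = 1 := by omega
      · exact (hI t ht).2.2.2
      · exact (hI t ht).2.fresh_succ
    intro s hs t ht hst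
    simp only at hst
    rcases Nat.lt_trichotomy s t with h | h | h
    · exact absurd hst (hfr t ht _ (by omega))
    · exact h
    · exact absurd hst.symm (hfr s hs _ (by omega))

/-- The number of walks of length `m * r` that backtrack at most at time `mid`, have at most `T`
collisions, at most one collision in each window of length `r`, and visit at most `ℓ` different
vertices at odd times. -/
theorem card_walks_le {A : Type*} (S : Finset A) (w : A → ℕ → X) {m r mid T ℓ Δ d₁ d₂ : ℕ}
    (hr : 0 < r) (hmid : r ∣ mid) (hd₁ : 1 ≤ d₁) (hd₂ : 1 ≤ d₂)
    (V₀ : Finset X) (Nb : X → Finset X) (Nx : X → X → Finset X)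
    (hinj : ∀ a ∈ S, ∀ b ∈ S, (∀ t ≤ m * r, w a t = w b t) → a = b)
    (hne : ∀ a ∈ S, ∀ t < m * r, w a t ≠ w a (t + 1))
    (hnb : ∀ a ∈ S, ∀ t, t + 2 ≤ m * r → t + 1 ≠ mid → w a t ≠ w a (t + 2))
    (hcol : ∀ a ∈ S, collisions (w a) (m * r) ≤ T)
    (hwin : ∀ a ∈ S, ∀ i < m, collisions (fun b => w a (i * r + b)) r ≤ 1)
    (hodd : ∀ a ∈ S, ∃ Y : Finset X, Y.card ≤ ℓ ∧ ∀ t ≤ m * r, Odd t → w a t ∈ Y)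
    (h0 : ∀ a ∈ S, w a 0 ∈ V₀)
    (hNb : ∀ a ∈ S, ∀ t < m * r, w a (t + 1) ∈ Nb (w a t)) (hΔ : ∀ x, (Nb x).card ≤ Δ)
    (hNx : ∀ a ∈ S, ∀ t < m * r, t ≠ 0 → t ≠ mid → w a (t + 1) ∈ Nx (w a (t - 1)) (w a t))
    (hd : ∀ a ∈ S, ∀ t < m * r, t ≠ 0 → t ≠ mid →
      (Nx (w a (t - 1)) (w a t)).card ≤ if Even t then d₁ else d₂) :
    S.card ≤ (d₁ * d₂) ^ ℓ * (V₀.card * (((r + 2) * ((r + 2) * (r + 2))) ^ m *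
      (m * r * (Δ + (m * r + 1)) + 1) ^ eventBound T m)) := by
  classical
  choose nb hnb1 hnb2 using fun x => exists_label (Nb x)
  choose nx hnx1 hnx2 using fun x y => exists_label (Nx x y)
  have hex : ∀ a, ∃ p : Fin m → Fin (r + 2) × Fin (r + 2) × Fin (r + 2), a ∈ S →
      IsWindowData (w a) m r (extendWindowData p) := by
    intro a
    by_cases ha : a ∈ S
    · obtain ⟨p, hp⟩ := exists_windowData hmid (hne a ha) (hnb a ha) (hwin a ha)
      exact ⟨p, fun _ => hp⟩
    · exact ⟨fun _ => 0, fun h => absurd h ha⟩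
  choose p hp using hex
  set N := m * r with hN
  -- The code contains everything except the labels of the regular steps, which carry the
  -- exponential part of the count.
  set code : A → X × (Fin m → Fin (r + 2) × Fin (r + 2) × Fin (r + 2)) × Finset (ℕ × (ℕ ⊕ ℕ)) :=
    fun a => (w a 0, p a, eventCode nb (w a) r mid N (extendWindowData (p a))) with hcode
  set D := (Finset.range N) ×ˢ ((Finset.range Δ).disjSum (Finset.range (N + 1))) with hD
  have hDcard : D.card = N * (Δ + (N + 1)) := by simp [hD]
  have himage : S.image code ⊆ V₀ ×ˢ (Finset.univ ×ˢ
      (D.powerset.filter (fun t => t.card ≤ eventBound T m))) := by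
    intro x hx
    obtain ⟨a, ha, rfl⟩ := Finset.mem_image.1 hx
    simp only [hcode, Finset.mem_product, Finset.mem_univ, true_and, Finset.mem_filter,
      Finset.mem_powerset]
    refine ⟨h0 a ha, ?_, ?_⟩
    · rintro ⟨t, d⟩ htd
      obtain ⟨h1, h2, rfl⟩ := mem_eventCode.1 htd
      simp only [hD, Finset.mem_product, Finset.mem_range, h1, true_and]
      unfold eventData
      split_ifs with hf
      · rw [Finset.inl_mem_disjSum, Finset.mem_range]
        exact (hnb2 _ _ (hNb a ha t h1)).trans_le (hΔ _)
      · rw [Finset.inr_mem_disjSum, Finset.mem_range]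
        have := firstVisit_le (w a) (t + 1)
        omega
    · exact Finset.card_image_le.trans (card_eventTimes_le hr (hp a ha) (hnb a ha) (hcol a ha))
  -- The code determines which times are regular, so within a fibre a walk is given by its labels
  -- there: one of `d₁` at even and one of `d₂` at odd times, with at most `ℓ` times of each parity.
  have hfib : ∀ x ∈ S.image code, (S.filter (fun a => code a = x)).card ≤ (d₁ * d₂) ^ ℓ := by
    intro x hx
    obtain ⟨a₀, ha₀, rfl⟩ := Finset.mem_image.1 hx
    set Reg := (Finset.range N).filter (IsRegular (w a₀) r mid (extendWindowData (p a₀))) with hReg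
    set Lab : Finset ((t : ℕ) → t ∈ Reg → ℕ) :=
      Reg.pi (fun t => Finset.range (if Even t then d₁ else d₂)) with hLab
    have hLabcard : Lab.card ≤ (d₁ * d₂) ^ ℓ := by
      rw [hLab, Finset.card_pi]
      simp only [Finset.card_range]
      rw [Finset.prod_ite, Finset.prod_const, Finset.prod_const, mul_pow]
      obtain ⟨Y, hY1, hY2⟩ := hodd a₀ ha₀
      refine Nat.mul_le_mul (Nat.pow_le_pow_right hd₁ ?_) (Nat.pow_le_pow_right hd₂ ?_)
      · refine card_regular_le (r := r) (mid := mid) (P := extendWindowData (p a₀)) Y hY2 hY1 _ ?_ 1 le_rfl ?_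
        · intro t ht
          simpa [hReg] using (Finset.mem_filter.1 ht).1
        · intro t ht
          exact (Finset.mem_filter.1 ht).2.add_one
      · refine card_regular_le (r := r) (mid := mid) (P := extendWindowData (p a₀)) Y hY2 hY1 _ ?_ 0 (by omega) ?_
        · intro t ht
          simpa [hReg] using (Finset.mem_filter.1 ht).1
        · intro t ht
          exact Nat.not_even_iff_odd.1 (Finset.mem_filter.1 ht).2
    refine le_trans ?_ hLabcard
    have hcodeeq : ∀ a, code a = code a₀ → w a 0 = w a₀ 0 ∧ p a = p a₀ ∧
        eventCode nb (w a) r mid N (extendWindowData (p a)) =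
          eventCode nb (w a₀) r mid N (extendWindowData (p a₀)) := by
      intro a h
      simpa [hcode] using h
    have hreg : ∀ a ∈ S, code a = code a₀ → ∀ t ∈ Reg,
        t < N ∧ IsRegular (w a) r mid (extendWindowData (p a₀)) t := by
      intro a ha h t ht
      obtain ⟨-, h2, h3⟩ := hcodeeq a h
      rw [h2] at h3
      have ht' : t < N ∧ IsRegular (w a₀) r mid (extendWindowData (p a₀)) t := by
        simpa [hReg] using ht
      have hpa := hp a ha
      rw [h2] at hpa
      exact ⟨ht'.1, (isRegular_iff_of_eventCode hpa (hp a₀ ha₀) h3 t ht'.1).2 ht'.2⟩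
    refine Finset.card_le_card_of_injOn
      (fun a t _ => nx (w a (t - 1)) (w a t) (w a (t + 1))) ?_ ?_
    · intro a ha
      obtain ⟨ha, hca⟩ := Finset.mem_filter.1 ha
      rw [hLab, Finset.mem_coe, Finset.mem_pi]
      intro t ht
      obtain ⟨h1, h2⟩ := hreg a ha hca t ht
      rw [Finset.mem_range]
      exact (hnx2 _ _ _ (hNx a ha t h1 h2.ne_zero h2.ne_mid)).trans_le
        (hd a ha t h1 h2.ne_zero h2.ne_mid)
    · intro a ha b hb hab
      obtain ⟨ha, hca⟩ := Finset.mem_filter.1 ha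
      obtain ⟨hb, hcb⟩ := Finset.mem_filter.1 hb
      obtain ⟨ha1, ha2, ha3⟩ := hcodeeq a hca
      obtain ⟨hb1, hb2, hb3⟩ := hcodeeq b hcb
      have hpa := hp a ha
      have hpb := hp b hb
      rw [ha2] at ha3 hpa
      rw [hb2] at hb3 hpb
      refine hinj a ha b hb (eq_of_code_eq (nx := nx) (fun x => Nb x) (fun x y => Nx x y) hnb1 hnx1
        hpa hpb (hNb a ha) (hNb b hb) (hNx a ha) (hNx b hb) (ha1.trans hb1.symm)
        (ha3.trans hb3.symm) ?_)
      intro t ht hrt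
      have htR : t ∈ Reg := by
        simp only [hReg, Finset.mem_filter, Finset.mem_range]
        exact ⟨ht, (isRegular_iff_of_eventCode hpa (hp a₀ ha₀) ha3 t ht).1 hrt⟩
      exact congrFun (congrFun hab t) htR
  refine (Finset.card_le_mul_card_image S _ hfib).trans (Nat.mul_le_mul_left _ ?_)
  refine (Finset.card_le_card himage).trans ?_
  rw [Finset.card_product, Finset.card_product]
  refine Nat.mul_le_mul_left _ (Nat.mul_le_mul (le_of_eq ?_) ?_)
  · simp
  · rw [← hDcard]
    exact card_powerset_filter_card_le D _

end WalkCount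

/-! ### Collisions in random lifts -/

namespace WalkCount

variable {X : Type*}

theorem newEdge_congr {u v : ℕ → X} {t : ℕ} (h : ∀ s ≤ t + 1, u s = v s) :
    NewEdge u t ↔ NewEdge v t := by
  unfold NewEdge
  refine forall₂_congr fun s hs => ?_
  rw [h s (by omega), h (s + 1) (by omega), h t (by omega), h (t + 1) le_rfl]

theorem isCollision_congr {u v : ℕ → X} {t : ℕ} (h : ∀ s ≤ t + 1, u s = v s) :
    IsCollision u t ↔ IsCollision v t := by
  unfold IsCollision
  rw [newEdge_congr h, fresh_congr h]

theorem collisions_congr {u v : ℕ → X} {N : ℕ} (h : ∀ s ≤ N, u s = v s) :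
    collisions u N = collisions v N := by
  unfold collisions
  congr 1
  ext t
  simp only [mem_collisionTimes]
  refine and_congr_right fun ht => isCollision_congr fun s hs => h s (by omega)

open Classical in
theorem collisions_succ (w : ℕ → X) (N : ℕ) :
    collisions w (N + 1) = collisions w N + if IsCollision w N then 1 else 0 := by
  unfold collisions collisionTimes
  rw [Finset.range_add_one, Finset.filter_insert]
  split_ifs with h
  · rw [Finset.card_insert_of_notMem (by simp)]
  · rfl

end WalkCount

/-! ### Exposing the permutations of a random lift along a walk -/

namespace RandomLift

open WalkCount

variable {ι : Type} {c n : ℕ}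

/-- The vertices of the constraint graph: variables and constraints. -/
abbrev Vtx (ι : Type) (c n : ℕ) : Type := (ι × Fin n) ⊕ (Fin c × Fin n)

/-- The neighbour of a vertex of the constraint graph in direction `l`. -/
def nbr (σ : ConstraintLift ι c n) : Vtx ι c n → Fin c × ι → Vtx ι c n
  | Sum.inl x, l => Sum.inr (l.1, (σ (x.1, l.1)).symm x.2)
  | Sum.inr f, l => Sum.inl (l.2, σ (l.2, f.1) f.2)

/-- The value of a permutation that is used in a step of a walk. -/
def stepTriple (σ : ConstraintLift ι c n) : Vtx ι c n → Fin c × ι → (ι × Fin c) × Fin n × Fin n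
  | Sum.inl x, l => ((x.1, l.1), (σ (x.1, l.1)).symm x.2, x.2)
  | Sum.inr f, l => ((l.2, f.1), f.2, σ (l.2, f.1) f.2)

/-- The walk that follows the directions `l`. -/
def wordWalk (σ : ConstraintLift ι c n) (x : Vtx ι c n) (l : ℕ → Fin c × ι) : ℕ → Vtx ι c n
  | 0 => x
  | t + 1 => nbr σ (wordWalk σ x l t) (l t)

theorem nbr_eq_iff (σ τ : ConstraintLift ι c n) (x : Vtx ι c n) (l : Fin c × ι) :
    nbr τ x l = nbr σ x l ↔
      τ (stepTriple σ x l).1 (stepTriple σ x l).2.1 = (stepTriple σ x l).2.2 := by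
  rcases x with x | f
  · simp only [nbr, stepTriple, Sum.inr.injEq, Prod.mk.injEq, true_and]
    rw [Equiv.symm_apply_eq, eq_comm]
  · simp [nbr, stepTriple]

theorem stepTriple_congr {σ τ : ConstraintLift ι c n} {x : Vtx ι c n} {l : Fin c × ι}
    (h : nbr τ x l = nbr σ x l) : stepTriple τ x l = stepTriple σ x l := by
  rcases x with x | f
  · simp only [nbr, Sum.inr.injEq, Prod.mk.injEq, true_and] at h
    simp [stepTriple, h]
  · simp only [nbr, Sum.inl.injEq, Prod.mk.injEq, true_and] at h
    simp [stepTriple, h]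

/-- The exposed value determines the undirected edge, so a new edge always exposes a new value. -/
theorem edge_eq_of_stepTriple (σ : ConstraintLift ι c n) (x : Vtx ι c n) (l : Fin c × ι) :
    s(x, nbr σ x l) = s(Sum.inl ((stepTriple σ x l).1.1, (stepTriple σ x l).2.2),
      Sum.inr ((stepTriple σ x l).1.2, (stepTriple σ x l).2.1)) := by
  rcases x with x | f
  · rfl
  · exact Sym2.eq_swap

variable [Fintype ι] [DecidableEq ι]

/-- The lifts with prescribed values. -/
def lifts (π : Finset ((ι × Fin c) × Fin n × Fin n)) : Finset (ConstraintLift ι c n) :=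
  Finset.univ.filter (fun σ => ∀ e ∈ π, σ e.1 e.2.1 = e.2.2)

theorem mem_lifts {π : Finset ((ι × Fin c) × Fin n × Fin n)} {σ : ConstraintLift ι c n} :
    σ ∈ lifts π ↔ ∀ e ∈ π, σ e.1 e.2.1 = e.2.2 := by
  simp [lifts]

/-- Prescribing a further value divides the number of lifts at least by the number of values that
are still free. -/
theorem card_lifts_insert_mul_le (π : Finset ((ι × Fin c) × Fin n × Fin n))
    {e : (ι × Fin c) × Fin n × Fin n} (he : e ∉ π) :
    (lifts (insert e π)).card * (n - π.card) ≤ (lifts π).card := by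
  classical
  rcases (lifts (insert e π)).eq_empty_or_nonempty with h0 | ⟨σ₀, hσ₀⟩
  · simp [h0]
  obtain ⟨p, b, a⟩ := e
  rw [mem_lifts] at hσ₀
  have h0 : σ₀ p b = a := hσ₀ (p, b, a) (Finset.mem_insert_self _ _)
  have hb : ∀ a', (p, b, a') ∉ π := by
    intro a' h
    have h1 : σ₀ p b = a' := hσ₀ (p, b, a') (Finset.mem_insert_of_mem h)
    rw [← h1, h0] at h
    exact he h
  -- Inputs that `π` does not mention for any permutation. This may omit some inputs that are free
  -- for `p`, but at least `n - π.card` remain.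
  set Fr : Finset (Fin n) := Finset.univ \ π.image (fun e => e.2.1) with hFr
  have hFrc : n - π.card ≤ Fr.card := by
    have h1 : (Finset.univ : Finset (Fin n)).card - (π.image (fun e => e.2.1)).card ≤ Fr.card :=
      Finset.le_card_sdiff _ _
    have h2 := Finset.card_image_le (s := π) (f := fun e => e.2.1)
    rw [Finset.card_univ, Fintype.card_fin] at h1
    omega
  refine (Nat.mul_le_mul_left _ hFrc).trans ?_
  rw [← Finset.card_product]
  -- Composing with the transposition of `b` and a free input `b'` moves the value `a` from `b` to
  -- `b'` and respects `π`. The pair is recovered because `b'` is the preimage of `a`.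
  refine Finset.card_le_card_of_injOn
    (fun x => Function.update x.1 p (x.1 p * Equiv.swap b x.2)) ?_ ?_
  · rintro ⟨σ, b'⟩ hx
    simp only [Finset.mem_coe, Finset.mem_product, mem_lifts] at hx
    obtain ⟨hσ, hb'⟩ := hx
    simp only [Finset.mem_coe, mem_lifts]
    rintro ⟨p', b'', a''⟩ h
    have h1 := hσ _ (Finset.mem_insert_of_mem h)
    simp only at h1 ⊢
    by_cases hp : p' = p
    · subst hp
      rw [Function.update_self, Equiv.Perm.mul_apply, Equiv.swap_apply_of_ne_of_ne, h1]
      · rintro rfl; exact hb _ h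
      · rintro rfl
        simp only [hFr, Finset.mem_sdiff, Finset.mem_image, not_exists, not_and] at hb'
        exact hb'.2 _ h rfl
    · rw [Function.update_of_ne hp, h1]
  · rintro ⟨σ, b₁⟩ h1 ⟨τ, b₂⟩ h2 h
    simp only [Finset.mem_coe, Finset.mem_product, mem_lifts] at h1 h2
    have hσ := h1.1 _ (Finset.mem_insert_self _ _)
    have hτ := h2.1 _ (Finset.mem_insert_self _ _)
    simp only at h hσ hτ
    have hp := congrFun h p
    rw [Function.update_self, Function.update_self] at hp
    have hbb : b₁ = b₂ := by
      have e1 : (σ p * Equiv.swap b b₁) b₁ = a := by simp [hσ]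
      have e2 : (τ p * Equiv.swap b b₂) b₂ = a := by simp [hτ]
      rw [hp] at e1
      exact (τ p * Equiv.swap b b₂).injective (e1.trans e2.symm)
    subst hbb
    refine Prod.ext (funext fun p' => ?_) rfl
    by_cases hpp : p' = p
    · subst hpp
      exact mul_right_cancel hp
    · have := congrFun h p'
      rwa [Function.update_of_ne hpp, Function.update_of_ne hpp] at this

/-- The values used in the first `L` steps of a walk. -/
def exposed (σ : ConstraintLift ι c n) (x : Vtx ι c n) (l : ℕ → Fin c × ι) (L : ℕ) :
    Finset ((ι × Fin c) × Fin n × Fin n) :=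
  (Finset.range L).image (fun t => stepTriple σ (wordWalk σ x l t) (l t))

/-- Conditioning on the beginning of the walk is thus the same as prescribing the exposed values,
which is what makes `card_lifts_insert_mul_le` applicable. -/
theorem mem_lifts_exposed {σ τ : ConstraintLift ι c n} {x : Vtx ι c n} {l : ℕ → Fin c × ι} {L : ℕ} :
    τ ∈ lifts (exposed σ x l L) ↔ ∀ t ≤ L, wordWalk τ x l t = wordWalk σ x l t := by
  rw [mem_lifts]
  simp only [exposed, Finset.mem_image, Finset.mem_range, forall_exists_index, and_imp,
    forall_apply_eq_imp_iff₂]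
  constructor
  · intro h t
    induction t with
    | zero => intro _; rfl
    | succ t ih =>
      intro ht
      rw [wordWalk, wordWalk, ih (by omega), nbr_eq_iff]
      exact h t (by omega)
  · intro h t ht
    rw [← nbr_eq_iff, ← wordWalk, ← h (t + 1) (by omega), ← h t ht.le]
    rfl

theorem stepTriple_notMem_exposed {σ : ConstraintLift ι c n} {x : Vtx ι c n} {l : ℕ → Fin c × ι}
    {L : ℕ} (h : NewEdge (wordWalk σ x l) L) :
    stepTriple σ (wordWalk σ x l L) (l L) ∉ exposed σ x l L := by
  simp only [exposed, Finset.mem_image, Finset.mem_range, not_exists, not_and]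
  intro t ht heq
  apply h t ht
  rw [wordWalk, wordWalk, edge_eq_of_stepTriple, edge_eq_of_stepTriple, heq]

/-- Given the first `L` steps of a walk in a random lift, the next step is a collision with
probability at most `(L + 1) / (n - L)`. -/
theorem card_collision_le (σ : ConstraintLift ι c n) (x : Vtx ι c n) (l : ℕ → Fin c × ι) (L : ℕ)
    (S : Finset (ConstraintLift ι c n)) (hS : S ⊆ lifts (exposed σ x l L))
    (hcol : ∀ τ ∈ S, IsCollision (wordWalk τ x l) L) :
    S.card * (n - L) ≤ (L + 1) * (lifts (exposed σ x l L)).card := by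
  classical
  set π := exposed σ x l L with hπ
  have hπc : π.card ≤ L := by
    simpa [hπ, exposed] using Finset.card_image_le (s := Finset.range L)
      (f := fun t => stepTriple σ (wordWalk σ x l t) (l t))
  set y := wordWalk σ x l L with hy
  -- Sort the collisions by the earlier vertex that is hit. A fixed target prescribes one further
  -- value.
  set S' : ℕ → Finset (ConstraintLift ι c n) := fun s =>
    S.filter (fun τ => nbr τ y (l L) = wordWalk σ x l s) with hS'
  have hagree : ∀ τ ∈ S, ∀ t ≤ L, wordWalk τ x l t = wordWalk σ x l t := fun τ hτ =>
    mem_lifts_exposed.1 (hS hτ)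
  have hcover : S ⊆ (Finset.range (L + 1)).biUnion S' := by
    intro τ hτ
    have h := (hcol τ hτ).2
    simp only [Fresh, not_forall, not_not] at h
    obtain ⟨s, hs, h⟩ := h
    rw [Finset.mem_biUnion]
    refine ⟨s, Finset.mem_range.2 hs, Finset.mem_filter.2 ⟨hτ, ?_⟩⟩
    rw [wordWalk, hagree τ hτ s (by omega), hagree τ hτ L le_rfl] at h
    exact h.symm
  have hpart : ∀ s, (S' s).card * (n - L) ≤ (lifts π).card := by
    intro s
    rcases (S' s).eq_empty_or_nonempty with h0 | ⟨τ₀, hτ₀⟩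
    · simp [h0]
    obtain ⟨hτ₀S, hτ₀⟩ := Finset.mem_filter.1 hτ₀
    have hexp : exposed τ₀ x l L = π := by
      rw [hπ]
      refine Finset.image_congr fun t ht => ?_
      have ht : t < L := by simpa using ht
      rw [hagree τ₀ hτ₀S t ht.le]
      apply stepTriple_congr
      have := hagree τ₀ hτ₀S (t + 1) ht
      rwa [wordWalk, wordWalk, hagree τ₀ hτ₀S t ht.le] at this
    have hnew := stepTriple_notMem_exposed (hcol τ₀ hτ₀S).1
    rw [hexp, hagree τ₀ hτ₀S L le_rfl, ← hy] at hnew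
    refine le_trans ?_ (card_lifts_insert_mul_le π hnew)
    refine Nat.mul_le_mul (Finset.card_le_card ?_) (by omega)
    intro τ hτ
    obtain ⟨hτS, hτ⟩ := Finset.mem_filter.1 hτ
    rw [mem_lifts]
    intro e he
    rcases Finset.mem_insert.1 he with rfl | he
    · exact (nbr_eq_iff τ₀ τ y (l L)).1 (hτ.trans hτ₀.symm)
    · exact mem_lifts.1 (hS hτS) e he
  calc S.card * (n - L) ≤ (∑ s ∈ Finset.range (L + 1), (S' s).card) * (n - L) :=
        Nat.mul_le_mul_right _ ((Finset.card_le_card hcover).trans Finset.card_biUnion_le)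
    _ = ∑ s ∈ Finset.range (L + 1), (S' s).card * (n - L) := Finset.sum_mul _ _ _
    _ ≤ ∑ s ∈ Finset.range (L + 1), (lifts π).card := Finset.sum_le_sum fun s _ => hpart s
    _ = (L + 1) * (lifts π).card := by simp

-- The exponential moment of the number of collisions grows by at most the factor `1 + z q` in each
-- step, since the conditional probability of a collision is at most `q`.
open Classical in
theorem sum_pow_collisions_le (x : Vtx ι c n) (l : ℕ → Fin c × ι) {z q : ℝ} (hz : 0 ≤ z) {L : ℕ}
    (hL : L < n) (hq : ∀ t < L, ((t : ℝ) + 1) ≤ q * ((n : ℝ) - t)) :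
    ∑ σ : ConstraintLift ι c n, z ^ collisions (wordWalk σ x l) L ≤
      (1 + z * q) ^ L * Fintype.card (ConstraintLift ι c n) := by
  induction L with
  | zero => simp [collisions, collisionTimes]
  | succ L ih =>
    have ih := ih (by omega) (fun t ht => hq t (by omega))
    have hq0 : 0 ≤ q := by
      by_contra h
      have h1 := hq L (by omega)
      have h2 : (L : ℝ) < n := by exact_mod_cast (by omega : L < n)
      nlinarith [(Nat.cast_nonneg L : (0 : ℝ) ≤ L)]
    set f : ConstraintLift ι c n → ℝ := fun σ => z ^ collisions (wordWalk σ x l) L with hf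
    set g : ConstraintLift ι c n → ℝ := fun σ =>
      if IsCollision (wordWalk σ x l) L then f σ else 0 with hg
    have h1 : ∀ σ, z ^ collisions (wordWalk σ x l) (L + 1) ≤ f σ + z * g σ := by
      intro σ
      have hf0 : 0 ≤ f σ := pow_nonneg hz _
      rw [collisions_succ]
      simp only [hg]
      split_ifs with h
      · rw [pow_succ, mul_comm]; linarith
      · simp [hf]
    have h2 : ∑ σ, g σ ≤ q * ∑ σ, f σ := by
      -- On a fibre of `tr` the first `L` steps are fixed, hence so is the number of earlier
      -- collisions, and `card_collision_le` bounds the proportion of lifts that collide next.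
      set tr : ConstraintLift ι c n → (Fin (L + 1) → Vtx ι c n) :=
        fun σ t => wordWalk σ x l t with htr
      rw [← Finset.sum_fiberwise Finset.univ tr g, ← Finset.sum_fiberwise Finset.univ tr f,
        Finset.mul_sum]
      refine Finset.sum_le_sum fun τ _ => ?_
      rcases (Finset.univ.filter (fun σ => tr σ = τ)).eq_empty_or_nonempty with h0 | ⟨σ₀, hσ₀⟩
      · simp [h0]
      have hσ₀ : tr σ₀ = τ := by simpa using hσ₀
      have hfib : Finset.univ.filter (fun σ => tr σ = τ) = lifts (exposed σ₀ x l L) := by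
        ext σ
        rw [mem_lifts_exposed]
        simp only [Finset.mem_filter, Finset.mem_univ, true_and, ← hσ₀, htr]
        constructor
        · intro h t ht
          exact congrFun h ⟨t, by omega⟩
        · intro h
          ext1 t
          exact h t (by have := t.2; omega)
      have hconst : ∀ σ ∈ lifts (exposed σ₀ x l L), f σ = f σ₀ := by
        intro σ hσ
        simp only [hf]
        rw [collisions_congr (mem_lifts_exposed.1 hσ)]
      rw [hfib, Finset.sum_congr rfl hconst, Finset.sum_const, nsmul_eq_mul]
      have hgs : ∑ σ ∈ lifts (exposed σ₀ x l L), g σ =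
          ((lifts (exposed σ₀ x l L)).filter (fun σ => IsCollision (wordWalk σ x l) L)).card
            * f σ₀ := by
        rw [← nsmul_eq_mul, ← Finset.sum_const, Finset.sum_filter]
        refine Finset.sum_congr rfl fun σ hσ => ?_
        simp only [hg]
        split_ifs
        · exact hconst σ hσ
        · rfl
      rw [hgs, ← mul_assoc]
      refine mul_le_mul_of_nonneg_right ?_ (pow_nonneg hz _)
      have h3 := card_collision_le σ₀ x l L _ (Finset.filter_subset _ _)
        (fun τ hτ => (Finset.mem_filter.1 hτ).2)
      have h4 : (((lifts (exposed σ₀ x l L)).filter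
          (fun σ => IsCollision (wordWalk σ x l) L)).card : ℝ) * ((n : ℝ) - L) ≤
          ((L : ℝ) + 1) * (lifts (exposed σ₀ x l L)).card := by
        have := (Nat.cast_le (α := ℝ)).2 h3
        rw [Nat.cast_mul, Nat.cast_mul, Nat.cast_sub (by omega)] at this
        simpa using this
      have h5 : (0 : ℝ) < (n : ℝ) - L := by
        have : (L : ℝ) < n := by exact_mod_cast (by omega : L < n)
        linarith
      refine le_of_mul_le_mul_right (h4.trans ?_) h5
      calc ((L : ℝ) + 1) * (lifts (exposed σ₀ x l L)).card
          ≤ (q * ((n : ℝ) - L)) * (lifts (exposed σ₀ x l L)).card :=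
            mul_le_mul_of_nonneg_right (hq L (by omega)) (Nat.cast_nonneg _)
        _ = q * (lifts (exposed σ₀ x l L)).card * ((n : ℝ) - L) := by ring
    calc ∑ σ, z ^ collisions (wordWalk σ x l) (L + 1) ≤ ∑ σ, (f σ + z * g σ) :=
          Finset.sum_le_sum fun σ _ => h1 σ
      _ = ∑ σ, f σ + z * ∑ σ, g σ := by rw [Finset.sum_add_distrib, Finset.mul_sum]
      _ ≤ ∑ σ, f σ + z * (q * ∑ σ, f σ) := by gcongr
      _ = (1 + z * q) * ∑ σ, f σ := by ring
      _ ≤ (1 + z * q) * ((1 + z * q) ^ L * Fintype.card (ConstraintLift ι c n)) := by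
          refine mul_le_mul_of_nonneg_left ih ?_
          positivity
      _ = _ := by ring

open Classical in
/-- The probability that the walk along a fixed word has at least `T` collisions. -/
theorem card_le_collisions_le (x : Vtx ι c n) (l : ℕ → Fin c × ι) {L : ℕ} (hL : L < n) (T : ℕ) :
    ((Finset.univ.filter (fun σ : ConstraintLift ι c n =>
      T ≤ collisions (wordWalk σ x l) L)).card : ℝ) ≤
      2 ^ L * (((L : ℝ) + 1) / ((n : ℝ) - L)) ^ T * Fintype.card (ConstraintLift ι c n) := by
  have h5 : (0 : ℝ) < (n : ℝ) - L := by
    have : (L : ℝ) < n := by exact_mod_cast hL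
    linarith
  have hL0 : (0 : ℝ) < (L : ℝ) + 1 := by positivity
  -- If the ratio `(L + 1) / (n - L)` is at least one, the bound is trivial.
  by_cases hbig : (L : ℝ) + 1 ≤ (n : ℝ) - L
  swap
  · have h1 : (1 : ℝ) ≤ (((L : ℝ) + 1) / ((n : ℝ) - L)) ^ T := by
      refine one_le_pow₀ ?_
      rw [le_div_iff₀ h5]
      linarith
    have h2 : (1 : ℝ) ≤ 2 ^ L := one_le_pow₀ (by norm_num)
    have h3 : ((Finset.univ.filter (fun σ : ConstraintLift ι c n =>
      T ≤ collisions (wordWalk σ x l) L)).card : ℝ) ≤ Fintype.card (ConstraintLift ι c n) := by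
      exact_mod_cast Finset.card_le_univ _
    refine h3.trans (le_mul_of_one_le_left (Nat.cast_nonneg _) ?_)
    nlinarith
  -- With `z` the inverse of the collision probability bound, `1 + z q = 2`, and Markov's inequality
  -- for `z ^ collisions` gives the claim.
  set z : ℝ := ((n : ℝ) - L) / ((L : ℝ) + 1) with hz
  have hz1 : 1 ≤ z := by rw [hz, le_div_iff₀ hL0]; linarith
  have hzq : z * (((L : ℝ) + 1) / ((n : ℝ) - L)) = 1 := by rw [hz]; field_simp
  have h := sum_pow_collisions_le (c := c) x l (z := z) (q := ((L : ℝ) + 1) / ((n : ℝ) - L))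
    (by positivity) hL (by
      intro t ht
      have h1 : (t : ℝ) ≤ L := by exact_mod_cast ht.le
      rw [div_mul_eq_mul_div, le_div_iff₀ h5]
      nlinarith)
  rw [hzq] at h
  have hmk : ((Finset.univ.filter (fun σ : ConstraintLift ι c n =>
      T ≤ collisions (wordWalk σ x l) L)).card : ℝ) * z ^ T ≤
      ∑ σ : ConstraintLift ι c n, z ^ collisions (wordWalk σ x l) L := by
    rw [← nsmul_eq_mul, ← Finset.sum_const]
    refine (Finset.sum_le_sum (g := fun σ => z ^ collisions (wordWalk σ x l) L) ?_).trans
      (Finset.sum_le_sum_of_subset_of_nonneg (Finset.subset_univ _) ?_)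
    · intro σ hσ
      exact pow_le_pow_right₀ hz1 (Finset.mem_filter.1 hσ).2
    · intro σ _ _
      positivity
  have h6 := hmk.trans h
  norm_num at h6
  have hzT : z ^ T * (((L : ℝ) + 1) / ((n : ℝ) - L)) ^ T = 1 := by rw [← mul_pow, hzq, one_pow]
  have hqT : 0 ≤ (((L : ℝ) + 1) / ((n : ℝ) - L)) ^ T := by positivity
  calc _ = (((Finset.univ.filter (fun σ : ConstraintLift ι c n =>
      T ≤ collisions (wordWalk σ x l) L)).card : ℝ) * z ^ T) *
        (((L : ℝ) + 1) / ((n : ℝ) - L)) ^ T := by rw [mul_assoc, hzT, mul_one]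
    _ ≤ (2 ^ L * Fintype.card (ConstraintLift ι c n)) * (((L : ℝ) + 1) / ((n : ℝ) - L)) ^ T := by
        refine mul_le_mul_of_nonneg_right ?_ hqT
        convert h6 using 2
        simp
    _ = _ := by ring

/-- The first `L` steps of `w` follow edges of the constraint graph. -/
def IsWalk (σ : ConstraintLift ι c n) (w : ℕ → Vtx ι c n) (L : ℕ) : Prop :=
  ∀ t < L, ∃ l, w (t + 1) = nbr σ (w t) l

open Classical in
/-- The probability that some walk from `x` has at least `T` collisions. -/
theorem card_exists_walk_le (x : Vtx ι c n) {L : ℕ} (hL : L < n) (T : ℕ) [Nonempty (Fin c × ι)] :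
    ((Finset.univ.filter (fun σ : ConstraintLift ι c n =>
      ∃ w : ℕ → Vtx ι c n, w 0 = x ∧ IsWalk σ w L ∧ T ≤ collisions w L)).card : ℝ) ≤
      (2 * Fintype.card (Fin c × ι)) ^ L * (((L : ℝ) + 1) / ((n : ℝ) - L)) ^ T *
        Fintype.card (ConstraintLift ι c n) := by
  -- Every walk of length `L` follows one of the finitely many words of directions; the union bound
  -- runs over these words.
  let ext : (Fin L → Fin c × ι) → ℕ → Fin c × ι := fun g t =>
    if h : t < L then g ⟨t, h⟩ else Classical.arbitrary _
  have hsub : (Finset.univ.filter (fun σ : ConstraintLift ι c n =>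
      ∃ w : ℕ → Vtx ι c n, w 0 = x ∧ IsWalk σ w L ∧ T ≤ collisions w L)) ⊆
      Finset.univ.biUnion (fun g : Fin L → Fin c × ι =>
        Finset.univ.filter (fun σ => T ≤ collisions (wordWalk σ x (ext g)) L)) := by
    intro σ hσ
    obtain ⟨w, hw0, hw, hT⟩ := (Finset.mem_filter.1 hσ).2
    choose! g hg using hw
    simp only [Finset.mem_biUnion, Finset.mem_univ, true_and, Finset.mem_filter]
    refine ⟨fun t => g t, ?_⟩
    rw [← collisions_congr (u := w)]
    · exact hT
    · intro s
      induction s with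
      | zero => intro _; exact hw0
      | succ s ih =>
        intro hs
        rw [hg s (by omega), ih (by omega)]
        simp only [wordWalk, ext]
        rw [dif_pos (by omega)]
  have h1 : ((Finset.univ.filter (fun σ : ConstraintLift ι c n =>
      ∃ w : ℕ → Vtx ι c n, w 0 = x ∧ IsWalk σ w L ∧ T ≤ collisions w L)).card : ℝ) ≤
      ∑ g : Fin L → Fin c × ι,
        ((Finset.univ.filter (fun σ : ConstraintLift ι c n =>
          T ≤ collisions (wordWalk σ x (ext g)) L)).card : ℝ) := by
    exact_mod_cast (Finset.card_le_card hsub).trans Finset.card_biUnion_le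
  refine h1.trans ((Finset.sum_le_sum fun g _ => card_le_collisions_le x (ext g) hL T).trans ?_)
  rw [Finset.sum_const, nsmul_eq_mul, Finset.card_univ, Fintype.card_fun, Fintype.card_fin,
    Nat.cast_pow, mul_pow]
  apply le_of_eq
  ring

end RandomLift

/-! ### Non-backtracking sums of involutions -/

namespace NonBacktracking

section Algebra

variable {M : Type*} [Ring M] [Algebra ℝ M] {c : ℕ}

/-- The sum of all products `B j₀ * B j₁ * ⋯ * B j_ℓ` with `j₀ = j` in which neighbouring indices
are distinct. -/
def nbProd (B : Fin c → M) : ℕ → Fin c → M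
  | 0, j => B j
  | ℓ + 1, j => B j * ∑ i ∈ Finset.univ.erase j, nbProd B ℓ i

/-- The sum of all products `B j₀ * B j₁ * ⋯ * B j_ℓ` in which neighbouring indices are distinct. -/
def nbSum (B : Fin c → M) (ℓ : ℕ) : M := ∑ j, nbProd B ℓ j

theorem sum_sum_erase {N : Type*} [AddCommGroup N] [Module ℝ N] (f : Fin c → N) :
    ∑ j, ∑ j' ∈ Finset.univ.erase j, f j' = ((c : ℝ) - 1) • ∑ j, f j := by
  have h : ∀ j, ∑ j' ∈ Finset.univ.erase j, f j' = ∑ j', f j' - f j := fun j => by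
    rw [eq_sub_iff_add_eq, Finset.sum_erase_add _ _ (Finset.mem_univ j)]
  simp only [h, Finset.sum_sub_distrib, Finset.sum_const, Finset.card_univ, Fintype.card_fin,
    sub_smul, one_smul, Nat.cast_smul_eq_nsmul]

variable {B : Fin c → M} {D : ℝ}

/-- A second letter equal to the first contributes `D`, and there are `c` such pairs. -/
theorem sum_mul_nbSum_zero (hB : ∀ j, B j * B j = D • 1) :
    (∑ j, B j) * nbSum B 0 = nbSum B 1 + ((c : ℝ) * D) • 1 := by
  simp only [nbSum, nbProd]
  rw [Finset.sum_mul]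
  have : ∀ j, B j * ∑ j', B j' = B j * ∑ j' ∈ Finset.univ.erase j, B j' + D • 1 := fun j => by
    rw [← hB j, ← mul_add, Finset.sum_erase_add _ _ (Finset.mem_univ j)]
  simp only [this, Finset.sum_add_distrib, Finset.sum_const, Finset.card_univ, Fintype.card_fin,
    mul_smul, Nat.cast_smul_eq_nsmul]

/-- Prepending a letter either keeps the word non-backtracking or cancels its first letter. After a
cancellation the remaining word arises from each of the `c - 1` letters different from its first
one. -/
theorem sum_mul_nbSum_succ (hB : ∀ j, B j * B j = D • 1) (ℓ : ℕ) :
    (∑ j, B j) * nbSum B (ℓ + 1) = nbSum B (ℓ + 2) + (D * ((c : ℝ) - 1)) • nbSum B ℓ := by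
  have h1 : ∀ j, B j * nbSum B (ℓ + 1) =
      nbProd B (ℓ + 2) j + D • ∑ j' ∈ Finset.univ.erase j, nbProd B ℓ j' := fun j => by
    rw [nbSum, ← Finset.sum_erase_add _ _ (Finset.mem_univ j), mul_add]
    have h2 : B j * nbProd B (ℓ + 1) j = D • ∑ j' ∈ Finset.univ.erase j, nbProd B ℓ j' := by
      rw [nbProd, ← mul_assoc, hB, smul_mul_assoc, one_mul]
    rw [h2]
    rfl
  rw [Finset.sum_mul]
  simp only [h1, Finset.sum_add_distrib]
  rw [← Finset.smul_sum, sum_sum_erase, smul_smul]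
  rfl

end Algebra

/-- The value of the non-backtracking sum at an eigenvalue. -/
def nbPoly (c : ℕ) (D lam : ℝ) : ℕ → ℝ
  | 0 => lam
  | 1 => lam * lam - c * D
  | ℓ + 2 => lam * nbPoly c D lam (ℓ + 1) - D * ((c : ℝ) - 1) * nbPoly c D lam ℓ

theorem nbSum_mulVec {V : Type*} [Fintype V] [DecidableEq V] {c : ℕ} {B : Fin c → Matrix V V ℝ}
    {D lam : ℝ} (hB : ∀ j, B j * B j = D • 1) {f : V → ℝ} (hf : (∑ j, B j) *ᵥ f = lam • f) :
    ∀ ℓ, nbSum B ℓ *ᵥ f = nbPoly c D lam ℓ • f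
  | 0 => hf
  | 1 => by
    have h : nbSum B 1 = (∑ j, B j) * nbSum B 0 - ((c : ℝ) * D) • 1 := by
      rw [sum_mul_nbSum_zero hB, add_sub_cancel_right]
    rw [h, Matrix.sub_mulVec, ← Matrix.mulVec_mulVec, nbSum_mulVec hB hf 0, Matrix.mulVec_smul, hf,
      Matrix.smul_mulVec, Matrix.one_mulVec, smul_smul, ← sub_smul]
    rfl
  | ℓ + 2 => by
    have h : nbSum B (ℓ + 2) =
        (∑ j, B j) * nbSum B (ℓ + 1) - (D * ((c : ℝ) - 1)) • nbSum B ℓ := by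
      rw [sum_mul_nbSum_succ hB, add_sub_cancel_right]
    rw [h, Matrix.sub_mulVec, ← Matrix.mulVec_mulVec, nbSum_mulVec hB hf (ℓ + 1),
      Matrix.mulVec_smul, hf, Matrix.smul_mulVec, nbSum_mulVec hB hf ℓ, smul_smul, smul_smul,
      ← sub_smul, mul_comm _ lam]
    rfl

/-- The sequence `s^(ℓ+1) (y^(ℓ+1) + y^(-ℓ-1))` satisfies the same recurrence. The difference `e`
starts with `0` and `(c - 2) D ≥ 0`, and since `y + y⁻¹ ≥ 2` the recurrence propagates `e (ℓ + 1) ≥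
s * e ℓ ≥ 0`. -/
theorem le_nbPoly {c : ℕ} (hc : 2 ≤ c) {D s y : ℝ} (hD : 0 ≤ D) (hs : 0 ≤ s)
    (hsD : s * s = D * ((c : ℝ) - 1)) (hy : 1 ≤ y) (ℓ : ℕ) :
    (s * y) ^ (ℓ + 1) ≤ nbPoly c D (s * (y + y⁻¹)) ℓ := by
  have hc' : (2 : ℝ) ≤ c := by exact_mod_cast hc
  have hy0 : 0 < y := by linarith
  have hyy : y * y⁻¹ = 1 := mul_inv_cancel₀ hy0.ne'
  have hy2 : 2 ≤ y + y⁻¹ := by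
    have : 0 < y⁻¹ := by positivity
    nlinarith [sq_nonneg (y - y⁻¹)]
  set e : ℕ → ℝ := fun ℓ => nbPoly c D (s * (y + y⁻¹)) ℓ - s ^ (ℓ + 1) * (y ^ (ℓ + 1) + y⁻¹ ^ (ℓ + 1))
    with he
  have hrec : ∀ ℓ, e (ℓ + 2) = s * (y + y⁻¹) * e (ℓ + 1) - s * s * e ℓ := by
    intro ℓ
    simp only [he, nbPoly]
    rw [hsD]
    have h1 : (y ^ (ℓ + 2 + 1) + y⁻¹ ^ (ℓ + 2 + 1)) =
        (y + y⁻¹) * (y ^ (ℓ + 1 + 1) + y⁻¹ ^ (ℓ + 1 + 1)) - (y ^ (ℓ + 1) + y⁻¹ ^ (ℓ + 1)) := by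
      have : (y + y⁻¹) * (y ^ (ℓ + 1 + 1) + y⁻¹ ^ (ℓ + 1 + 1)) =
          y ^ (ℓ + 2 + 1) + y⁻¹ ^ (ℓ + 2 + 1) + (y * y⁻¹) * (y ^ (ℓ + 1) + y⁻¹ ^ (ℓ + 1)) := by ring
      rw [this, hyy]; ring
    rw [h1, ← hsD]
    ring
  have h0 : e 0 = 0 := by simp only [he, nbPoly]; ring
  have h1 : 0 ≤ e 1 := by
    have : e 1 = 2 * (s * s) * (y * y⁻¹) - c * D := by simp only [he, nbPoly]; ring
    rw [this, hyy, hsD]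
    nlinarith
  have hmain : ∀ ℓ, 0 ≤ e ℓ ∧ s * e ℓ ≤ e (ℓ + 1) := by
    intro ℓ
    induction ℓ with
    | zero => rw [h0]; simpa using h1
    | succ ℓ ih =>
      have h2 : 0 ≤ e (ℓ + 1) := le_trans (mul_nonneg hs ih.1) ih.2
      refine ⟨h2, ?_⟩
      rw [hrec]
      have h3 : s * 2 * e (ℓ + 1) ≤ s * (y + y⁻¹) * e (ℓ + 1) := by gcongr
      have h4 : s * (s * e ℓ) ≤ s * e (ℓ + 1) := by gcongr; exact ih.2
      nlinarith
  have h5 := (hmain ℓ).1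
  simp only [he] at h5
  have h6 : 0 ≤ s ^ (ℓ + 1) * y⁻¹ ^ (ℓ + 1) := by positivity
  rw [mul_pow]
  nlinarith

end NonBacktracking

/-! ### The blocks of the adjacency matrix -/

namespace ForrLift

open NonBacktracking

variable {k c n : ℕ}

/-- The variables of an instance. -/
abbrev Var (k n : ℕ) : Type := ForrVar k × Fin n

/-- A direction in which a variable can be left: a constraint and a variable of it on the other
side. -/
abbrev Letter (k c : ℕ) : Type := Fin c × (Fin k → Fin 2)

/-- The variable `s` on the other side. -/
def opp : ForrVar k → (Fin k → Fin 2) → ForrVar k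
  | Sum.inl _, s => Sum.inr s
  | Sum.inr _, s => Sum.inl s

/-- The coordinate of a variable of the constraint. -/
def idx : ForrVar k → (Fin k → Fin 2)
  | Sum.inl s => s
  | Sum.inr s => s

/-- The entries of the constraint matrix, seen from either side. -/
def forrSign : ForrVar k → (Fin k → Fin 2) → ℤˣ
  | Sum.inl x, s => walshHadamard k x s
  | Sum.inr y, s => walshHadamard k s y

theorem walshHadamard_comm (x y : Fin k → Fin 2) : walshHadamard k x y = walshHadamard k y x := by
  unfold walshHadamard
  refine Finset.prod_congr rfl fun i _ => ?_
  generalize x i = a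
  generalize y i = b
  fin_cases a <;> fin_cases b <;> rfl

theorem forrSign_eq (i : ForrVar k) (s : Fin k → Fin 2) :
    forrSign i s = walshHadamard k (idx i) s := by
  rcases i with x | y
  · rfl
  · exact walshHadamard_comm _ _

/-- The sum factors over the coordinates, and the rows of the `2 × 2` matrix are orthogonal. -/
theorem sum_walshHadamard_mul (x y : Fin k → Fin 2) :
    ∑ s, ((walshHadamard k x s : ℤ) : ℝ) * ((walshHadamard k y s : ℤ) : ℝ) =
      if x = y then 2 ^ k else 0 := by
  have h1 : ∀ s, ((walshHadamard k x s : ℤ) : ℝ) * ((walshHadamard k y s : ℤ) : ℝ) =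
      ∏ i, ((((!![1, 1; 1, -1] : Matrix (Fin 2) (Fin 2) ℤˣ) (x i) (s i) : ℤˣ) : ℤ) : ℝ) *
        ((((!![1, 1; 1, -1] : Matrix (Fin 2) (Fin 2) ℤˣ) (y i) (s i) : ℤˣ) : ℤ) : ℝ) := by
    intro s
    simp only [walshHadamard, Units.coe_prod, Int.cast_prod, Finset.prod_mul_distrib]
  simp only [h1]
  rw [← Fintype.prod_sum (fun i (b : Fin 2) =>
    ((((!![1, 1; 1, -1] : Matrix (Fin 2) (Fin 2) ℤˣ) (x i) b : ℤˣ) : ℤ) : ℝ) *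
        ((((!![1, 1; 1, -1] : Matrix (Fin 2) (Fin 2) ℤˣ) (y i) b : ℤˣ) : ℤ) : ℝ))]
  have h2 : ∀ a b : Fin 2, ∑ d : Fin 2,
      ((((!![1, 1; 1, -1] : Matrix (Fin 2) (Fin 2) ℤˣ) a d : ℤˣ) : ℤ) : ℝ) *
        ((((!![1, 1; 1, -1] : Matrix (Fin 2) (Fin 2) ℤˣ) b d : ℤˣ) : ℤ) : ℝ) =
        if a = b then 2 else 0 := by
    intro a b
    fin_cases a <;> fin_cases b <;> simp [Fin.sum_univ_two] <;> norm_num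
  simp only [h2]
  split_ifs with h
  · subst h; simp
  · obtain ⟨i, hi⟩ := Function.ne_iff.1 h
    exact Finset.prod_eq_zero (Finset.mem_univ i) (if_neg hi)

variable (σ : ConstraintLift (ForrVar k) c n) (ξ : Negations (ForrVar k) c n)

/-- The constraint of kind `j` that contains `x`. -/
def constr (x : Var k n) (j : Fin c) : Fin c × Fin n := (j, (σ (x.1, j)).symm x.2)

/-- The variable reached from `x` in direction `l`. -/
def step (x : Var k n) (l : Letter k c) : Var k n :=
  (opp x.1 l.2, σ (opp x.1 l.2, l.1) (constr σ x l.1).2)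

/-- The sign of the edge from `x` in direction `l`. -/
def stepSign (x : Var k n) (l : Letter k c) : ℤˣ :=
  forrSign x.1 l.2 * (ξ (constr σ x l.1) x.1 * ξ (constr σ x l.1) (opp x.1 l.2))

/-- The part of the adjacency matrix that comes from the constraints of kind `j`. -/
def block (j : Fin c) : Matrix (Var k n) (Var k n) ℝ := fun x y =>
  ∑ s, if step σ x (j, s) = y then ((stepSign σ ξ x (j, s) : ℤ) : ℝ) else 0

theorem constr_step (x : Var k n) (l : Letter k c) : constr σ (step σ x l) l.1 = constr σ x l.1 := by
  simp [constr, step]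

/-- Crossing twice returns to the original side, and only the last coordinate is remembered. The
form `opp (opp i t) t` no longer involves the intermediate coordinate `s`. -/
theorem opp_opp (i : ForrVar k) (s t : Fin k → Fin 2) :
    opp (opp i s) t = opp (opp i t) t := by
  rcases i with _ | _ <;> rfl

theorem opp_idx (i : ForrVar k) (s : Fin k → Fin 2) : opp (opp i s) (idx i) = i := by
  rcases i with _ | _ <;> rfl

theorem idx_opp (i : ForrVar k) (s : Fin k → Fin 2) : idx (opp i s) = s := by
  rcases i with _ | _ <;> rfl

theorem step_idx (x : Var k n) (l : Letter k c) : step σ (step σ x l) (l.1, idx x.1) = x := by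
  rw [step, constr_step]
  simp only [step, opp_idx]
  simp [constr]

theorem block_mul_apply {β : Type*} (j : Fin c) (M : Matrix (Var k n) β ℝ) (x : Var k n) (z : β) :
    (block σ ξ j * M) x z =
      ∑ s, ((stepSign σ ξ x (j, s) : ℤ) : ℝ) * M (step σ x (j, s)) z := by
  rw [Matrix.mul_apply]
  simp only [block, Finset.sum_mul]
  rw [Finset.sum_comm]
  refine Finset.sum_congr rfl fun s _ => ?_
  simp [ite_mul]

/-- Both steps lie in the same constraint, so the sign `ξ` of the intermediate variable occurs twice
and cancels. Only the Hadamard entries still depend on `s`. -/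
theorem stepSign_mul_stepSign (x : Var k n) (j : Fin c) (s t : Fin k → Fin 2) :
    stepSign σ ξ x (j, s) * stepSign σ ξ (step σ x (j, s)) (j, t) =
      walshHadamard k (idx x.1) s * walshHadamard k t s *
        (ξ (constr σ x j) x.1 * ξ (constr σ x j) (opp (opp x.1 t) t)) := by
  have h1 : constr σ (step σ x (j, s)) j = constr σ x j := constr_step σ x (j, s)
  simp only [stepSign, h1, forrSign_eq]
  have h2 : (step σ x (j, s)).1 = opp x.1 s := rfl
  rw [h2, opp_opp, idx_opp, walshHadamard_comm s t]
  have h3 := Int.units_mul_self (ξ (constr σ x j) (opp x.1 s))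
  calc _ = walshHadamard k (idx x.1) s * walshHadamard k t s *
        (ξ (constr σ x j) x.1 * ξ (constr σ x j) (opp (opp x.1 t) t)) *
        (ξ (constr σ x j) (opp x.1 s) * ξ (constr σ x j) (opp x.1 s)) := by
          simp only [mul_comm, mul_left_comm]
    _ = _ := by rw [h3, mul_one]

theorem step_step (x : Var k n) (j : Fin c) (s t : Fin k → Fin 2) :
    step σ (step σ x (j, s)) (j, t) =
      (opp (opp x.1 t) t, σ (opp (opp x.1 t) t, j) (constr σ x j).2) := by
  have h1 : constr σ (step σ x (j, s)) j = constr σ x j := constr_step σ x (j, s)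
  have h2 : (step σ x (j, s)).1 = opp x.1 s := rfl
  rw [step, h1, h2, opp_opp]

/-- Two steps in the same constraint lead to a variable on the original side that does not depend on
the intermediate one. Summing over the latter gives an inner product of two rows of `H_k`, so only
the return to the start survives. -/
theorem block_mul_self (j : Fin c) : block σ ξ j * block σ ξ j = ((2 : ℝ) ^ k) • 1 := by
  ext x z
  rw [block_mul_apply]
  simp only [block, Finset.mul_sum, mul_ite, mul_zero]
  rw [Finset.sum_comm]
  have h1 : ∀ t, (∑ s, if step σ (step σ x (j, s)) (j, t) = z then
      ((stepSign σ ξ x (j, s) : ℤ) : ℝ) * ((stepSign σ ξ (step σ x (j, s)) (j, t) : ℤ) : ℝ) else 0)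
      = if idx x.1 = t then (if x = z then 2 ^ k else 0) else 0 := by
    intro t
    simp only [step_step]
    by_cases hz : (opp (opp x.1 t) t, σ (opp (opp x.1 t) t, j) (constr σ x j).2) = z
    · simp only [hz, if_true]
      have h2 : ∀ s, ((stepSign σ ξ x (j, s) : ℤ) : ℝ) *
          ((stepSign σ ξ (step σ x (j, s)) (j, t) : ℤ) : ℝ) =
          (((walshHadamard k (idx x.1) s : ℤ) : ℝ) * ((walshHadamard k t s : ℤ) : ℝ)) *
          (((ξ (constr σ x j) x.1 * ξ (constr σ x j) (opp (opp x.1 t) t) : ℤˣ) : ℤ) : ℝ) := by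
        intro s
        rw [← Int.cast_mul, ← Units.val_mul, stepSign_mul_stepSign]
        push_cast
        ring
      simp only [h2]
      rw [← Finset.sum_mul, sum_walshHadamard_mul]
      by_cases ht : idx x.1 = t
      · subst ht
        rw [opp_idx] at hz ⊢
        have hxz : x = z := by
          rw [← hz]
          simp [constr]
        simp [hxz]
      · simp [ht]
    · simp only [hz, if_false, Finset.sum_const_zero]
      by_cases ht : idx x.1 = t
      · subst ht
        rw [if_pos rfl, if_neg]
        rintro rfl
        apply hz
        rw [opp_idx]
        simp [constr]
      · rw [if_neg ht]
  rw [Finset.sum_congr rfl fun t _ => h1 t, Finset.sum_ite_eq]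
  simp [Matrix.one_apply]

theorem adj_eq_sum_block :
    (additiveLift (fun _ => forrelation k) σ ξ).adj = ∑ j, block σ ξ j := by
  ext u v
  rw [Matrix.sum_apply]
  unfold XorInstance.adj
  have hE : ∀ f : (additiveLift (fun _ : Fin c => forrelation k) σ ξ).E → ℝ,
      ∑ e, f e = ∑ j : Fin c, ∑ b : Fin n, ∑ s : Fin k → Fin 2, ∑ t : Fin k → Fin 2,
        f ⟨j, b, s, t⟩ := by
    intro f
    refine (Fintype.sum_sigma (α := fun _ : Fin c => Fin n × (forrelation k).E) _).trans ?_
    refine Finset.sum_congr rfl fun j _ => ?_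
    refine (Fintype.sum_prod_type _).trans ?_
    refine Finset.sum_congr rfl fun b _ => ?_
    exact Fintype.sum_prod_type _
  rw [hE]
  refine Finset.sum_congr rfl fun j _ => ?_
  simp only [block, additiveLift, forrelation]
  obtain ⟨u, a⟩ := u
  obtain ⟨v, a'⟩ := v
  rcases u with u | u <;> rcases v with v | v
  · simp [step, opp]
  · rw [Finset.sum_eq_single ((σ (Sum.inl u, j)).symm a)]
    · rw [Finset.sum_eq_single u]
      · simp [step, opp, constr, stepSign, forrSign]
      · intro s _ hs
        simp [hs]
      · simp
    · intro b _ hb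
      refine Finset.sum_eq_zero fun s _ => Finset.sum_eq_zero fun t _ => if_neg ?_
      simp only [Prod.mk.injEq, reduceCtorEq, false_and, and_false, or_false, not_and]
      rintro ⟨h1, h2⟩
      rw [Sum.inl.injEq] at h1
      subst h1
      exact absurd (by rw [← h2, Equiv.symm_apply_apply]) hb
    · simp
  · rw [Finset.sum_eq_single ((σ (Sum.inr u, j)).symm a)]
    · refine Finset.sum_congr rfl fun s _ => ?_
      rw [Finset.sum_eq_single u]
      · simp [step, opp, constr, stepSign, forrSign, mul_comm]
      · intro t _ ht
        simp [ht]
      · simp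
    · intro b _ hb
      refine Finset.sum_eq_zero fun s _ => Finset.sum_eq_zero fun t _ => if_neg ?_
      simp only [Prod.mk.injEq, reduceCtorEq, false_and, and_false, false_or, not_and]
      rintro - h1 h2
      rw [Sum.inr.injEq] at h1
      subst h1
      exact absurd (by rw [← h2, Equiv.symm_apply_apply]) hb
    · simp
  · simp [step, opp]

end ForrLift

/-! ### Concatenation of a walk with the reverse of another one -/

namespace WalkCount

variable {X : Type*}

/-- Follow `u` for `p` steps, then go back along the first `q` steps of `v`. -/
def concat (u : ℕ → X) (p : ℕ) (v : ℕ → X) (q : ℕ) (t : ℕ) : X :=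
  if t ≤ p then u t else v (p + q - t)

theorem concat_of_le {u v : ℕ → X} {p q t : ℕ} (h : t ≤ p) : concat u p v q t = u t := if_pos h

theorem concat_of_ge {u v : ℕ → X} {p q t : ℕ} (huv : u p = v q) (h : p ≤ t) :
    concat u p v q t = v (p + q - t) := by
  unfold concat
  split_ifs with h1
  · obtain rfl : t = p := by omega
    rw [huv]; congr 1; omega
  · rfl

theorem concat_ne_add_two {u v : ℕ → X} {p q : ℕ} (huv : u p = v q)
    (hu : ∀ t, t + 2 ≤ p → u t ≠ u (t + 2)) (hv : ∀ t, t + 2 ≤ q → v t ≠ v (t + 2)) {t : ℕ}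
    (ht : t + 2 ≤ p + q) (htp : t + 1 ≠ p) : concat u p v q t ≠ concat u p v q (t + 2) := by
  rcases Nat.lt_or_ge (t + 1) p with h | h
  · rw [concat_of_le (by omega), concat_of_le (by omega)]
    exact hu t (by omega)
  · rw [concat_of_ge huv (by omega), concat_of_ge huv (by omega)]
    have := hv (p + q - (t + 2)) (by omega)
    rw [show p + q - (t + 2) + 2 = p + q - t by omega] at this
    exact this.symm

/-- If there are no collisions, then non-backtracking walks with the same end points coincide. -/
theorem eq_of_end_eq {u v : ℕ → X} (h0 : u 0 = v 0) :
    ∀ p q, (∀ t, t + 2 ≤ p → u t ≠ u (t + 2)) → (∀ t, t + 2 ≤ q → v t ≠ v (t + 2)) →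
      (∀ p' ≤ p, ∀ q' ≤ q, u p' = v q' → collisions (concat u p' v q') (p' + q') = 0) →
      u p = v q → p = q ∧ ∀ t ≤ p, u t = v t := by
  intro p
  induction p with
  | zero =>
    intro q hu hv hcol huv
    rcases Nat.eq_zero_or_pos q with rfl | hq
    · exact ⟨rfl, fun t ht => by obtain rfl : t = 0 := by omega
                                 exact h0⟩
    · exfalso
      have hf := fresh_of_collisions_eq_zero (w := concat u 0 v q)
        (fun t ht => concat_ne_add_two huv hu hv ht (by omega)) (hcol 0 le_rfl q le_rfl huv)
        (0 + q) le_rfl 0 (by omega)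
      apply hf
      rw [concat_of_le le_rfl, concat_of_ge huv (by omega), Nat.sub_self, h0]
  | succ p ih =>
    intro q hu hv hcol huv
    -- If the last steps differ, the concatenated walk does not backtrack at the joint either. It
    -- then visits no vertex twice, although it ends where it starts.
    have hfin : (∀ q', q = q' + 1 → u p ≠ v q') → False := by
      intro hne
      have hnb : ∀ t, t + 2 ≤ p + 1 + q →
          concat u (p + 1) v q t ≠ concat u (p + 1) v q (t + 2) := by
        intro t ht
        by_cases htp : t = p
        · subst htp
          rw [concat_of_le (by omega), concat_of_ge huv (by omega)]
          have := hne (q - 1) (by omega)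
          rwa [show t + 1 + q - (t + 2) = q - 1 by omega]
        · exact concat_ne_add_two huv hu hv ht (by omega)
      have hf := fresh_of_collisions_eq_zero hnb (hcol (p + 1) le_rfl q le_rfl huv)
        (p + 1 + q) le_rfl 0 (by omega)
      apply hf
      rw [concat_of_le (by omega), concat_of_ge huv (by omega), Nat.sub_self, h0]
    rcases Nat.eq_zero_or_pos q with rfl | hq
    · exact (hfin (fun q' h => by omega)).elim
    · obtain ⟨q, rfl⟩ : ∃ q', q = q' + 1 := ⟨q - 1, by omega⟩
      by_cases hpq : u p = v q
      · obtain ⟨rfl, h⟩ := ih q (fun t ht => hu t (by omega)) (fun t ht => hv t (by omega))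
          (fun p' hp' q' hq' => hcol p' (by omega) q' (by omega)) hpq
        refine ⟨rfl, fun t ht => ?_⟩
        rcases Nat.lt_or_ge p t with h1 | h1
        · obtain rfl : t = p + 1 := by omega
          exact huv
        · exact h t h1
      · exact (hfin (fun q' h => by obtain rfl : q = q' := by omega
                                    exact hpq)).elim

end WalkCount

namespace RandomLift

open WalkCount

variable {ι : Type} {c n : ℕ}

theorem exists_eq_nbr_symm [Nonempty (Fin c × ι)] (σ : ConstraintLift ι c n) (x : Vtx ι c n)
    (l : Fin c × ι) : ∃ l', x = nbr σ (nbr σ x l) l' := by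
  obtain ⟨j₀, i₀⟩ := Classical.arbitrary (Fin c × ι)
  rcases x with ⟨i, a⟩ | ⟨j, b⟩
  · exact ⟨(j₀, i), by simp [nbr]⟩
  · exact ⟨(j, i₀), by simp [nbr]⟩

theorem IsWalk.concat [Nonempty (Fin c × ι)] {σ : ConstraintLift ι c n} {u v : ℕ → Vtx ι c n}
    {p q : ℕ} (hu : IsWalk σ u p) (hv : IsWalk σ v q) (huv : u p = v q) :
    IsWalk σ (concat u p v q) (p + q) := by
  intro t ht
  rcases Nat.lt_or_ge t p with h | h
  · rw [concat_of_le (by omega), concat_of_le (by omega)]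
    exact hu t h
  · rw [concat_of_ge huv (by omega), concat_of_ge huv (by omega)]
    obtain ⟨l, hl⟩ := hv (p + q - (t + 1)) (by omega)
    rw [show p + q - (t + 1) + 1 = p + q - t by omega] at hl
    rw [hl]
    exact exists_eq_nbr_symm σ _ l

end RandomLift

/-! ### Words -/

namespace ForrLift

open NonBacktracking WalkCount RandomLift

variable {k c n : ℕ}

/-- A word, continued by an arbitrary letter. -/
def extendWord [NeZero c] {L : ℕ} (γ : Fin L → Letter k c) (t : ℕ) : Letter k c :=
  if h : t < L then γ ⟨t, h⟩ else (0, fun _ => 0)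

/-- Consecutive letters of the word belong to different constraints. -/
def IsReduced (g : ℕ → Letter k c) (L : ℕ) : Prop := ∀ t, t + 1 < L → (g t).1 ≠ (g (t + 1)).1

noncomputable instance (g : ℕ → Letter k c) (L : ℕ) : Decidable (IsReduced g L) := Classical.propDecidable _

/-- The variables visited by a word. -/
def vpos (σ : ConstraintLift (ForrVar k) c n) (x : Var k n) (g : ℕ → Letter k c) : ℕ → Var k n
  | 0 => x
  | t + 1 => step σ (vpos σ x g t) (g t)

/-- The product of the signs along a word. -/
def wordSign (σ : ConstraintLift (ForrVar k) c n) (ξ : Negations (ForrVar k) c n) (x : Var k n)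
    (g : ℕ → Letter k c) (L : ℕ) : ℤˣ :=
  ∏ t ∈ Finset.range L, stepSign σ ξ (vpos σ x g t) (g t)

theorem vpos_succ' (σ : ConstraintLift (ForrVar k) c n) (x : Var k n) (g : ℕ → Letter k c) (t : ℕ) :
    vpos σ x g (t + 1) = vpos σ (step σ x (g 0)) (fun t => g (t + 1)) t := by
  induction t with
  | zero => rfl
  | succ t ih => rw [vpos, ih]; rfl

theorem wordSign_succ' (σ : ConstraintLift (ForrVar k) c n) (ξ : Negations (ForrVar k) c n)
    (x : Var k n) (g : ℕ → Letter k c) (L : ℕ) :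
    wordSign σ ξ x g (L + 1) =
      stepSign σ ξ x (g 0) * wordSign σ ξ (step σ x (g 0)) (fun t => g (t + 1)) L := by
  unfold wordSign
  rw [Finset.prod_range_succ', mul_comm]
  congr 1
  refine Finset.prod_congr rfl fun t _ => ?_
  rw [vpos_succ']

section Words

variable [NeZero c]

theorem extendWord_cons_zero {L : ℕ} (l : Letter k c) (γ : Fin L → Letter k c) :
    extendWord (Fin.cons l γ : Fin (L + 1) → Letter k c) 0 = l := by
  simp [extendWord]

theorem extendWord_cons_succ {L : ℕ} (l : Letter k c) (γ : Fin L → Letter k c) (t : ℕ) :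
    extendWord (Fin.cons l γ : Fin (L + 1) → Letter k c) (t + 1) = extendWord γ t := by
  unfold extendWord
  by_cases h : t < L
  · rw [dif_pos (by omega), dif_pos h]
    exact Fin.cons_succ (α := fun _ => Letter k c) l γ ⟨t, h⟩
  · rw [dif_neg (by omega), dif_neg h]

theorem extendWord_zero {L : ℕ} (γ : Fin (L + 1) → Letter k c) : extendWord γ 0 = γ 0 := by
  simp [extendWord]

theorem isReduced_cons {L : ℕ} (l : Letter k c) (γ : Fin (L + 1) → Letter k c) :
    IsReduced (extendWord (Fin.cons l γ : Fin (L + 2) → Letter k c)) (L + 2) ↔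
      l.1 ≠ (γ 0).1 ∧ IsReduced (extendWord γ) (L + 1) := by
  constructor
  · intro h
    constructor
    · have := h 0 (by omega)
      rwa [extendWord_cons_zero, extendWord_cons_succ, extendWord_zero] at this
    · intro t ht
      have := h (t + 1) (by omega)
      rwa [extendWord_cons_succ, extendWord_cons_succ] at this
  · rintro ⟨h1, h2⟩ t ht
    rcases t with _ | t
    · rwa [extendWord_cons_zero, extendWord_cons_succ, extendWord_zero]
    · rw [extendWord_cons_succ, extendWord_cons_succ]
      exact h2 t (by omega)

theorem sum_words_succ {N : Type*} [AddCommMonoid N] {L : ℕ} (F : (Fin (L + 1) → Letter k c) → N) :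
    ∑ γ, F γ = ∑ j : Fin c, ∑ s : Fin k → Fin 2, ∑ γ : Fin L → Letter k c,
      F (Fin.cons (j, s) γ) := by
  rw [← (Fin.consEquiv (fun _ : Fin (L + 1) => Letter k c)).sum_comp, Fintype.sum_prod_type,
    Fintype.sum_prod_type]
  rfl

/-- The recursion for `nbProd` splits off the leftmost factor, which corresponds to splitting the
first letter off the word. -/
theorem nbProd_block_apply (σ : ConstraintLift (ForrVar k) c n) (ξ : Negations (ForrVar k) c n)
    (ℓ : ℕ) : ∀ (j : Fin c) (x z : Var k n), nbProd (block σ ξ) ℓ j x z =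
      ∑ γ : Fin (ℓ + 1) → Letter k c, if IsReduced (extendWord γ) (ℓ + 1) ∧ (γ 0).1 = j ∧
        vpos σ x (extendWord γ) (ℓ + 1) = z then
          ((wordSign σ ξ x (extendWord γ) (ℓ + 1) : ℤ) : ℝ) else 0 := by
  induction ℓ with
  | zero =>
    intro j x z
    rw [sum_words_succ, Finset.sum_eq_single j]
    · simp only [nbProd, block]
      refine Finset.sum_congr rfl fun s _ => ?_
      have hred : ∀ γ : Fin 1 → Letter k c, IsReduced (extendWord γ) 1 :=
        fun γ t ht => by omega
      simp [hred, vpos, wordSign, extendWord_cons_zero]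
    · intro j' _ hj'
      refine Finset.sum_eq_zero fun s _ => Finset.sum_eq_zero fun γ _ => if_neg ?_
      rintro ⟨_, h, _⟩
      exact hj' (by simpa using h)
    · simp
  | succ ℓ ih =>
    intro j x z
    rw [sum_words_succ, Finset.sum_eq_single j]
    · simp only [nbProd]
      rw [block_mul_apply]
      refine Finset.sum_congr rfl fun s _ => ?_
      rw [Matrix.sum_apply]
      simp only [ih]
      rw [Finset.sum_comm, Finset.mul_sum]
      refine Finset.sum_congr rfl fun γ _ => ?_
      have h1 : (fun t => extendWord (Fin.cons (j, s) γ : Fin (ℓ + 2) → Letter k c) (t + 1)) =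
          extendWord γ := funext fun t => extendWord_cons_succ _ _ _
      simp only [isReduced_cons]
      rw [vpos_succ' σ x (extendWord (Fin.cons (j, s) γ : Fin (ℓ + 2) → Letter k c)),
        wordSign_succ' σ ξ x (extendWord (Fin.cons (j, s) γ : Fin (ℓ + 2) → Letter k c)), h1, extendWord_cons_zero]
      by_cases hγ : (γ 0).1 = j
      · rw [if_neg (by rintro ⟨⟨h, _⟩, _⟩; exact h hγ.symm), Finset.sum_eq_zero, mul_zero]
        intro j' hj'
        rw [if_neg]
        rintro ⟨_, h, _⟩
        exact (Finset.mem_erase.1 hj').1 (h.symm.trans hγ)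
      · rw [Finset.sum_eq_single_of_mem (γ 0).1 (Finset.mem_erase.2 ⟨hγ, Finset.mem_univ _⟩)]
        · by_cases hz : IsReduced (extendWord γ) (ℓ + 1) ∧
            vpos σ (step σ x (j, s)) (extendWord γ) (ℓ + 1) = z
          · rw [if_pos ⟨hz.1, rfl, hz.2⟩, if_pos ⟨⟨fun h => hγ h.symm, hz.1⟩, by simp, hz.2⟩]
            push_cast
            rfl
          · rw [if_neg (fun h => hz ⟨h.1, h.2.2⟩), if_neg (fun h => hz ⟨h.1.2, h.2.2⟩), mul_zero]
        · intro j' _ hj'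
          exact if_neg (fun h => hj' h.2.1.symm)
    · intro j' _ hj'
      refine Finset.sum_eq_zero fun s _ => Finset.sum_eq_zero fun γ _ => if_neg ?_
      rintro ⟨_, h, _⟩
      exact hj' (by simpa using h)
    · simp

theorem nbSum_block_apply (σ : ConstraintLift (ForrVar k) c n) (ξ : Negations (ForrVar k) c n)
    (ℓ : ℕ) (x z : Var k n) : nbSum (block σ ξ) ℓ x z =
      ∑ γ : Fin (ℓ + 1) → Letter k c, if IsReduced (extendWord γ) (ℓ + 1) ∧
        vpos σ x (extendWord γ) (ℓ + 1) = z then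
          ((wordSign σ ξ x (extendWord γ) (ℓ + 1) : ℤ) : ℝ) else 0 := by
  rw [nbSum, Matrix.sum_apply]
  simp only [nbProd_block_apply]
  rw [Finset.sum_comm]
  refine Finset.sum_congr rfl fun γ _ => ?_
  rw [Finset.sum_eq_single (γ 0).1]
  · simp
  · intro j _ hj
    exact if_neg (fun h => hj h.2.1.symm)
  · simp

/-- Each further letter has `c - 1` admissible constraint kinds and `2^k` coordinates. -/
theorem card_reduced_first (ℓ : ℕ) : ∀ j : Fin c,
    (Finset.univ.filter (fun γ : Fin (ℓ + 1) → Letter k c =>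
      IsReduced (extendWord γ) (ℓ + 1) ∧ (γ 0).1 = j)).card = 2 ^ k * ((c - 1) * 2 ^ k) ^ ℓ := by
  induction ℓ with
  | zero =>
    intro j
    have hred : ∀ γ : Fin 1 → Letter k c, IsReduced (extendWord γ) 1 := fun γ t ht => by omega
    rw [Finset.card_filter, sum_words_succ, Finset.sum_eq_single j]
    · simp [hred]
    · intro j' _ hj'
      simp [hj']
    · simp
  | succ ℓ ih =>
    intro j
    rw [Finset.card_filter, sum_words_succ, Finset.sum_eq_single j]
    · have h1 : ∀ γ : Fin (ℓ + 1) → Letter k c, ∀ s : Fin k → Fin 2,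
          (if IsReduced (extendWord (Fin.cons (j, s) γ : Fin (ℓ + 2) → Letter k c)) (ℓ + 2) ∧
            ((Fin.cons (j, s) γ : Fin (ℓ + 2) → Letter k c) 0).1 = j then 1 else 0) =
          ∑ j' ∈ Finset.univ.erase j,
            if IsReduced (extendWord γ) (ℓ + 1) ∧ (γ 0).1 = j' then 1 else 0 := by
        intro γ s
        simp only [isReduced_cons]
        by_cases hγ : (γ 0).1 = j
        · rw [if_neg (by rintro ⟨⟨h, _⟩, _⟩; exact h hγ.symm), Finset.sum_eq_zero]
          intro j' hj'
          rw [if_neg]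
          rintro ⟨_, h⟩
          exact (Finset.mem_erase.1 hj').1 (h.symm.trans hγ)
        · rw [Finset.sum_eq_single_of_mem (γ 0).1 (Finset.mem_erase.2 ⟨hγ, Finset.mem_univ _⟩)]
          · have : j ≠ (γ 0).1 := fun h => hγ h.symm
            simp [this]
          · intro j' _ hj'
            exact if_neg (fun h => hj' h.2.symm)
      simp only [h1]
      rw [Finset.sum_const, Finset.sum_comm]
      simp only [← Finset.card_filter, ih]
      rw [Finset.sum_const, Finset.card_erase_of_mem (Finset.mem_univ _)]
      simp only [Finset.card_univ, Fintype.card_fun, Fintype.card_fin, smul_eq_mul]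
      ring
    · intro j' _ hj'
      simp [hj']
    · simp

theorem card_reduced (ℓ : ℕ) :
    (Finset.univ.filter (fun γ : Fin (ℓ + 1) → Letter k c =>
      IsReduced (extendWord γ) (ℓ + 1))).card = c * (2 ^ k * ((c - 1) * 2 ^ k) ^ ℓ) := by
  rw [Finset.card_eq_sum_card_fiberwise (f := fun γ => (γ 0).1) (t := Finset.univ)
    (fun _ _ => Finset.mem_univ _)]
  simp only [Finset.filter_filter, card_reduced_first]
  simp

end Words

/-! ### The walk of a word in the constraint graph -/

/-- The walk of a word, including the constraints that it passes through. -/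
def halfWalk (σ : ConstraintLift (ForrVar k) c n) (x : Var k n) (g : ℕ → Letter k c) (t : ℕ) :
    Vtx (ForrVar k) c n :=
  if Even t then Sum.inl (vpos σ x g (t / 2)) else Sum.inr (constr σ (vpos σ x g (t / 2)) (g (t / 2)).1)

section HalfWalk

variable (σ : ConstraintLift (ForrVar k) c n) (x : Var k n) (g : ℕ → Letter k c)

theorem halfWalk_two_mul (t : ℕ) : halfWalk σ x g (2 * t) = Sum.inl (vpos σ x g t) := by
  simp [halfWalk]

theorem halfWalk_two_mul_add_one (t : ℕ) :
    halfWalk σ x g (2 * t + 1) = Sum.inr (constr σ (vpos σ x g t) (g t).1) := by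
  have h1 : ¬ Even (2 * t + 1) := by simp
  have h2 : (2 * t + 1) / 2 = t := by omega
  simp [halfWalk, h2]

theorem isWalk_halfWalk (L : ℕ) : IsWalk σ (halfWalk σ x g) L := by
  intro t _
  obtain ⟨a, rfl | rfl⟩ := Nat.even_or_odd' t
  · refine ⟨((g a).1, opp (vpos σ x g a).1 (g a).2), ?_⟩
    rw [halfWalk_two_mul_add_one, halfWalk_two_mul]
    rfl
  · refine ⟨((g a).1, opp (vpos σ x g a).1 (g a).2), ?_⟩
    rw [halfWalk_two_mul_add_one, show 2 * a + 1 + 1 = 2 * (a + 1) by ring, halfWalk_two_mul]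
    rfl

theorem opp_ne (i : ForrVar k) (s : Fin k → Fin 2) : opp i s ≠ i := by
  rcases i with _ | _ <;> simp [opp]

/-- Backtracking at a constraint is impossible since its two variables lie on opposite sides of the
bipartition; at a variable it is excluded because the word is reduced. -/
theorem halfWalk_ne_add_two {L : ℕ} (hg : IsReduced g L) (t : ℕ) (ht : t + 2 ≤ 2 * L) :
    halfWalk σ x g t ≠ halfWalk σ x g (t + 2) := by
  obtain ⟨a, rfl | rfl⟩ := Nat.even_or_odd' t
  · rw [show 2 * a + 2 = 2 * (a + 1) by ring, halfWalk_two_mul, halfWalk_two_mul]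
    intro h
    rw [Sum.inl.injEq] at h
    have := congrArg Prod.fst h
    exact opp_ne _ _ this.symm
  · rw [show 2 * a + 1 + 2 = 2 * (a + 1) + 1 by ring, halfWalk_two_mul_add_one,
      halfWalk_two_mul_add_one]
    intro h
    rw [Sum.inr.injEq] at h
    exact hg a (by omega) (by simpa [constr] using congrArg Prod.fst h)

/-- A letter is recovered from the kind of the constraint and from the coordinate of the variable
reached. -/
theorem eq_of_halfWalk_eq {x y : Var k n} {g g' : ℕ → Letter k c} {L : ℕ}
    (h : ∀ t ≤ 2 * L, halfWalk σ x g t = halfWalk σ y g' t) : x = y ∧ ∀ t < L, g t = g' t := by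
  have h1 : ∀ t ≤ L, vpos σ x g t = vpos σ y g' t := by
    intro t ht
    have := h (2 * t) (by omega)
    rwa [halfWalk_two_mul, halfWalk_two_mul, Sum.inl.injEq] at this
  refine ⟨h1 0 (Nat.zero_le _), fun t ht => Prod.ext ?_ ?_⟩
  · have := h (2 * t + 1) (by omega)
    rw [halfWalk_two_mul_add_one, halfWalk_two_mul_add_one, Sum.inr.injEq] at this
    simpa [constr] using congrArg Prod.fst this
  · have h2 := congrArg (fun v => idx v.1) (h1 (t + 1) ht)
    simpa [vpos, step, idx_opp] using h2

end HalfWalk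

end ForrLift

/-! ### Pairs of words that visit every constraint twice -/

namespace ForrLift

open NonBacktracking WalkCount RandomLift

variable {k c n : ℕ}

/-- The constraints visited by a pair of words from `x`. -/
def visit [NeZero c] (σ : ConstraintLift (ForrVar k) c n) (x : Var k n) {L : ℕ}
    (γ₁ γ₂ : Fin L → Letter k c) : Fin L ⊕ Fin L → Fin c × Fin n
  | Sum.inl t => constr σ (vpos σ x (extendWord γ₁) t) (extendWord γ₁ t).1
  | Sum.inr t => constr σ (vpos σ x (extendWord γ₂) t) (extendWord γ₂ t).1

/-- Two reduced words from `x` with a common end point. -/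
def IsReducedPair [NeZero c] (σ : ConstraintLift (ForrVar k) c n) (x : Var k n) {L : ℕ}
    (γ γ' : Fin L → Letter k c) : Prop :=
  IsReduced (extendWord γ) L ∧ IsReduced (extendWord γ') L ∧
    vpos σ x (extendWord γ) L = vpos σ x (extendWord γ') L

open Classical in
/-- The pairs of words that contribute to the second moment. -/
noncomputable def doublePairs [NeZero c] (σ : ConstraintLift (ForrVar k) c n) (L : ℕ) :
    Finset (Var k n × (Fin L → Letter k c) × (Fin L → Letter k c)) :=
  Finset.univ.filter (fun a => IsReducedPair σ a.1 a.2.1 a.2.2 ∧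
    ∀ v, ∃ v' ≠ v, visit σ a.1 a.2.1 a.2.2 v' = visit σ a.1 a.2.1 a.2.2 v)

/-- Walks of length `m * r` have at most `T` collisions, walks of length `r` at most one. -/
def IsSparse (σ : ConstraintLift (ForrVar k) c n) (m r T : ℕ) : Prop :=
  (∀ w, IsWalk σ w (m * r) → collisions w (m * r) ≤ T) ∧ (∀ w, IsWalk σ w r → collisions w r ≤ 1)

open Classical in
/-- The possible continuations of a walk that came from the first vertex to the second one. -/
noncomputable def continuations (σ : ConstraintLift (ForrVar k) c n) :
    Vtx (ForrVar k) c n → Vtx (ForrVar k) c n → Finset (Vtx (ForrVar k) c n)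
  | u, Sum.inl y => (Finset.univ.image (fun j => Sum.inr (constr σ y j))).erase u
  | Sum.inl y, Sum.inr f => Finset.univ.image (fun s => Sum.inl (opp y.1 s, σ (opp y.1 s, f.1) f.2))
  | Sum.inr _, Sum.inr _ => ∅

variable (σ : ConstraintLift (ForrVar k) c n)

theorem card_continuations_inl {u : Vtx (ForrVar k) c n} {y : Var k n}
    (h : ∃ l, u = nbr σ (Sum.inl y) l) : (continuations σ u (Sum.inl y)).card ≤ c - 1 := by
  classical
  obtain ⟨l, rfl⟩ := h
  unfold continuations
  rw [Finset.card_erase_of_mem]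
  · have := Finset.card_image_le (s := (Finset.univ : Finset (Fin c)))
      (f := fun j => (Sum.inr (constr σ y j) : Vtx (ForrVar k) c n))
    rw [Finset.card_univ, Fintype.card_fin] at this
    omega
  · exact Finset.mem_image.2 ⟨l.1, Finset.mem_univ _, rfl⟩

theorem card_continuations_inr (u : Vtx (ForrVar k) c n) (f : Fin c × Fin n) :
    (continuations σ u (Sum.inr f)).card ≤ 2 ^ k := by
  classical
  rcases u with y | _
  · unfold continuations
    refine Finset.card_image_le.trans ?_
    simp
  · simp [continuations]

theorem halfWalk_mem_continuations (x : Var k n) (g : ℕ → Letter k c) (a : ℕ) :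
    halfWalk σ x g (2 * a + 2) ∈
      continuations σ (halfWalk σ x g (2 * a)) (halfWalk σ x g (2 * a + 1)) := by
  classical
  rw [show 2 * a + 2 = 2 * (a + 1) by ring, halfWalk_two_mul, halfWalk_two_mul,
    halfWalk_two_mul_add_one]
  exact Finset.mem_image.2 ⟨(g a).2, Finset.mem_univ _, rfl⟩

/-- Needed because the closed walk of a pair runs its second word backwards. -/
theorem halfWalk_mem_continuations' (x : Var k n) (g : ℕ → Letter k c) (a : ℕ) :
    halfWalk σ x g (2 * a) ∈
      continuations σ (halfWalk σ x g (2 * a + 2)) (halfWalk σ x g (2 * a + 1)) := by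
  classical
  rw [show 2 * a + 2 = 2 * (a + 1) by ring, halfWalk_two_mul, halfWalk_two_mul,
    halfWalk_two_mul_add_one]
  refine Finset.mem_image.2 ⟨idx (vpos σ x g a).1, Finset.mem_univ _, ?_⟩
  simp only [vpos, step, opp_idx]
  simp [constr]

theorem isWalk_mem_image {w : ℕ → Vtx (ForrVar k) c n} {N t : ℕ} (hw : IsWalk σ w N) (ht : t < N)
    [DecidableEq (Vtx (ForrVar k) c n)] : w (t + 1) ∈ Finset.univ.image (nbr σ (w t)) := by
  obtain ⟨l, hl⟩ := hw t ht
  exact Finset.mem_image.2 ⟨l, Finset.mem_univ _, hl.symm⟩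

theorem nbr_ne (x : Vtx (ForrVar k) c n) (l : Fin c × ForrVar k) : x ≠ nbr σ x l := by
  rcases x with _ | _ <;> simp [nbr]

theorem IsWalk.shift {w : ℕ → Vtx (ForrVar k) c n} {N : ℕ} (hw : IsWalk σ w N) {a r : ℕ}
    (h : a + r ≤ N) : IsWalk σ (fun b => w (a + b)) r := fun t ht => hw (a + t) (by omega)

theorem extendWord_inj [NeZero c] {L : ℕ} {γ γ' : Fin L → Letter k c}
    (h : ∀ t < L, extendWord γ t = extendWord γ' t) : γ = γ' := by
  ext1 ⟨t, ht⟩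
  have := h t ht
  simpa [extendWord, ht] using this

/-- The closed walk of a pair of words. -/
def pairWalk [NeZero c] {L : ℕ} (a : Var k n × (Fin L → Letter k c) × (Fin L → Letter k c)) :
    ℕ → Vtx (ForrVar k) c n :=
  concat (halfWalk σ a.1 (extendWord a.2.1)) (2 * L) (halfWalk σ a.1 (extendWord a.2.2)) (2 * L)

/-- The closed walk of a pair has length `4L` and may backtrack only at its turning point `2L`. It
leaves a variable in at most `c - 1` ways at even times, a constraint in at most `2^k` ways at odd
times, and meets at most `L` different constraints, so `card_walks_le` applies. -/
theorem card_doublePairs_le (hc : 2 ≤ c) [NeZero c] {L K r T : ℕ} (hr : 0 < r) (hL : 2 * L = K * r)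
    (hσ : IsSparse σ (2 * K) r T) :
    (doublePairs σ L).card ≤ ((c - 1) * 2 ^ k) ^ L * (Fintype.card (Var k n) *
      (((r + 2) * ((r + 2) * (r + 2))) ^ (2 * K) *
      (2 * K * r * (Fintype.card (Fin c × ForrVar k) + (2 * K * r + 1)) + 1) ^
        eventBound T (2 * K))) := by
  classical
  have hN : 2 * K * r = 2 * L + 2 * L := by rw [hL]; ring
  have hmem : ∀ a ∈ doublePairs σ L, IsReducedPair σ a.1 a.2.1 a.2.2 ∧
    ∀ v, ∃ v' ≠ v, visit σ a.1 a.2.1 a.2.2 v' = visit σ a.1 a.2.1 a.2.2 v := by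
    intro a ha
    simpa [doublePairs] using ha
  have hjoin : ∀ a ∈ doublePairs σ L, halfWalk σ a.1 (extendWord a.2.1) (2 * L) =
      halfWalk σ a.1 (extendWord a.2.2) (2 * L) := by
    intro a ha
    rw [halfWalk_two_mul, halfWalk_two_mul, (hmem a ha).1.2.2]
  have hle : ∀ a t, t ≤ 2 * L → pairWalk σ a t = halfWalk σ a.1 (extendWord a.2.1) t :=
    fun a t ht => concat_of_le ht
  have hge : ∀ a ∈ doublePairs σ L, ∀ t, 2 * L ≤ t → pairWalk σ a t =
      halfWalk σ a.1 (extendWord a.2.2) (2 * L + 2 * L - t) :=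
    fun a ha t ht => concat_of_ge (hjoin a ha) ht
  have hwalk : ∀ a ∈ doublePairs σ L, IsWalk σ (pairWalk σ a) (2 * L + 2 * L) := by
    intro a ha
    have : Nonempty (Fin c × ForrVar k) := ⟨(0, Sum.inl fun _ => 0)⟩
    exact IsWalk.concat (isWalk_halfWalk σ _ _ _) (isWalk_halfWalk σ _ _ _) (hjoin a ha)
  have hnb : ∀ a ∈ doublePairs σ L, ∀ t, t + 2 ≤ 2 * L + 2 * L → t + 1 ≠ 2 * L →
      pairWalk σ a t ≠ pairWalk σ a (t + 2) := by
    intro a ha t ht htm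
    exact concat_ne_add_two (hjoin a ha) (halfWalk_ne_add_two σ _ _ (hmem a ha).1.1)
      (halfWalk_ne_add_two σ _ _ (hmem a ha).1.2.1) ht htm
  have heven : ∀ a ∈ doublePairs σ L, ∀ t ≤ 2 * L + 2 * L, Even t →
      ∃ y, pairWalk σ a t = Sum.inl y := by
    rintro a ha t ht ⟨b, rfl⟩
    rcases Nat.lt_or_ge (b + b) (2 * L) with h | h
    · exact ⟨_, by rw [hle a _ h.le, ← two_mul, halfWalk_two_mul]⟩
    · refine ⟨vpos σ a.1 (extendWord a.2.2) (L + L - b), ?_⟩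
      rw [hge a ha _ h, show 2 * L + 2 * L - (b + b) = 2 * (L + L - b) by omega, halfWalk_two_mul]
  have hoddv : ∀ a ∈ doublePairs σ L, ∀ t ≤ 2 * L + 2 * L, Odd t →
      ∃ v, pairWalk σ a t = Sum.inr (visit σ a.1 a.2.1 a.2.2 v) := by
    rintro a ha t ht ⟨b, rfl⟩
    rcases Nat.lt_or_ge (2 * b + 1) (2 * L) with h | h
    · refine ⟨Sum.inl ⟨b, by omega⟩, ?_⟩
      rw [hle a _ h.le, halfWalk_two_mul_add_one]
      rfl
    · refine ⟨Sum.inr ⟨L + L - b - 1, by omega⟩, ?_⟩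
      rw [hge a ha _ h, show 2 * L + 2 * L - (2 * b + 1) = 2 * (L + L - b - 1) + 1 by omega,
        halfWalk_two_mul_add_one]
      rfl
  have hmain := card_walks_le (doublePairs σ L) (pairWalk σ) (m := 2 * K) (r := r) (mid := 2 * L)
    (T := T) (ℓ := L) (Δ := Fintype.card (Fin c × ForrVar k)) (d₁ := c - 1) (d₂ := 2 ^ k) hr
    (by rw [hL]; exact Dvd.intro_left K rfl) (by omega) Nat.one_le_two_pow
    (Finset.univ.image Sum.inl) (fun x => Finset.univ.image (nbr σ x)) (continuations σ)
    (by
      rw [hN]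
      intro a ha b hb hab
      obtain ⟨h1, h2⟩ := eq_of_halfWalk_eq σ (x := a.1) (y := b.1) (g := extendWord a.2.1)
        (g' := extendWord b.2.1) (L := L) (fun t ht => by
          rw [← hle a t ht, ← hle b t ht]
          exact hab t (by omega))
      obtain ⟨-, h3⟩ := eq_of_halfWalk_eq σ (x := a.1) (y := b.1) (g := extendWord a.2.2)
        (g' := extendWord b.2.2) (L := L) (fun t ht => by
          have := hab (2 * L + 2 * L - t) (by omega)
          rw [hge a ha _ (by omega), hge b hb _ (by omega)] at this
          rwa [show 2 * L + 2 * L - (2 * L + 2 * L - t) = t by omega] at this)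
      exact Prod.ext h1 (Prod.ext (extendWord_inj h2) (extendWord_inj h3)))
    (by
      rw [hN]
      intro a ha t ht
      obtain ⟨l, hl⟩ := hwalk a ha t ht
      rw [hl]
      exact nbr_ne σ _ l)
    (by rw [hN]; exact hnb)
    (by
      intro a ha
      refine hσ.1 _ ?_
      rw [hN]
      exact hwalk a ha)
    (by
      intro a ha i hi
      refine hσ.2 _ (IsWalk.shift σ (hwalk a ha) ?_)
      rw [← hN]
      calc i * r + r = (i + 1) * r := by ring
        _ ≤ 2 * K * r := Nat.mul_le_mul_right r hi)
    (by
      rw [hN]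
      intro a ha
      refine ⟨(Finset.univ.image (visit σ a.1 a.2.1 a.2.2)).image Sum.inr, ?_, ?_⟩
      · refine Finset.card_image_le.trans ?_
        -- There are `2L` visits and every visited constraint is visited at least twice.
        have := Finset.mul_card_image_le_card (f := visit σ a.1 a.2.1 a.2.2) Finset.univ 2 (by
          intro b hb
          obtain ⟨v, -, rfl⟩ := Finset.mem_image.1 hb
          obtain ⟨v', hv', h⟩ := (hmem a ha).2 v
          exact Finset.one_lt_card.2 ⟨v', by simp [h], v, by simp, hv'⟩)
        rw [Finset.card_univ, Fintype.card_sum, Fintype.card_fin] at this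
        omega
      · intro t ht hodd
        obtain ⟨v, hv⟩ := hoddv a ha t ht hodd
        rw [hv]
        exact Finset.mem_image_of_mem _ (Finset.mem_image_of_mem _ (Finset.mem_univ v)))
    (by
      intro a ha
      obtain ⟨y, hy⟩ := heven a ha 0 (by omega) (by simp)
      rw [hy]
      exact Finset.mem_image_of_mem _ (Finset.mem_univ _))
    (by
      rw [hN]
      intro a ha t ht
      exact isWalk_mem_image σ (hwalk a ha) ht)
    (by
      intro x
      exact Finset.card_image_le.trans (by rw [Finset.card_univ]))
    (by
      rw [hN]
      intro a ha t ht ht0 htm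
      rcases Nat.even_or_odd t with he | ho
      · obtain ⟨y, hy⟩ := heven a ha t ht.le he
        obtain ⟨l, hl⟩ := hwalk a ha t ht
        rw [hy] at hl ⊢
        unfold continuations
        refine Finset.mem_erase.2 ⟨?_, Finset.mem_image.2 ⟨l.1, Finset.mem_univ _, hl.symm⟩⟩
        have := hnb a ha (t - 1) (by omega) (by omega)
        rw [show t - 1 + 2 = t + 1 by omega] at this
        exact this.symm
      · obtain ⟨b, rfl⟩ := ho
        rcases Nat.lt_or_ge (2 * b + 1) (2 * L) with h | h
        · rw [hle a (2 * b + 1 + 1) (by omega), hle a (2 * b + 1 - 1) (by omega), hle a _ h.le]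
          exact halfWalk_mem_continuations σ _ _ b
        · rw [hge a ha (2 * b + 1 + 1) (by omega), hge a ha (2 * b + 1 - 1) (by omega),
            hge a ha (2 * b + 1) (by omega)]
          have := halfWalk_mem_continuations' σ a.1 (extendWord a.2.2) (L + L - b - 1)
          rw [show 2 * L + 2 * L - (2 * b + 1 + 1) = 2 * (L + L - b - 1) by omega,
            show 2 * L + 2 * L - (2 * b + 1 - 1) = 2 * (L + L - b - 1) + 2 by omega,
            show 2 * L + 2 * L - (2 * b + 1) = 2 * (L + L - b - 1) + 1 by omega]
          exact this)
    (by
      rw [hN]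
      intro a ha t ht ht0 htm
      split_ifs with he
      · obtain ⟨y, hy⟩ := heven a ha t ht.le he
        rw [hy]
        apply card_continuations_inl
        have : Nonempty (Fin c × ForrVar k) := ⟨(0, Sum.inl fun _ => 0)⟩
        obtain ⟨l, hl⟩ := hwalk a ha (t - 1) (by omega)
        obtain ⟨l', hl'⟩ := exists_eq_nbr_symm σ (pairWalk σ a (t - 1)) l
        rw [← hl, show t - 1 + 1 = t by omega, hy] at hl'
        exact ⟨l', hl'⟩
      · obtain ⟨v, hv⟩ := hoddv a ha t ht.le (Nat.not_even_iff_odd.1 he)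
        rw [hv]
        exact card_continuations_inr σ _ _)
  refine hmain.trans (Nat.mul_le_mul_left _ (Nat.mul_le_mul_right _ ?_))
  exact Finset.card_image_le.trans (by rw [Finset.card_univ])

end ForrLift

/-! ### The second moment over the signs -/

namespace ForrLift

open NonBacktracking WalkCount RandomLift

instance measurableSingletonClassIntUnits : MeasurableSingletonClass ℤˣ := ⟨fun u => by
  have : ({u} : Set ℤˣ) = Units.val ⁻¹' {(u : ℤ)} := by ext v; simp [Units.ext_iff]
  rw [this]
  exact ⟨_, MeasurableSet.singleton _, rfl⟩⟩

instance discreteMeasurableSpacePerm (n : ℕ) : DiscreteMeasurableSpace (Equiv.Perm (Fin n)) :=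
  ⟨fun _ => trivial⟩

variable {k c n : ℕ}

theorem abs_unit (u : ℤˣ) : |((u : ℤ) : ℝ)| = 1 := by
  rcases Int.units_eq_one_or u with rfl | rfl <;> simp

theorem integral_unit_eq_zero {Ω : Type*} [MeasurableSpace Ω] [DiscreteMeasurableSpace Ω]
    [Finite Ω] (ν : Measure Ω) [IsProbabilityMeasure ν] (u : Ω → ℤˣ)
    (h : ν {ζ | u ζ = -1} = 1 / 2) : ∫ ζ, ((u ζ : ℤ) : ℝ) ∂ν = 0 := by
  have h1 : ∀ ζ, ((u ζ : ℤ) : ℝ) = 1 - 2 * Set.indicator {ζ | u ζ = -1} (fun _ => (1 : ℝ)) ζ := by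
    intro ζ
    rcases Int.units_eq_one_or (u ζ) with hu | hu
    · simp [Set.indicator, hu]
    · simp [Set.indicator, hu]; norm_num
  simp only [h1]
  rw [integral_sub Integrable.of_finite Integrable.of_finite, integral_const_mul,
    integral_indicator (MeasurableSet.of_discrete), setIntegral_const, measureReal_def, h]
  simp

/-- If some coordinate is used by one factor only, and that factor has mean zero, then the product
has mean zero. -/
theorem integral_prod_eq_zero {F J Ω : Type*} [Fintype F] [DecidableEq F] [Fintype J]
    [MeasurableSpace Ω] (ν : F → Measure Ω) [∀ f, IsProbabilityMeasure (ν f)] (f : J → F)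
    (h : J → Ω → ℝ) (v₀ : J) (huniq : ∀ v, v ≠ v₀ → f v ≠ f v₀)
    (hzero : ∫ ζ, h v₀ ζ ∂(ν (f v₀)) = 0) :
    ∫ ξ, ∏ v, h v (ξ (f v)) ∂(Measure.pi ν) = 0 := by
  classical
  have h1 : ∀ ξ : F → Ω, ∏ v, h v (ξ (f v)) =
      ∏ a, ∏ v ∈ Finset.univ.filter (fun v => f v = a), h v (ξ a) := by
    intro ξ
    rw [← Finset.prod_fiberwise Finset.univ f]
    refine Finset.prod_congr rfl fun a _ => Finset.prod_congr rfl fun v hv => ?_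
    rw [(Finset.mem_filter.1 hv).2]
  simp only [h1]
  rw [integral_fintype_prod_eq_prod (fun a ζ => ∏ v ∈ Finset.univ.filter (fun v => f v = a), h v ζ)]
  refine Finset.prod_eq_zero (Finset.mem_univ (f v₀)) ?_
  have h2 : Finset.univ.filter (fun v => f v = f v₀) = {v₀} := by
    ext v
    simp only [Finset.mem_filter, Finset.mem_univ, true_and, Finset.mem_singleton]
    constructor
    · intro hv
      by_contra hne
      exact huniq v hne hv
    · rintro rfl; rfl
  simp [h2, hzero]

section SecondMoment

variable [NeZero c] (σ : ConstraintLift (ForrVar k) c n)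

/-- The variable and the letter of a step of a pair of words. -/
def pairStep (x : Var k n) {L : ℕ} (γ₁ γ₂ : Fin L → Letter k c) :
    Fin L ⊕ Fin L → Var k n × Letter k c
  | Sum.inl t => (vpos σ x (extendWord γ₁) t, extendWord γ₁ t)
  | Sum.inr t => (vpos σ x (extendWord γ₂) t, extendWord γ₂ t)

/-- The sign of a step as a function of the signs at its constraint. -/
def localSign (p : Var k n × Letter k c) (ζ : ForrVar k → ℤˣ) : ℤˣ :=
  forrSign p.1.1 p.2.2 * (ζ p.1.1 * ζ (opp p.1.1 p.2.2))

theorem integral_localSign {ν : Measure (ForrVar k → ℤˣ)} [IsProbabilityMeasure ν]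
    (hν : IsOneWiseUniform (forrelation k) ν) (p : Var k n × Letter k c) :
    ∫ ζ, ((localSign p ζ : ℤ) : ℝ) ∂ν = 0 := by
  simp only [localSign, Units.val_mul, Int.cast_mul]
  rw [integral_const_mul]
  have h : ∫ ζ, ((ζ p.1.1 * ζ (opp p.1.1 p.2.2) : ℤˣ) : ℝ) ∂ν = 0 := by
    apply integral_unit_eq_zero
    obtain ⟨⟨i, a⟩, j, s⟩ := p
    rcases i with x | x
    · exact hν (x, s)
    · have := hν (s, x)
      simp only [opp]
      simp only [forrelation] at this
      rw [← this]
      congr 1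
      ext ζ
      simp only [Set.mem_ofPred_eq, mul_comm]
  simp only [Units.val_mul, Int.cast_mul] at h
  rw [h, mul_zero]

theorem wordSign_mul_wordSign (ξ : Negations (ForrVar k) c n) (x : Var k n) {L : ℕ}
    (γ γ' : Fin L → Letter k c) :
    ((wordSign σ ξ x (extendWord γ) L : ℤ) : ℝ) * ((wordSign σ ξ x (extendWord γ') L : ℤ) : ℝ) =
      ∏ v, ((localSign (pairStep σ x γ γ' v) (ξ (visit σ x γ γ' v)) : ℤ) : ℝ) := by
  rw [Fintype.prod_sum_type]
  simp only [wordSign, Finset.prod_range, Units.coe_prod, Int.cast_prod]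
  rfl

/-- If some constraint is visited exactly once, its sign is independent of the other factors and has
mean zero. Otherwise the pair is counted in `doublePairs`, and a product of signs is at most one. -/
theorem integral_pair_le (ν : Fin c × Fin n → Measure (ForrVar k → ℤˣ))
    [∀ f, IsProbabilityMeasure (ν f)] (hν : ∀ f, IsOneWiseUniform (forrelation k) (ν f))
    (x : Var k n) {L : ℕ} (γ γ' : Fin L → Letter k c) [Decidable (IsReducedPair σ x γ γ')] :
    ∫ ξ, (if IsReducedPair σ x γ γ' then ((wordSign σ ξ x (extendWord γ) L : ℤ) : ℝ) *
      ((wordSign σ ξ x (extendWord γ') L : ℤ) : ℝ) else 0) ∂(Measure.pi ν) ≤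
      Set.indicator (doublePairs σ L : Set _) (fun _ => (1 : ℝ)) (x, γ, γ') := by
  classical
  by_cases hred : IsReducedPair σ x γ γ'
  swap
  · simp only [hred, if_false, integral_zero]
    exact Set.indicator_nonneg (fun _ _ => zero_le_one) _
  simp only [hred, if_true, wordSign_mul_wordSign]
  by_cases hd : ∀ v, ∃ v' ≠ v, visit σ x γ γ' v' = visit σ x γ γ' v
  · rw [Set.indicator_of_mem (by simp [doublePairs, hred]; simpa using hd)]
    refine (integral_mono (g := fun _ => (1 : ℝ)) Integrable.of_finite Integrable.of_finite
      fun ξ => ?_).trans (by simp)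
    refine (le_abs_self _).trans ?_
    simp only [Finset.abs_prod, abs_unit, Finset.prod_const_one, le_refl]
  · push Not at hd
    obtain ⟨v₀, hv₀⟩ := hd
    rw [integral_prod_eq_zero ν (visit σ x γ γ')
      (fun v ζ => ((localSign (pairStep σ x γ γ' v) ζ : ℤ) : ℝ)) v₀ hv₀
      (integral_localSign (hν _) _)]
    exact Set.indicator_nonneg (fun _ _ => zero_le_one) _

open Classical in
theorem sum_sq_nbSum (ξ : Negations (ForrVar k) c n) (ℓ : ℕ) (x : Var k n) :
    ∑ z, (nbSum (block σ ξ) ℓ x z) ^ 2 =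
      ∑ γ : Fin (ℓ + 1) → Letter k c, ∑ γ' : Fin (ℓ + 1) → Letter k c,
        if IsReducedPair σ x γ γ' then ((wordSign σ ξ x (extendWord γ) (ℓ + 1) : ℤ) : ℝ) *
      ((wordSign σ ξ x (extendWord γ') (ℓ + 1) : ℤ) : ℝ) else 0 := by
  simp only [nbSum_block_apply, pow_two, Finset.sum_mul_sum]
  rw [Finset.sum_comm]
  refine Finset.sum_congr rfl fun γ _ => ?_
  rw [Finset.sum_comm]
  refine Finset.sum_congr rfl fun γ' _ => ?_
  rw [Finset.sum_eq_single (vpos σ x (extendWord γ) (ℓ + 1))]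
  · by_cases h1 : IsReduced (extendWord γ) (ℓ + 1)
    · by_cases h2 : IsReduced (extendWord γ') (ℓ + 1) ∧
        vpos σ x (extendWord γ) (ℓ + 1) = vpos σ x (extendWord γ') (ℓ + 1)
      · rw [if_pos ⟨h1, rfl⟩, if_pos ⟨h2.1, h2.2.symm⟩, if_pos ⟨h1, h2⟩]
      · rw [if_pos ⟨h1, rfl⟩, if_neg (fun h => h2 ⟨h.1, h.2.symm⟩), mul_zero, if_neg (fun h => h2 h.2)]
    · rw [if_neg (fun h => h1 h.1), zero_mul, if_neg (fun h => h1 h.1)]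
  · intro z _ hz
    rw [if_neg (fun h => hz h.2.symm), zero_mul]
  · simp

theorem integral_sum_sq_nbSum_le (ν : Fin c × Fin n → Measure (ForrVar k → ℤˣ))
    [∀ f, IsProbabilityMeasure (ν f)] (hν : ∀ f, IsOneWiseUniform (forrelation k) (ν f)) (ℓ : ℕ) :
    ∫ ξ, ∑ x, ∑ z, (nbSum (block σ ξ) ℓ x z) ^ 2 ∂(Measure.pi ν) ≤
      (doublePairs σ (ℓ + 1)).card := by
  classical
  simp only [sum_sq_nbSum]
  rw [integral_finsetSum _ fun x _ => Integrable.of_finite]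
  have h1 : ∀ x, ∫ ξ, ∑ γ : Fin (ℓ + 1) → Letter k c, ∑ γ' : Fin (ℓ + 1) → Letter k c,
        (if IsReducedPair σ x γ γ' then ((wordSign σ ξ x (extendWord γ) (ℓ + 1) : ℤ) : ℝ) *
      ((wordSign σ ξ x (extendWord γ') (ℓ + 1) : ℤ) : ℝ) else 0) ∂(Measure.pi ν) ≤
      ∑ γ : Fin (ℓ + 1) → Letter k c, ∑ γ' : Fin (ℓ + 1) → Letter k c,
        Set.indicator (doublePairs σ (ℓ + 1) : Set _) (fun _ => (1 : ℝ)) (x, γ, γ') := by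
    intro x
    rw [integral_finsetSum _ fun γ _ => Integrable.of_finite]
    refine Finset.sum_le_sum fun γ _ => ?_
    rw [integral_finsetSum _ fun γ' _ => Integrable.of_finite]
    exact Finset.sum_le_sum fun γ' _ => integral_pair_le σ ν hν x γ γ'
  refine (Finset.sum_le_sum fun x _ => h1 x).trans (le_of_eq ?_)
  have h2 : ∀ x : Var k n, ∑ γ : Fin (ℓ + 1) → Letter k c, ∑ γ' : Fin (ℓ + 1) → Letter k c,
        Set.indicator (doublePairs σ (ℓ + 1) : Set _) (fun _ => (1 : ℝ)) (x, γ, γ') =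
      ∑ p : (Fin (ℓ + 1) → Letter k c) × (Fin (ℓ + 1) → Letter k c),
        Set.indicator (doublePairs σ (ℓ + 1) : Set _) (fun _ => (1 : ℝ)) (x, p) :=
    fun x => by rw [Fintype.sum_prod_type]
  simp only [h2]
  rw [← Fintype.sum_prod_type]
  simp [Set.indicator_apply]

end SecondMoment

/-! ### From large eigenvalues to the second moment -/

theorem exists_add_inv_eq {t y : ℝ} (hy : 1 ≤ y) (ht : y + y⁻¹ ≤ t) :
    ∃ y' ≥ y, y' + y'⁻¹ = t := by
  have hy0 : 0 < y := by linarith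
  have hyi : 0 < y⁻¹ := by positivity
  have hyy : y * y⁻¹ = 1 := mul_inv_cancel₀ hy0.ne'
  have hyle : y⁻¹ ≤ 1 := inv_le_one_of_one_le₀ hy
  have h1 : (y - y⁻¹) ^ 2 ≤ t ^ 2 - 4 := by
    have : (y + y⁻¹) ^ 2 ≤ t ^ 2 := pow_le_pow_left₀ (by positivity) ht 2
    nlinarith
  have h2 : y - y⁻¹ ≤ √(t ^ 2 - 4) := Real.le_sqrt_of_sq_le h1
  have h3 : √(t ^ 2 - 4) ^ 2 = t ^ 2 - 4 := Real.sq_sqrt (le_trans (sq_nonneg _) h1)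
  refine ⟨(t + √(t ^ 2 - 4)) / 2, by linarith, ?_⟩
  -- The witness is the larger root of `Y² - tY + 1`; its inverse is the other root.
  have h4 : 0 < (t + √(t ^ 2 - 4)) / 2 := by linarith
  have h5 : (t + √(t ^ 2 - 4)) / 2 * ((t - √(t ^ 2 - 4)) / 2) = 1 := by
    linear_combination (-1 / 4) * h3
  rw [inv_eq_of_mul_eq_one_right h5]
  ring

/-- An eigenvector of the adjacency matrix is also one of the non-backtracking sum, with eigenvalue
`q`. Cauchy–Schwarz in each row bounds `q²` by the squared Frobenius norm. -/
theorem le_sum_sq_nbSum (hc : 2 ≤ c) {s y lam : ℝ} (hs : 0 < s)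
    (hsD : s * s = 2 ^ k * ((c : ℝ) - 1)) (hy : 1 ≤ y) (hlam : s * (y + y⁻¹) ≤ lam)
    (σ : ConstraintLift (ForrVar k) c n) (ξ : Negations (ForrVar k) c n)
    (hev : Module.End.HasEigenvalue
      (Matrix.toLin' (additiveLift (fun _ => forrelation k) σ ξ).adj) lam) (ℓ : ℕ) :
    (s * y) ^ (2 * (ℓ + 1)) ≤ ∑ x, ∑ z, (nbSum (block σ ξ) ℓ x z) ^ 2 := by
  obtain ⟨f, hf⟩ := hev.exists_hasEigenvector
  have hfe : (∑ j, block σ ξ j) *ᵥ f = lam • f := by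
    have := hf.apply_eq_smul
    rwa [Matrix.toLin'_apply, adj_eq_sum_block] at this
  obtain ⟨y', hy', hyt⟩ := exists_add_inv_eq (t := lam / s) hy (by rw [le_div_iff₀ hs]; linarith)
  have hlam' : lam = s * (y' + y'⁻¹) := by rw [hyt]; field_simp
  have hq := nbSum_mulVec (block_mul_self σ ξ) hfe ℓ
  set q := nbPoly c (2 ^ k) lam ℓ with hqdef
  have hqge : (s * y) ^ (ℓ + 1) ≤ q := by
    refine le_trans ?_ (hlam' ▸ le_nbPoly hc (by positivity) hs.le hsD (hy.trans hy') ℓ)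
    gcongr
  have hf0 : 0 < ∑ x, f x ^ 2 := by
    obtain ⟨x, hx⟩ := Function.ne_iff.1 hf.2
    exact Finset.sum_pos' (fun _ _ => sq_nonneg _) ⟨x, Finset.mem_univ _, by
      simp only [Pi.zero_apply] at hx; positivity⟩
  have h1 : q ^ 2 * ∑ x, f x ^ 2 ≤
      (∑ x, ∑ z, (nbSum (block σ ξ) ℓ x z) ^ 2) * ∑ x, f x ^ 2 := by
    rw [Finset.mul_sum, Finset.sum_mul]
    refine Finset.sum_le_sum fun x _ => ?_
    have h2 := congrFun hq x
    simp only [Pi.smul_apply, smul_eq_mul] at h2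
    rw [← mul_pow, ← h2, Matrix.mulVec, dotProduct]
    exact Finset.sum_mul_sq_le_sq_mul_sq _ _ _
  have h3 := le_of_mul_le_mul_right h1 hf0
  refine le_trans ?_ h3
  rw [mul_comm 2, pow_mul]
  exact pow_le_pow_left₀ (by positivity) hqge 2

/-- For a fixed lift, the probability of a large eigenvalue. -/
theorem measure_large_eigenvalue_le (hc : 2 ≤ c) [NeZero c] {s y : ℝ} (hs : 0 < s)
    (hsD : s * s = 2 ^ k * ((c : ℝ) - 1)) (hy : 1 ≤ y) (σ : ConstraintLift (ForrVar k) c n)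
    (ν : Fin c × Fin n → Measure (ForrVar k → ℤˣ))
    [∀ f, IsProbabilityMeasure (ν f)] (hν : ∀ f, IsOneWiseUniform (forrelation k) (ν f)) (ℓ : ℕ) :
    (Measure.pi ν).real {ξ | ∃ lam, s * (y + y⁻¹) ≤ lam ∧ Module.End.HasEigenvalue
      (Matrix.toLin' (additiveLift (fun _ => forrelation k) σ ξ).adj) lam} ≤
      (doublePairs σ (ℓ + 1)).card / (s * y) ^ (2 * (ℓ + 1)) := by
  rw [le_div_iff₀ (by positivity)]
  -- Markov's inequality for the squared Frobenius norm.
  have h1 := mul_meas_ge_le_integral_of_nonneg (μ := Measure.pi ν)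
    (f := fun ξ => ∑ x, ∑ z, (nbSum (block σ ξ) ℓ x z) ^ 2)
    (Eventually.of_forall fun ξ => Finset.sum_nonneg fun x _ => Finset.sum_nonneg fun z _ =>
      sq_nonneg _) Integrable.of_finite ((s * y) ^ (2 * (ℓ + 1)))
  refine le_trans ?_ (h1.trans (integral_sum_sq_nbSum_le σ ν hν ℓ))
  rw [mul_comm]
  refine mul_le_mul_of_nonneg_left (measureReal_mono ?_) (by positivity)
  rintro ξ ⟨lam, h2, h3⟩
  exact le_sum_sq_nbSum hc hs hsD hy h2 σ ξ h3 ℓ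

end ForrLift

/-! ### The upper bound on the eigenvalues -/

namespace RandomLift

open WalkCount

variable {ι : Type} [Fintype ι] [DecidableEq ι] {c n : ℕ}

open Classical in
theorem card_exists_walk_le_of_two_mul_le {L : ℕ} (hL : 2 * L ≤ n) (hn : 0 < n) (T : ℕ)
    [Nonempty (Fin c × ι)] (x : Vtx ι c n) :
    ((Finset.univ.filter (fun σ : ConstraintLift ι c n =>
      ∃ w : ℕ → Vtx ι c n, w 0 = x ∧ IsWalk σ w L ∧ T ≤ collisions w L)).card : ℝ) ≤
      (2 * Fintype.card (Fin c × ι)) ^ L * (2 * ((L : ℝ) + 1) / n) ^ T *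
        Fintype.card (ConstraintLift ι c n) := by
  have hn' : (0 : ℝ) < n := by exact_mod_cast hn
  have hL' : 2 * (L : ℝ) ≤ n := by exact_mod_cast hL
  refine (card_exists_walk_le x (by omega) T).trans ?_
  have h0 : (0 : ℝ) < n - L := by linarith
  have h1 : ((L : ℝ) + 1) / (n - L) ≤ 2 * ((L : ℝ) + 1) / n := by
    rw [div_le_div_iff₀ h0 hn']
    nlinarith [Nat.cast_nonneg (α := ℝ) L]
  have h2 : (0 : ℝ) ≤ ((L : ℝ) + 1) / (n - L) := by positivity
  gcongr

theorem card_vtx {ι : Type} [Fintype ι] {c n : ℕ} : Fintype.card (Vtx ι c n) = (Fintype.card ι + c) * n := by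
  simp [Vtx, add_mul]

open Classical in
theorem card_exists_start_walk_le {L : ℕ} (hL : 2 * L ≤ n) (hn : 0 < n) (T : ℕ)
    [Nonempty (Fin c × ι)] :
    ((Finset.univ.filter (fun σ : ConstraintLift ι c n =>
      ∃ w : ℕ → Vtx ι c n, IsWalk σ w L ∧ T ≤ collisions w L)).card : ℝ) ≤
      ((Fintype.card ι + c : ℕ) : ℝ) * n * ((2 * Fintype.card (Fin c × ι)) ^ L *
        (2 * ((L : ℝ) + 1) / n) ^ T) * Fintype.card (ConstraintLift ι c n) := by
  have hsub : (Finset.univ.filter (fun σ : ConstraintLift ι c n =>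
      ∃ w : ℕ → Vtx ι c n, IsWalk σ w L ∧ T ≤ collisions w L)) ⊆
      Finset.univ.biUnion (fun x : Vtx ι c n => Finset.univ.filter
        (fun σ : ConstraintLift ι c n =>
          ∃ w : ℕ → Vtx ι c n, w 0 = x ∧ IsWalk σ w L ∧ T ≤ collisions w L)) := by
    intro σ hσ
    obtain ⟨w, hw, hT⟩ := (Finset.mem_filter.1 hσ).2
    exact Finset.mem_biUnion.2 ⟨w 0, Finset.mem_univ _,
      Finset.mem_filter.2 ⟨Finset.mem_univ _, w, rfl, hw, hT⟩⟩
  have h1 : ((Finset.univ.filter (fun σ : ConstraintLift ι c n =>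
      ∃ w : ℕ → Vtx ι c n, IsWalk σ w L ∧ T ≤ collisions w L)).card : ℝ) ≤
      ∑ x : Vtx ι c n, ((Finset.univ.filter
        (fun σ : ConstraintLift ι c n =>
          ∃ w : ℕ → Vtx ι c n, w 0 = x ∧ IsWalk σ w L ∧ T ≤ collisions w L)).card : ℝ) := by
    exact_mod_cast (Finset.card_le_card hsub).trans Finset.card_biUnion_le
  refine h1.trans ((Finset.sum_le_sum fun x _ =>
    card_exists_walk_le_of_two_mul_le hL hn T x).trans (le_of_eq ?_))
  rw [Finset.sum_const, Finset.card_univ, card_vtx, nsmul_eq_mul]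
  push_cast
  ring

/-- Over a random lift, an event is unlikely if it is unlikely given any permutations outside a
small set. -/
theorem measureReal_randomLiftLaw_le (ν : Fin c × Fin n → Measure (ι → ℤˣ))
    [∀ f, IsProbabilityMeasure (ν f)] (S : Set (ConstraintLift ι c n × Negations ι c n))
    (P : ConstraintLift ι c n → Prop) [DecidablePred P] {δ₁ δ₂ : ℝ} (hδ₂ : 0 ≤ δ₂)
    (h₁ : ((Finset.univ.filter (fun σ => ¬ P σ)).card : ℝ) ≤
      δ₁ * Fintype.card (ConstraintLift ι c n))
    (h₂ : ∀ σ, P σ → (Measure.pi ν).real {ξ | (σ, ξ) ∈ S} ≤ δ₂) :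
    (randomLiftLaw ι c n ν).real S ≤ δ₁ + δ₂ := by
  classical
  have hcard : (0 : ℝ) < Fintype.card (ConstraintLift ι c n) := by
    exact_mod_cast Fintype.card_pos
  have hδ₁ : 0 ≤ δ₁ := nonneg_of_mul_nonneg_left ((Nat.cast_nonneg _).trans h₁) hcard
  have hm : MeasurableSet S := S.toFinite.measurableSet
  have hprod : randomLiftLaw ι c n ν S ≤ ENNReal.ofReal (δ₁ + δ₂) := by
    rw [randomLiftLaw, Measure.prod_apply hm]
    -- By Fubini, bound the section of `S` trivially by one over exceptional lifts and by `δ₂` over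
    -- the others.
    have hpt : ∀ σ, (Measure.pi ν) (Prod.mk σ ⁻¹' S) ≤
        Set.indicator {σ | ¬ P σ} (fun _ => 1) σ + ENNReal.ofReal δ₂ := by
      intro σ
      by_cases hσ : P σ
      · rw [Set.indicator_of_notMem (by simpa using hσ), zero_add]
        rw [← ENNReal.ofReal_toReal (measure_ne_top (Measure.pi ν) (Prod.mk σ ⁻¹' S))]
        exact ENNReal.ofReal_le_ofReal (h₂ σ hσ)
      · rw [Set.indicator_of_mem (by simpa using hσ)]
        exact prob_le_one.trans le_self_add
    refine (lintegral_mono hpt).trans ?_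
    rw [lintegral_add_right _ measurable_const, lintegral_const,
      lintegral_indicator (Set.toFinite _).measurableSet, setLIntegral_one,
      ENNReal.ofReal_add hδ₁ hδ₂]
    have := ProbabilityTheory.isProbabilityMeasure_uniformOn
      (Set.finite_univ (α := ConstraintLift ι c n)) Set.univ_nonempty
    rw [measure_univ, mul_one]
    gcongr
    rw [ProbabilityTheory.uniformOn_univ, Measure.count_apply (Set.toFinite _).measurableSet]
    refine ENNReal.div_le_of_le_mul ?_
    rw [← ENNReal.ofReal_natCast (Fintype.card _), ← ENNReal.ofReal_mul hδ₁]
    have h3 : Set.encard {σ | ¬ P σ} = ((Finset.univ.filter (fun σ => ¬ P σ)).card : ℕ∞) := by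
      rw [← Set.encard_coe_eq_coe_finsetCard]
      simp
    rw [h3]
    simp only [ENat.toENNReal_coe]
    rw [← ENNReal.ofReal_natCast]
    exact ENNReal.ofReal_le_ofReal h₁
  rw [measureReal_def]
  exact ENNReal.toReal_le_of_le_ofReal (by positivity) hprod

end RandomLift

namespace ForrLift

open NonBacktracking WalkCount RandomLift

variable {k c n : ℕ}

theorem tendsto_pow_mul_half_pow (a : ℝ) (M : ℕ) :
    Tendsto (fun r : ℕ => (a * ((r : ℝ) + 1)) ^ M * (1 / 2 : ℝ) ^ r) atTop (𝓝 0) := by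
  have h := (tendsto_pow_const_mul_const_pow_of_abs_lt_one M
    (r := (1 / 2 : ℝ)) (by rw [abs_of_pos] <;> norm_num)).comp (tendsto_add_atTop_nat 1)
  have h2 := h.const_mul (2 * a ^ M)
  rw [mul_zero] at h2
  refine h2.congr fun r => ?_
  simp only [Function.comp, Nat.cast_add, Nat.cast_one, mul_pow, pow_succ]
  ring

-- Let `N` be twice the number of directions. Up to constants and powers of `r`, the union bound for
-- `K + 1` collisions in length `2Kr` is `n N^(2Kr) / n^(K+1) = (N^(2r) / n)^K`, and for two
-- collisions in length `r` it is `N^r / n`. Both are small as `n ≥ N^(3r)`.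
open Classical in
theorem card_not_isSparse_le [NeZero c] {K r : ℕ} (hK : 0 < K)
    (hr : 2 * (2 * K * r) ≤ n) (hn : 0 < n)
    (hb : ((2 * Fintype.card (Fin c × ForrVar k)) ^ 3) ^ r ≤ n) :
    ((Finset.univ.filter (fun σ : ConstraintLift (ForrVar k) c n =>
      ¬ IsSparse σ (2 * K) r K)).card : ℝ) ≤
      ((Fintype.card (ForrVar k) + c : ℕ) : ℝ) *
        ((2 * (2 * K + 1) * ((r : ℝ) + 1)) ^ (K + 1) * (1 / 2) ^ r +
          (2 * ((r : ℝ) + 1)) ^ 2 * (1 / 2) ^ r) *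
        Fintype.card (ConstraintLift (ForrVar k) c n) := by
  have hsub : Finset.univ.filter (fun σ : ConstraintLift (ForrVar k) c n =>
      ¬ IsSparse σ (2 * K) r K) ⊆
      Finset.univ.filter (fun σ : ConstraintLift (ForrVar k) c n => ∃ w, IsWalk σ w (2 * K * r) ∧
        K + 1 ≤ collisions w (2 * K * r)) ∪
      Finset.univ.filter (fun σ : ConstraintLift (ForrVar k) c n => ∃ w, IsWalk σ w r ∧
        2 ≤ collisions w r) := by
    intro σ hσ
    simp only [Finset.mem_union, Finset.mem_filter, Finset.mem_univ, true_and] at hσ ⊢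
    by_contra! h
    exact hσ ⟨fun w hw => Nat.lt_succ_iff.1 (h.1 w hw), fun w hw => Nat.lt_succ_iff.1 (h.2 w hw)⟩
  have hr' : 2 * r ≤ n := le_trans (by nlinarith) hr
  have h1 : ((Finset.univ.filter (fun σ : ConstraintLift (ForrVar k) c n =>
      ¬ IsSparse σ (2 * K) r K)).card : ℝ) ≤
      ((Finset.univ.filter (fun σ : ConstraintLift (ForrVar k) c n =>
        ∃ w, IsWalk σ w (2 * K * r) ∧ K + 1 ≤ collisions w (2 * K * r))).card : ℝ) +
      ((Finset.univ.filter (fun σ : ConstraintLift (ForrVar k) c n =>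
        ∃ w, IsWalk σ w r ∧ 2 ≤ collisions w r)).card : ℝ) := by
    exact_mod_cast (Finset.card_le_card hsub).trans (Finset.card_union_le _ _)
  refine h1.trans ?_
  refine (add_le_add (card_exists_start_walk_le hr hn (K + 1))
    (card_exists_start_walk_le hr' hn 2)).trans ?_
  rw [← add_mul]
  refine mul_le_mul_of_nonneg_right ?_ (Nat.cast_nonneg _)
  set N : ℝ := 2 * (Fintype.card (Fin c × ForrVar k) : ℝ) with hN
  have hcard : 0 < Fintype.card (Fin c × ForrVar k) := Fintype.card_pos
  have hN2 : 2 ≤ N := by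
    have : (1 : ℝ) ≤ Fintype.card (Fin c × ForrVar k) := by exact_mod_cast hcard
    linarith
  have hN0 : 0 < N := by linarith
  have hbN : (N ^ 3) ^ r ≤ n := by
    have : ((((2 * Fintype.card (Fin c × ForrVar k)) ^ 3) ^ r : ℕ) : ℝ) ≤ n := by
      exact_mod_cast hb
    push_cast at this
    exact this
  have hn' : (0 : ℝ) < n := by exact_mod_cast hn
  have h2r : (1 / 2 : ℝ) ^ r * N ^ r ≥ 1 := by
    rw [← mul_pow]
    exact one_le_pow₀ (by linarith)
  have hN3 : (N ^ 3) ^ r = (N ^ r) ^ 3 := by rw [← pow_mul, ← pow_mul, mul_comm]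
  -- Since `n ≥ N^(3r)`, the quotient is at most `N^(-r)`, and `N ≥ 2`.
  have hq : N ^ (2 * r) / n ≤ (1 / 2) ^ r := by
    rw [div_le_iff₀ hn', mul_comm 2, pow_mul]
    calc (N ^ r) ^ 2 ≤ (N ^ r) ^ 2 * ((1 / 2 : ℝ) ^ r * N ^ r) :=
          le_mul_of_one_le_right (by positivity) h2r
      _ = (1 / 2) ^ r * (N ^ r) ^ 3 := by ring
      _ ≤ _ := by rw [← hN3]; gcongr
  have hq' : N ^ r / n ≤ (1 / 2) ^ r := by
    refine le_trans ?_ hq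
    gcongr
    · linarith
    · omega
  rw [mul_assoc _ (n : ℝ) (N ^ (2 * K * r) * _), mul_assoc _ (n : ℝ) (N ^ r * _), ← mul_add]
  refine mul_le_mul_of_nonneg_left (add_le_add ?_ ?_) (Nat.cast_nonneg _)
  · push_cast
    calc (n : ℝ) * (N ^ (2 * K * r) * (2 * (2 * K * r + 1) / n) ^ (K + 1))
        = (2 * (2 * K * r + 1)) ^ (K + 1) * (N ^ (2 * r) / n) ^ K := by
          rw [div_pow, div_pow, ← pow_mul, show 2 * r * K = 2 * K * r by ring, pow_succ (n : ℝ)]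
          field_simp
      _ ≤ (2 * (2 * K + 1) * ((r : ℝ) + 1)) ^ (K + 1) * ((1 / 2) ^ r) ^ K := by
          refine mul_le_mul (pow_le_pow_left₀ (by positivity) ?_ _)
            (pow_le_pow_left₀ (by positivity) hq _) (by positivity) (by positivity)
          nlinarith [Nat.cast_nonneg (α := ℝ) r, Nat.cast_nonneg (α := ℝ) K]
      _ ≤ _ := by
          gcongr
          exact pow_le_of_le_one (by positivity)
            (pow_le_one₀ (by norm_num) (by norm_num)) hK.ne'
  · calc (n : ℝ) * (N ^ r * (2 * (r + 1) / n) ^ 2)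
        = (2 * (r + 1)) ^ 2 * (N ^ r / n) := by
          rw [div_pow]
          field_simp
      _ ≤ _ := by gcongr

/-- The factor `((c-1) 2^k)^L` cancels against `s^(2L)`. What remains is `n ≤ b^(r+1)` times a power
of `r` of fixed exponent, divided by `y^(2mr) ≥ b^(2r)`. -/
theorem card_doublePairs_div_le (hc : 2 ≤ c) [NeZero c] {s y : ℝ} (hs : 0 < s)
    (hsD : s * s = 2 ^ k * ((c : ℝ) - 1)) (hy : 1 < y) {m r b : ℕ} (hr : 0 < r) (hb : 2 ≤ b)
    (hm : (b : ℝ) ^ 2 ≤ (y ^ 2) ^ m) (hn : n ≤ b ^ (r + 1)) {σ : ConstraintLift (ForrVar k) c n}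
    (hσ : IsSparse σ (2 * (2 * m)) r (2 * m)) :
    (doublePairs σ (m * r)).card / (s * y) ^ (2 * (m * r)) ≤
      (Fintype.card (ForrVar k) * b : ℝ) *
        ((((4 * m + Fintype.card (Fin c × ForrVar k) + 2 : ℕ) : ℝ) * ((r : ℝ) + 1)) ^
          (12 * m + 2 * eventBound (2 * m) (2 * (2 * m))) * (1 / 2) ^ r) := by
  set Λ := Fintype.card (Fin c × ForrVar k) with hΛ
  set e := eventBound (2 * m) (2 * (2 * m)) with he
  -- `Y` dominates every polynomial base: `r + 2` occurs three times for each of `4m` windows, hence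
  -- `12 m`, and the base of the event count is at most `Y²`, hence `2 e`.
  set Y := (4 * m + Λ + 2) * (r + 1) with hY
  have h1 : (doublePairs σ (m * r)).card ≤ ((c - 1) * 2 ^ k) ^ (m * r) *
      (Fintype.card (ForrVar k) * b ^ (r + 1) * Y ^ (12 * m + 2 * e)) := by
    refine (card_doublePairs_le (hc := hc) (hr := hr) (hσ := hσ) (L := m * r) (K := 2 * m)
      (hL := by ring)).trans ?_
    refine Nat.mul_le_mul_left _ ?_
    rw [mul_assoc (Fintype.card (ForrVar k)), Fintype.card_prod, Fintype.card_fin, mul_assoc]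
    refine Nat.mul_le_mul_left _ (Nat.mul_le_mul hn ?_)
    rw [pow_add]
    refine Nat.mul_le_mul ?_ ?_
    · rw [show 12 * m = 3 * (2 * (2 * m)) by ring, pow_mul Y]
      refine Nat.pow_le_pow_left ?_ _
      rw [pow_succ, pow_two, mul_assoc]
      have : r + 2 ≤ Y := by rw [hY]; nlinarith
      exact Nat.mul_le_mul this (Nat.mul_le_mul this this)
    · rw [pow_mul Y]
      refine Nat.pow_le_pow_left ?_ _
      have h2 : 2 * (2 * m) * r + 1 ≤ Y := by rw [hY]; nlinarith
      have h3 : Λ + (2 * (2 * m) * r + 1) ≤ Y := by rw [hY]; nlinarith [Nat.zero_le (Λ * r)]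
      calc 2 * (2 * m) * r * (Λ + (2 * (2 * m) * r + 1)) + 1 ≤ 2 * (2 * m) * r * Y + Y := by
            gcongr; omega
        _ = (2 * (2 * m) * r + 1) * Y := by ring
        _ ≤ Y ^ 2 := by rw [pow_two]; gcongr
  have hb' : (2 : ℝ) ≤ b := by exact_mod_cast hb
  have hc1 : (1 : ℕ) ≤ c := by omega
  have hc1' : (0 : ℝ) ≤ (c : ℝ) - 1 := by
    have : (1 : ℝ) ≤ c := by exact_mod_cast hc1
    linarith
  have h1' : ((doublePairs σ (m * r)).card : ℝ) ≤ (s * s) ^ (m * r) *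
      (Fintype.card (ForrVar k) * (b : ℝ) ^ (r + 1) * (Y : ℝ) ^ (12 * m + 2 * e)) := by
    have : ((doublePairs σ (m * r)).card : ℝ) ≤ ((((c - 1) * 2 ^ k) ^ (m * r) *
      (Fintype.card (ForrVar k) * b ^ (r + 1) * Y ^ (12 * m + 2 * e)) : ℕ) : ℝ) := by
      exact_mod_cast h1
    refine this.trans (le_of_eq ?_)
    rw [hsD]
    push_cast [Nat.cast_sub hc1]
    ring
  have hsy : (s * y) ^ (2 * (m * r)) = (s * s) ^ (m * r) * ((y ^ 2) ^ m) ^ r := by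
    rw [← pow_mul, ← pow_mul, mul_pow, ← pow_two, ← pow_mul]
  rw [hsy, div_le_iff₀ (by positivity)]
  refine h1'.trans ?_
  have hYc : ((4 * m + Λ + 2 : ℕ) : ℝ) * ((r : ℝ) + 1) = (Y : ℝ) := by rw [hY]; push_cast; ring
  rw [hYc]
  -- Here `2b ≤ b² ≤ y^(2m)`.
  have h5 : (b : ℝ) ^ r ≤ (1 / 2) ^ r * ((y ^ 2) ^ m) ^ r := by
    rw [← mul_pow]
    gcongr
    nlinarith
  calc (s * s) ^ (m * r) * (Fintype.card (ForrVar k) * (b : ℝ) ^ (r + 1) *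
        (Y : ℝ) ^ (12 * m + 2 * e))
      = (s * s) ^ (m * r) * (Fintype.card (ForrVar k) * b * (Y : ℝ) ^ (12 * m + 2 * e)) *
        (b : ℝ) ^ r := by ring
    _ ≤ (s * s) ^ (m * r) * (Fintype.card (ForrVar k) * b * (Y : ℝ) ^ (12 * m + 2 * e)) *
        ((1 / 2) ^ r * ((y ^ 2) ^ m) ^ r) := by gcongr
    _ = _ := by ring

/-- With high probability there is no eigenvalue beyond `2 s` by a constant. -/
theorem tendsto_measure_large_eigenvalue (hc : 2 ≤ c) {s y : ℝ} (hs : 0 < s)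
    (hsD : s * s = 2 ^ k * ((c : ℝ) - 1)) (hy : 1 < y)
    (ν : (n : ℕ) → Fin c × Fin n → Measure (ForrVar k → ℤˣ))
    (hprob : ∀ n f, IsProbabilityMeasure (ν n f))
    (hν : ∀ n f, IsOneWiseUniform (forrelation k) (ν n f)) :
    Tendsto (fun n : ℕ => (randomLiftLaw (ForrVar k) c n (ν n)).real
      {ω | ∃ lam, s * (y + y⁻¹) ≤ lam ∧ Module.End.HasEigenvalue
        (Matrix.toLin' (additiveLift (fun _ => forrelation k) ω.1 ω.2).adj) lam}) atTop (𝓝 0) := by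
  classical
  have : NeZero c := ⟨by omega⟩
  set Λ := Fintype.card (Fin c × ForrVar k) with hΛ
  have hΛ0 : 0 < Λ := Fintype.card_pos
  -- The base is the one required by `card_not_isSparse_le`, so the window length can be `r =
  -- Nat.log b n`. The number `m` of windows per word of variables is then fixed by `b² < y^(2m)`.
  set b := (2 * Λ) ^ 3 with hbdef
  have hb : 2 ≤ b := by
    calc 2 ≤ (2 * 1) ^ 3 := by norm_num
      _ ≤ b := by rw [hbdef]; gcongr; omega
  obtain ⟨m, hm⟩ := pow_unbounded_of_one_lt ((b : ℝ) ^ 2) (y := y ^ 2) (by nlinarith)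
  have hm0 : 0 < m := by
    rcases Nat.eq_zero_or_pos m with rfl | h
    · have : (2 : ℝ) ≤ b := by exact_mod_cast hb
      rw [pow_zero] at hm
      nlinarith
    · exact h
  set M := 12 * m + 2 * eventBound (2 * m) (2 * (2 * m)) with hM
  let δ₁ : ℕ → ℝ := fun r => ((Fintype.card (ForrVar k) + c : ℕ) : ℝ) *
        ((2 * (2 * (2 * m : ℕ) + 1) * ((r : ℝ) + 1)) ^ (2 * m + 1) * (1 / 2) ^ r +
          (2 * ((r : ℝ) + 1)) ^ 2 * (1 / 2) ^ r)
  let δ₂ : ℕ → ℝ := fun r => (Fintype.card (ForrVar k) * b : ℝ) *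
        ((((4 * m + Λ + 2 : ℕ) : ℝ) * ((r : ℝ) + 1)) ^ M * (1 / 2) ^ r)
  have hδ : Tendsto (fun r => δ₁ r + δ₂ r) atTop (𝓝 0) := by
    have h1 := ((tendsto_pow_mul_half_pow (2 * (2 * (2 * m : ℕ) + 1)) (2 * m + 1)).add
      (tendsto_pow_mul_half_pow 2 2)).const_mul ((Fintype.card (ForrVar k) + c : ℕ) : ℝ)
    have h2 := (tendsto_pow_mul_half_pow ((4 * m + Λ + 2 : ℕ) : ℝ) M).const_mul
      (Fintype.card (ForrVar k) * b : ℝ)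
    simpa only [add_zero, mul_zero] using h1.add h2
  have hlog : Tendsto (fun n => Nat.log b n) atTop atTop :=
    tendsto_atTop_atTop.2 fun r => ⟨b ^ r, fun n hn => Nat.le_log_of_pow_le hb hn⟩
  -- Only used to ensure that walks of length `4 m r` are at most half as long as `n`.
  have hsmall : ∀ᶠ r : ℕ in atTop, ((8 * m : ℝ) * ((r : ℝ) + 1)) ^ 1 * (1 / 2 : ℝ) ^ r < 1 :=
    (tendsto_pow_mul_half_pow (8 * m : ℝ) 1).eventually (gt_mem_nhds one_pos)
  refine squeeze_zero' (Eventually.of_forall fun n => measureReal_nonneg) ?_ (hδ.comp hlog)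
  filter_upwards [hlog.eventually hsmall, hlog.eventually (eventually_gt_atTop 0),
    eventually_gt_atTop 0] with n h8 hr hn
  set r := Nat.log b n with hrdef
  have hbn : b ^ r ≤ n := Nat.pow_log_le_self b hn.ne'
  have hnb : n ≤ b ^ (r + 1) := (Nat.lt_pow_succ_log_self hb n).le
  have h2n : 2 * (2 * (2 * m) * r) ≤ n := by
    have h3 : (8 * m : ℝ) * ((r : ℝ) + 1) < 2 ^ r := by
      rw [pow_one, one_div, inv_pow, ← div_eq_mul_inv, div_lt_one (by positivity)] at h8
      exact h8
    have h4 : 8 * m * (r + 1) < 2 ^ r := by exact_mod_cast h3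
    calc 2 * (2 * (2 * m) * r) ≤ 8 * m * (r + 1) := by nlinarith
      _ ≤ 2 ^ r := h4.le
      _ ≤ b ^ r := Nat.pow_le_pow_left hb r
      _ ≤ n := hbn
  have := hprob n
  refine measureReal_randomLiftLaw_le (ν n) _
    (fun σ => IsSparse σ (2 * (2 * m)) r (2 * m)) (by positivity)
    (card_not_isSparse_le (by omega) h2n hn hbn) fun σ hσ => ?_
  have hmr : 0 < m * r := Nat.mul_pos hm0 hr
  -- Index `ℓ` of the non-backtracking sums stands for words of length `ℓ + 1`.
  have h5 := measure_large_eigenvalue_le hc hs hsD hy.le σ (ν n) (hν n) (m * r - 1)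
  rw [Nat.sub_add_cancel hmr] at h5
  exact h5.trans (card_doublePairs_div_le hc hs hsD hy hr hb hm.le hnb hσ)

end ForrLift

/-! ### The SDP value and quadratic forms of the adjacency matrix -/

namespace XorInstance

variable {V : Type}

/-- Every edge contributes to both ordered pairs of its endpoints. These are different pairs because
there are no loops, so the disjunction in `adj` splits into two summands. -/
theorem sum_adj_mul [Fintype V] [DecidableEq V] (I : XorInstance V) (F : V → V → ℝ) :
    ∑ u, ∑ v, I.adj u v * F u v =
      ∑ e, ((I.sign e : ℤ) : ℝ) * (F (I.src e) (I.tgt e) + F (I.tgt e) (I.src e)) := by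
  have h1 : ∀ u v, I.adj u v * F u v = ∑ e : I.E,
      ((if I.src e = u then (if I.tgt e = v then ((I.sign e : ℤ) : ℝ) * F u v else 0) else 0) +
        (if I.tgt e = u then (if I.src e = v then ((I.sign e : ℤ) : ℝ) * F u v else 0) else 0)) := by
    intro u v
    rw [adj, Finset.sum_mul]
    refine Finset.sum_congr rfl fun e _ => ?_
    have hne := I.src_ne_tgt e
    by_cases h1 : I.src e = u
    · have h2 : I.tgt e ≠ u := fun h => hne (h1.trans h.symm)
      simp [h1, h2]
    · by_cases h2 : I.tgt e = u
      · simp [h1, h2]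
      · simp [h1, h2]
  simp only [h1]
  have h2 : ∀ u, ∑ v, ∑ e : I.E,
      ((if I.src e = u then (if I.tgt e = v then ((I.sign e : ℤ) : ℝ) * F u v else 0) else 0) +
        (if I.tgt e = u then (if I.src e = v then ((I.sign e : ℤ) : ℝ) * F u v else 0) else 0)) =
      ∑ e : I.E, ((if I.src e = u then ((I.sign e : ℤ) : ℝ) * F u (I.tgt e) else 0) +
        (if I.tgt e = u then ((I.sign e : ℤ) : ℝ) * F u (I.src e) else 0)) := by
    intro u
    rw [Finset.sum_comm]
    refine Finset.sum_congr rfl fun e _ => ?_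
    rw [Finset.sum_add_distrib]
    congr 1 <;> split_ifs <;> simp
  simp only [h2]
  rw [Finset.sum_comm]
  refine Finset.sum_congr rfl fun e _ => ?_
  rw [Finset.sum_add_distrib, mul_add]
  simp

theorem abs_sign (I : XorInstance V) (e : I.E) : |((I.sign e : ℤ) : ℝ)| = 1 :=
  ForrLift.abs_unit _

theorem sum_sign_mul_div_le_one (I : XorInstance V) (f : I.E → ℝ) (hf : ∀ e, |f e| ≤ 1) :
    (∑ e, ((I.sign e : ℤ) : ℝ) * f e) / (Fintype.card I.E : ℝ) ≤ 1 := by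
  refine div_le_one_of_le₀ ?_ (Nat.cast_nonneg _)
  calc ∑ e, ((I.sign e : ℤ) : ℝ) * f e ≤ ∑ _e : I.E, (1 : ℝ) := by
        refine Finset.sum_le_sum fun e _ => (le_abs_self _).trans ?_
        rw [abs_mul, abs_sign, one_mul]
        exact hf e
    _ = _ := by simp

theorem bddAbove_sdp (I : XorInstance V) :
    BddAbove {t : ℝ | ∃ (m : ℕ) (x : V → EuclideanSpace ℝ (Fin m)), (∀ v, ‖x v‖ = 1) ∧
    t = (∑ e : I.E, ((I.sign e : ℤ) : ℝ) * inner ℝ (x (I.src e)) (x (I.tgt e))) /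
      (Fintype.card I.E : ℝ)} := by
  refine ⟨1, ?_⟩
  rintro t ⟨m, x, hx, rfl⟩
  refine I.sum_sign_mul_div_le_one _ fun e => (abs_real_inner_le_norm _ _).trans ?_
  rw [hx, hx, one_mul]

theorem le_sdp (I : XorInstance V) {W : Type*} [Fintype W] (Y : V → W → ℝ)
    (hY : ∀ v, ∑ w, Y v w * Y v w = 1) :
    (∑ e : I.E, ((I.sign e : ℤ) : ℝ) * ∑ w, Y (I.src e) w * Y (I.tgt e) w) /
      (Fintype.card I.E : ℝ) ≤ I.sdp := by
  refine le_csSup I.bddAbove_sdp ⟨Fintype.card W,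
    fun v => WithLp.toLp 2 fun i => Y v ((Fintype.equivFin W).symm i), fun v => ?_, ?_⟩
  · rw [EuclideanSpace.norm_eq, Real.sqrt_eq_one, ← hY v,
      ← (Fintype.equivFin W).symm.sum_comp]
    refine Finset.sum_congr rfl fun i _ => ?_
    rw [Real.norm_eq_abs, sq_abs, pow_two]
  · congr 1
    refine Finset.sum_congr rfl fun e _ => ?_
    congr 1
    rw [← (Fintype.equivFin W).symm.sum_comp, PiLp.inner_apply]
    refine Finset.sum_congr rfl fun i _ => ?_
    simp [mul_comm]

end XorInstance

/-! ### Rows of non-backtracking sums at vertices with a tree-like neighbourhood -/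

namespace ForrLift

open NonBacktracking WalkCount RandomLift

variable {k c n : ℕ}

/-- No walk of length at most `H` from `x` has a collision. -/
def IsTreeLike (σ : ConstraintLift (ForrVar k) c n) (H : ℕ) (x : Var k n) : Prop :=
  ∀ L ≤ H, ∀ w, w 0 = Sum.inl x → IsWalk σ w L → collisions w L = 0

section Orthogonality

variable [NeZero c] {σ : ConstraintLift (ForrVar k) c n} {h : ℕ} {x : Var k n}

/-- A word of length `h + 1` gives a walk of length `2(h + 1)` through variables and constraints, so
the concatenation of two such walks fits into the radius `4(h + 1)` and has no collision. -/
theorem IsTreeLike.halfWalk_eq (hx : IsTreeLike σ (4 * (h + 1)) x) {g g' : ℕ → Letter k c} {p q : ℕ}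
    (hp : p ≤ h + 1) (hq : q ≤ h + 1) (hg : IsReduced g p) (hg' : IsReduced g' q)
    (heq : vpos σ x g p = vpos σ x g' q) :
    p = q ∧ ∀ t ≤ 2 * p, halfWalk σ x g t = halfWalk σ x g' t := by
  obtain ⟨h1, h2⟩ := eq_of_end_eq (u := halfWalk σ x g) (v := halfWalk σ x g')
    ((halfWalk_two_mul σ x g 0).trans (halfWalk_two_mul σ x g' 0).symm) (2 * p) (2 * q)
    (halfWalk_ne_add_two σ x g hg) (halfWalk_ne_add_two σ x g' hg')
    (fun p' hp' q' hq' h => hx _ (by omega) _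
      ((concat_of_le (Nat.zero_le _)).trans (halfWalk_two_mul σ x g 0))
      (IsWalk.concat (isWalk_halfWalk σ x g _) (isWalk_halfWalk σ x g' _) h))
    (by rw [halfWalk_two_mul, halfWalk_two_mul, heq])
  exact ⟨by omega, h2⟩

theorem exists_of_nbSum_ne_zero {ξ : Negations (ForrVar k) c n} {ℓ : ℕ} {z : Var k n}
    (hne : nbSum (block σ ξ) ℓ x z ≠ 0) :
    ∃ g : ℕ → Letter k c, IsReduced g (ℓ + 1) ∧ vpos σ x g (ℓ + 1) = z := by
  rw [nbSum_block_apply] at hne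
  obtain ⟨γ, -, hγ⟩ := Finset.exists_ne_zero_of_sum_ne_zero hne
  by_contra hno
  push Not at hno
  exact hγ (if_neg fun h => hno _ h.1 h.2)

/-- A nonempty reduced word cannot end where the empty word does. -/
theorem IsTreeLike.nbSum_self (hx : IsTreeLike σ (4 * (h + 1)) x) (ξ : Negations (ForrVar k) c n)
    {ℓ : ℕ} (hℓ : ℓ ≤ h) : nbSum (block σ ξ) ℓ x x = 0 := by
  by_contra hne
  obtain ⟨g, hg, hgx⟩ := exists_of_nbSum_ne_zero hne
  have := (hx.halfWalk_eq (q := 0) (g' := g) (by omega) (by omega) hg (fun t ht => by omega) hgx).1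
  omega

/-- Reduced words from `x` with the same end coincide. Hence rows for different lengths have
disjoint supports, and each nonzero entry is a single sign, so the squared norm counts reduced
words. -/
theorem IsTreeLike.sum_nbSum_mul_nbSum (hx : IsTreeLike σ (4 * (h + 1)) x)
    (ξ : Negations (ForrVar k) c n) {ℓ ℓ' : ℕ} (hℓ : ℓ ≤ h) (hℓ' : ℓ' ≤ h) :
    ∑ z, nbSum (block σ ξ) ℓ x z * nbSum (block σ ξ) ℓ' x z =
      if ℓ = ℓ' then ((c * (2 ^ k * ((c - 1) * 2 ^ k) ^ ℓ) : ℕ) : ℝ) else 0 := by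
  classical
  split_ifs with hll
  · subst hll
    simp only [← pow_two]
    rw [sum_sq_nbSum, ← card_reduced, Finset.card_filter, Nat.cast_sum]
    refine Finset.sum_congr rfl fun γ _ => ?_
    rw [Finset.sum_eq_single γ]
    · by_cases hγ : IsReduced (extendWord γ) (ℓ + 1)
      · rw [if_pos ⟨hγ, hγ, rfl⟩, if_pos hγ, ← Int.cast_mul, ← Units.val_mul, Int.units_mul_self]
        simp
      · rw [if_neg fun h => hγ h.1, if_neg hγ, Nat.cast_zero]
    · intro γ' _ hne
      refine if_neg fun hred => hne ?_
      have h1 := (hx.halfWalk_eq (by omega) (by omega) hred.1 hred.2.1 hred.2.2).2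
      have h2 := (eq_of_halfWalk_eq σ h1).2
      exact (extendWord_inj h2).symm
    · simp
  · refine Finset.sum_eq_zero fun z _ => ?_
    by_contra hne
    obtain ⟨g, hg, hgz⟩ := exists_of_nbSum_ne_zero (left_ne_zero_of_mul hne)
    obtain ⟨g', hg', hgz'⟩ := exists_of_nbSum_ne_zero (right_ne_zero_of_mul hne)
    have := (hx.halfWalk_eq (by omega) (by omega) hg hg' (hgz.trans hgz'.symm)).1
    omega

end Orthogonality

end ForrLift

/-! ### The lower bound on the SDP value -/

namespace ForrLift

open NonBacktracking WalkCount RandomLift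

variable {k c n : ℕ}

theorem card_edges (σ : ConstraintLift (ForrVar k) c n) (ξ : Negations (ForrVar k) c n) :
    Fintype.card (additiveLift (fun _ => forrelation k) σ ξ).E = c * (n * (2 ^ k * 2 ^ k)) := by
  refine (Fintype.card_sigma (α := fun _ : Fin c => Fin n × (forrelation k).E)).trans ?_
  have : Fintype.card (forrelation k).E = 2 ^ k * 2 ^ k :=
    (Fintype.card_prod _ _).trans (by simp)
  simp [this]

theorem sum_adj_row_mul (σ : ConstraintLift (ForrVar k) c n) (ξ : Negations (ForrVar k) c n)
    (x : Var k n) (F : Var k n → ℝ) :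
    ∑ v, (additiveLift (fun _ => forrelation k) σ ξ).adj x v * F v =
      ∑ l : Letter k c, ((stepSign σ ξ x l : ℤ) : ℝ) * F (step σ x l) := by
  have h1 := fun j => block_mul_apply σ ξ j (Matrix.of fun v (_ : Unit) => F v) x ()
  simp only [Matrix.mul_apply, Matrix.of_apply] at h1
  rw [adj_eq_sum_block, Fintype.sum_prod_type (γ := ℝ) (α₁ := Fin c),
    ← Finset.sum_congr rfl fun j _ => h1 j, Finset.sum_comm]
  refine Finset.sum_congr rfl fun v _ => ?_
  rw [Matrix.sum_apply, Finset.sum_mul]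

/-- A weighted sum of the non-backtracking sums. -/
noncomputable def weightedNbSum (σ : ConstraintLift (ForrVar k) c n)
    (ξ : Negations (ForrVar k) c n) (s : ℝ) (m : ℕ) : Matrix (Var k n) (Var k n) ℝ :=
  ∑ ℓ ∈ Finset.range (m + 1), (s⁻¹) ^ (ℓ + 1) • nbSum (block σ ξ) ℓ

section Rows

variable [NeZero c] {σ : ConstraintLift (ForrVar k) c n} {s : ℝ} {m : ℕ} {x : Var k n}

theorem IsTreeLike.sum_nbSum_mul_nbSum_eq (hc : 2 ≤ c) (hsD : s * s = 2 ^ k * ((c : ℝ) - 1)) {h : ℕ}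
    (hx : IsTreeLike σ (4 * (h + 1)) x) (ξ : Negations (ForrVar k) c n) {ℓ ℓ' : ℕ}
    (hℓ : ℓ ≤ h) (hℓ' : ℓ' ≤ h) :
    ∑ z, nbSum (block σ ξ) ℓ x z * nbSum (block σ ξ) ℓ' x z =
      if ℓ = ℓ' then (c : ℝ) * 2 ^ k * (s * s) ^ ℓ else 0 := by
  rw [hx.sum_nbSum_mul_nbSum ξ hℓ hℓ']
  congr 1
  rw [hsD]
  push_cast [Nat.cast_sub (show 1 ≤ c by omega)]
  ring

/-- The weights `s^(-ℓ-1)` give the `m + 1` orthogonal rows the same squared norm `c 2^k / s²`. -/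
theorem IsTreeLike.sum_weighted_sq (hc : 2 ≤ c) (hs : 0 < s)
    (hsD : s * s = 2 ^ k * ((c : ℝ) - 1)) (hx : IsTreeLike σ (4 * (m + 1 + 1)) x)
    (ξ : Negations (ForrVar k) c n) :
    ∑ z, weightedNbSum σ ξ s m x z * weightedNbSum σ ξ s m x z =
      ((m : ℝ) + 1) * (c * 2 ^ k) / (s * s) := by
  simp only [weightedNbSum, Matrix.sum_apply, Matrix.smul_apply, smul_eq_mul, Finset.sum_mul_sum]
  rw [Finset.sum_comm]
  have h1 : ∀ ℓ ∈ Finset.range (m + 1), ∑ z, ∑ ℓ' ∈ Finset.range (m + 1),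
      s⁻¹ ^ (ℓ + 1) * nbSum (block σ ξ) ℓ x z * (s⁻¹ ^ (ℓ' + 1) * nbSum (block σ ξ) ℓ' x z) =
      (c * 2 ^ k) / (s * s) := by
    intro ℓ hℓ
    rw [Finset.mem_range] at hℓ
    rw [Finset.sum_comm, Finset.sum_eq_single_of_mem ℓ (Finset.mem_range.2 hℓ)]
    · have := hx.sum_nbSum_mul_nbSum_eq hc hsD ξ (ℓ := ℓ) (ℓ' := ℓ) (by omega) (by omega)
      rw [if_pos rfl] at this
      calc _ = s⁻¹ ^ (ℓ + 1) * s⁻¹ ^ (ℓ + 1) *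
            ∑ z, nbSum (block σ ξ) ℓ x z * nbSum (block σ ξ) ℓ x z := by
            rw [Finset.mul_sum]
            exact Finset.sum_congr rfl fun z _ => by ring
        _ = _ := by
            rw [this, inv_pow, mul_pow]
            field_simp
            ring
    · intro ℓ' hℓ' hne
      rw [Finset.mem_range] at hℓ'
      have := hx.sum_nbSum_mul_nbSum_eq hc hsD ξ (ℓ := ℓ) (ℓ' := ℓ') (by omega) (by omega)
      rw [if_neg (Ne.symm hne)] at this
      calc _ = s⁻¹ ^ (ℓ + 1) * s⁻¹ ^ (ℓ' + 1) *
            ∑ z, nbSum (block σ ξ) ℓ x z * nbSum (block σ ξ) ℓ' x z := by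
            rw [Finset.mul_sum]
            exact Finset.sum_congr rfl fun z _ => by ring
        _ = _ := by rw [this, mul_zero]
  rw [Finset.sum_congr rfl h1]
  simp only [Finset.sum_const, Finset.card_range, nsmul_eq_mul]
  push_cast
  ring

/-- By the recurrence, the adjacency matrix maps row `ℓ` to row `ℓ + 1` plus `s²` times row `ℓ - 1`;
for `ℓ = 0` the second term is a multiple of a basis vector, orthogonal to all rows by `nbSum_self`.
Row `m + 1` appears, which explains the radius `4 * (m + 1 + 1)`. -/
theorem IsTreeLike.sum_adj_nbSum_mul_nbSum (hc : 2 ≤ c)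
    (hsD : s * s = 2 ^ k * ((c : ℝ) - 1)) (hx : IsTreeLike σ (4 * (m + 1 + 1)) x)
    (ξ : Negations (ForrVar k) c n) {ℓ ℓ' : ℕ} (hℓ : ℓ ≤ m) (hℓ' : ℓ' ≤ m) :
    ∑ z, ((∑ j, block σ ξ j) * nbSum (block σ ξ) ℓ) x z * nbSum (block σ ξ) ℓ' x z =
      (if ℓ + 1 = ℓ' then (c : ℝ) * 2 ^ k * (s * s) ^ (ℓ + 1) else 0) +
        (if ℓ' + 1 = ℓ then (c : ℝ) * 2 ^ k * (s * s) ^ (ℓ' + 1) else 0) := by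
  have h1 := hx.sum_nbSum_mul_nbSum_eq hc hsD ξ (ℓ := ℓ + 1) (ℓ' := ℓ') (by omega) (by omega)
  rcases ℓ with _ | ℓ
  · rw [sum_mul_nbSum_zero (block_mul_self σ ξ)]
    simp only [Matrix.add_apply, add_mul, Finset.sum_add_distrib, h1]
    rw [if_neg (show ¬ ℓ' + 1 = 0 by omega)]
    congr 1
    simp only [Matrix.smul_apply, Matrix.one_apply, smul_eq_mul, mul_ite, mul_one, mul_zero, ite_mul,
      zero_mul, Finset.sum_ite_eq, Finset.mem_univ, if_true]
    rw [hx.nbSum_self ξ (by omega), mul_zero]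
  · rw [sum_mul_nbSum_succ (block_mul_self σ ξ)]
    have h2 := hx.sum_nbSum_mul_nbSum_eq hc hsD ξ (ℓ := ℓ) (ℓ' := ℓ') (by omega) (by omega)
    simp only [Matrix.add_apply, add_mul, Finset.sum_add_distrib, h1, Matrix.smul_apply,
      smul_eq_mul, mul_assoc (2 ^ k * ((c : ℝ) - 1))]
    rw [← Finset.mul_sum, h2, ← hsD]
    congr 1
    by_cases hll : ℓ = ℓ'
    · subst hll
      rw [if_pos rfl, if_pos rfl]
      ring
    · rw [if_neg hll, if_neg (by omega), mul_zero]

theorem sum_range_ite_succ_lt (m : ℕ) (a : ℝ) :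
    ∑ ℓ ∈ Finset.range (m + 1), (if ℓ < m then a else 0) = m * a := by
  rw [Finset.sum_range_succ, if_neg (lt_irrefl m), add_zero,
    Finset.sum_congr rfl fun ℓ hℓ => if_pos (Finset.mem_range.1 hℓ)]
  simp

/-- On the weighted rows the adjacency matrix acts as on a path: the `m` pairs of neighbouring
lengths contribute `c 2^k / s` in each of the two orders. Divided by the squared norm this is `2s m
/ (m + 1)`. -/
theorem IsTreeLike.sum_adj_weighted_mul (hc : 2 ≤ c) (hs : 0 < s)
    (hsD : s * s = 2 ^ k * ((c : ℝ) - 1)) (hx : IsTreeLike σ (4 * (m + 1 + 1)) x)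
    (ξ : Negations (ForrVar k) c n) :
    ∑ z, ((∑ j, block σ ξ j) * weightedNbSum σ ξ s m) x z * weightedNbSum σ ξ s m x z =
      2 * m * (c * 2 ^ k) / s := by
  have h0 : (∑ j, block σ ξ j) * weightedNbSum σ ξ s m = ∑ ℓ ∈ Finset.range (m + 1),
      (s⁻¹) ^ (ℓ + 1) • ((∑ j, block σ ξ j) * nbSum (block σ ξ) ℓ) := by
    simp only [weightedNbSum, Finset.mul_sum, Algebra.mul_smul_comm]
  rw [h0]
  simp only [weightedNbSum, Matrix.sum_apply, Matrix.smul_apply, smul_eq_mul, Finset.sum_mul_sum]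
  set a : ℝ := (c * 2 ^ k) / s with ha
  have h1 : ∀ ℓ ∈ Finset.range (m + 1), ∀ ℓ' ∈ Finset.range (m + 1),
      ∑ z, s⁻¹ ^ (ℓ + 1) * ((∑ j, block σ ξ j) * nbSum (block σ ξ) ℓ) x z *
        (s⁻¹ ^ (ℓ' + 1) * nbSum (block σ ξ) ℓ' x z) =
      (if ℓ + 1 = ℓ' then a else 0) + (if ℓ' + 1 = ℓ then a else 0) := by
    intro ℓ hℓ ℓ' hℓ'
    rw [Finset.mem_range] at hℓ hℓ'
    have := hx.sum_adj_nbSum_mul_nbSum hc hsD ξ (ℓ := ℓ) (ℓ' := ℓ') (by omega) (by omega)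
    calc _ = s⁻¹ ^ (ℓ + 1) * s⁻¹ ^ (ℓ' + 1) * ∑ z,
          ((∑ j, block σ ξ j) * nbSum (block σ ξ) ℓ) x z * nbSum (block σ ξ) ℓ' x z := by
          rw [Finset.mul_sum]
          exact Finset.sum_congr rfl fun z _ => by ring
      _ = _ := by
          rw [this, mul_add, mul_ite, mul_ite, mul_zero]
          congr 1
          · split_ifs with he
            · subst he
              rw [ha, inv_pow, inv_pow, mul_pow]
              field_simp
              ring
            · rfl
          · split_ifs with he
            · subst he
              rw [ha, inv_pow, inv_pow, mul_pow]
              field_simp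
              ring
            · rfl
  rw [Finset.sum_comm]
  have h2 : ∑ ℓ ∈ Finset.range (m + 1), ∑ z, ∑ ℓ' ∈ Finset.range (m + 1),
      s⁻¹ ^ (ℓ + 1) * ((∑ j, block σ ξ j) * nbSum (block σ ξ) ℓ) x z *
        (s⁻¹ ^ (ℓ' + 1) * nbSum (block σ ξ) ℓ' x z) =
      ∑ ℓ ∈ Finset.range (m + 1), ∑ ℓ' ∈ Finset.range (m + 1),
        ((if ℓ + 1 = ℓ' then a else 0) + (if ℓ' + 1 = ℓ then a else 0)) := by
    refine Finset.sum_congr rfl fun ℓ hℓ => ?_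
    rw [Finset.sum_comm]
    exact Finset.sum_congr rfl fun ℓ' hℓ' => h1 ℓ hℓ ℓ' hℓ'
  have h3 : ∑ ℓ ∈ Finset.range (m + 1), ∑ ℓ' ∈ Finset.range (m + 1),
      (if ℓ + 1 = ℓ' then a else 0) = m * a := by
    rw [← sum_range_ite_succ_lt]
    refine Finset.sum_congr rfl fun ℓ _ => ?_
    rw [Finset.sum_ite_eq]
    simp
  have h4 : ∑ ℓ ∈ Finset.range (m + 1), ∑ ℓ' ∈ Finset.range (m + 1),
      (if ℓ' + 1 = ℓ then a else 0) = m * a := by rw [Finset.sum_comm, h3]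
  rw [h2]
  simp only [Finset.sum_add_distrib]
  rw [h3, h4, ha]
  ring

end Rows

end ForrLift

/-! ### The SDP solution and its value -/

namespace ForrLift

open NonBacktracking WalkCount RandomLift

variable {k c n : ℕ}

theorem card_var : (Fintype.card (Var k n) : ℝ) = 2 * 2 ^ k * n := by
  rw [Fintype.card_prod, Fintype.card_sum]
  simp only [Fintype.card_pi, Fintype.card_fin, Finset.prod_const, Finset.card_univ]
  push_cast
  ring

open Classical in
/-- The unit vectors: normalized rows at vertices with a tree-like neighbourhood, and basis vectors
elsewhere. -/
noncomputable def sdpVector (σ : ConstraintLift (ForrVar k) c n) (ξ : Negations (ForrVar k) c n)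
    (s : ℝ) (m : ℕ) (x : Var k n) : Var k n → ℝ :=
  if IsTreeLike σ (4 * (m + 1 + 1)) x then
    fun z => weightedNbSum σ ξ s m x z / √(((m : ℝ) + 1) * (c * 2 ^ k) / (s * s))
  else Pi.single x 1

open Classical in
/-- The vertices without a tree-like neighbourhood. -/
noncomputable def badVertices (σ : ConstraintLift (ForrVar k) c n) (H : ℕ) : Finset (Var k n) :=
  Finset.univ.filter fun x => ¬ IsTreeLike σ H x

-- Steps are reversible by `step_idx`, so a bad vertex spoils itself and at most `c 2^k` neighbours.
open Classical in
theorem card_not_all_isTreeLike_le (σ : ConstraintLift (ForrVar k) c n) (H : ℕ) :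
    (Finset.univ.filter fun x => ¬ (IsTreeLike σ H x ∧ ∀ l, IsTreeLike σ H (step σ x l))).card ≤
      (c * 2 ^ k + 1) * (badVertices σ H).card := by
  have hsub : (Finset.univ.filter fun x =>
      ¬ (IsTreeLike σ H x ∧ ∀ l, IsTreeLike σ H (step σ x l))) ⊆
      ((badVertices σ H) ×ˢ (Finset.univ : Finset (Letter k c))).image (fun p => step σ p.1 p.2) ∪
        badVertices σ H := by
    intro x hx
    have hx' := (Finset.mem_filter.1 hx).2
    rw [Finset.mem_union]
    by_cases h1 : IsTreeLike σ H x
    · left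
      have : ∃ l, ¬ IsTreeLike σ H (step σ x l) := by
        by_contra hno
        push Not at hno
        exact hx' ⟨h1, hno⟩
      obtain ⟨l, hl⟩ := this
      exact Finset.mem_image.2 ⟨(step σ x l, (l.1, idx x.1)), by simp [badVertices, hl],
        step_idx σ x l⟩
    · right
      simp [badVertices, h1]
  refine (Finset.card_le_card hsub).trans ((Finset.card_union_le _ _).trans ?_)
  rw [add_mul, one_mul]
  refine Nat.add_le_add_right (Finset.card_image_le.trans (le_of_eq ?_)) _
  rw [Finset.card_product, mul_comm]
  simp

section SdpVector

variable [NeZero c] {σ : ConstraintLift (ForrVar k) c n} {s : ℝ} {m : ℕ} {x : Var k n}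

theorem sum_sdpVector_sq (hc : 2 ≤ c) (hs : 0 < s) (hsD : s * s = 2 ^ k * ((c : ℝ) - 1))
    (ξ : Negations (ForrVar k) c n) (x : Var k n) :
    ∑ z, sdpVector σ ξ s m x z * sdpVector σ ξ s m x z = 1 := by
  by_cases hx : IsTreeLike σ (4 * (m + 1 + 1)) x
  · have hc0 : (0 : ℝ) < c := by exact_mod_cast (by omega : 0 < c)
    have hM : 0 < ((m : ℝ) + 1) * (c * 2 ^ k) / (s * s) := by positivity
    simp only [sdpVector, if_pos hx, div_mul_div_comm, Real.mul_self_sqrt hM.le]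
    rw [← Finset.sum_div, hx.sum_weighted_sq hc hs hsD, div_self hM.ne']
  · simp [sdpVector, if_neg hx, Pi.single_apply]

theorem abs_sum_sdpVector_le (hc : 2 ≤ c) (hs : 0 < s) (hsD : s * s = 2 ^ k * ((c : ℝ) - 1))
    (ξ : Negations (ForrVar k) c n) (x y : Var k n) :
    |∑ z, sdpVector σ ξ s m x z * sdpVector σ ξ s m y z| ≤ 1 := by
  have h := Finset.sum_mul_sq_le_sq_mul_sq Finset.univ (sdpVector σ ξ s m x) (sdpVector σ ξ s m y)
  simp only [pow_two (sdpVector _ _ _ _ _ _), sum_sdpVector_sq hc hs hsD, one_mul] at h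
  exact (sq_le_one_iff_abs_le_one _).1 h

theorem neg_le_sum_adj_sdpVector (hc : 2 ≤ c) (hs : 0 < s) (hsD : s * s = 2 ^ k * ((c : ℝ) - 1))
    (ξ : Negations (ForrVar k) c n) (x : Var k n) :
    -((c : ℝ) * 2 ^ k) ≤ ∑ v, (additiveLift (fun _ => forrelation k) σ ξ).adj x v *
      ∑ z, sdpVector σ ξ s m x z * sdpVector σ ξ s m v z := by
  rw [sum_adj_row_mul σ ξ x fun v => ∑ z, sdpVector σ ξ s m x z * sdpVector σ ξ s m v z]
  have h : ∑ _l : Letter k c, (-1 : ℝ) = -((c : ℝ) * 2 ^ k) := by simp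
  rw [← h]
  refine Finset.sum_le_sum fun l _ => neg_le_of_abs_le ?_
  rw [abs_mul, abs_unit, one_mul]
  exact abs_sum_sdpVector_le hc hs hsD ξ _ _

/-- All vectors involved are normalized rows of one matrix `W`, so the sum is the inner product of
the rows of `A * W` and `W` at `x`. -/
theorem sum_adj_sdpVector (hc : 2 ≤ c) (hs : 0 < s) (hsD : s * s = 2 ^ k * ((c : ℝ) - 1))
    (ξ : Negations (ForrVar k) c n) (hx : IsTreeLike σ (4 * (m + 1 + 1)) x)
    (hstep : ∀ l, IsTreeLike σ (4 * (m + 1 + 1)) (step σ x l)) :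
    ∑ v, (additiveLift (fun _ => forrelation k) σ ξ).adj x v *
      ∑ z, sdpVector σ ξ s m x z * sdpVector σ ξ s m v z = 2 * s * (m / (m + 1)) := by
  have hc0 : (0 : ℝ) < c := by exact_mod_cast (by omega : 0 < c)
  set M := ((m : ℝ) + 1) * (c * 2 ^ k) / (s * s) with hMdef
  have hM : 0 < M := by positivity
  have h1 : ∑ v, (additiveLift (fun _ => forrelation k) σ ξ).adj x v *
      ∑ z, sdpVector σ ξ s m x z * sdpVector σ ξ s m v z =
      ∑ v, (additiveLift (fun _ => forrelation k) σ ξ).adj x v *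
        ∑ z, weightedNbSum σ ξ s m x z * weightedNbSum σ ξ s m v z / M := by
    rw [sum_adj_row_mul σ ξ x fun v => ∑ z, sdpVector σ ξ s m x z * sdpVector σ ξ s m v z,
      sum_adj_row_mul σ ξ x fun v => ∑ z, weightedNbSum σ ξ s m x z * weightedNbSum σ ξ s m v z / M]
    refine Finset.sum_congr rfl fun l _ => ?_
    simp only [sdpVector, if_pos hx, if_pos (hstep l), div_mul_div_comm, ← hMdef,
      Real.mul_self_sqrt hM.le]
  rw [h1]
  have h2 : ∑ v, (additiveLift (fun _ => forrelation k) σ ξ).adj x v *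
        ∑ z, weightedNbSum σ ξ s m x z * weightedNbSum σ ξ s m v z / M =
      (∑ z, ((∑ j, block σ ξ j) * weightedNbSum σ ξ s m) x z * weightedNbSum σ ξ s m x z) / M := by
    rw [adj_eq_sum_block]
    generalize ∑ j, block σ ξ j = A
    simp only [Finset.mul_sum, Matrix.mul_apply, Finset.sum_mul, Finset.sum_div]
    rw [Finset.sum_comm]
    refine Finset.sum_congr rfl fun v _ => Finset.sum_congr rfl fun z _ => ?_
    ring
  rw [h2, hx.sum_adj_weighted_mul hc hs hsD, hMdef]
  field_simp

/-- Sum the row contributions over all variables: a good one gives `2s m/(m+1)`, and a bad one loses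
at most this plus its degree `c 2^k`. The ratio of vertices to twice the edges is `1 / (c 2^k)`. -/
theorem le_sdp_additiveLift (hc : 2 ≤ c) (hs : 0 < s) (hsD : s * s = 2 ^ k * ((c : ℝ) - 1))
    (hn : 0 < n) (ξ : Negations (ForrVar k) c n) (m : ℕ) :
    2 * s / (c * 2 ^ k) * (m / (m + 1)) -
      (2 * s + c * 2 ^ k) * (c * 2 ^ k + 1) * (badVertices σ (4 * (m + 1 + 1))).card / n ≤
      (additiveLift (fun _ => forrelation k) σ ξ).sdp := by
  classical
  have hn' : (0 : ℝ) < n := by exact_mod_cast hn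
  have hc1 : (1 : ℝ) ≤ c := by exact_mod_cast (by omega : 1 ≤ c)
  have hD : (1 : ℝ) ≤ 2 ^ k := one_le_pow₀ (by norm_num)
  set I := additiveLift (fun _ => forrelation k) σ ξ with hI
  refine le_trans ?_ (I.le_sdp (sdpVector σ ξ s m) (sum_sdpVector_sq hc hs hsD ξ))
  set F : Var k n → Var k n → ℝ := fun u v => ∑ z, sdpVector σ ξ s m u z * sdpVector σ ξ s m v z
    with hF
  have hFs : ∀ u v, F u v = F v u := fun u v => Finset.sum_congr rfl fun z _ => mul_comm _ _
  have h1 : ∑ u, ∑ v, I.adj u v * F u v = 2 * ∑ e, ((I.sign e : ℤ) : ℝ) * F (I.src e) (I.tgt e) := by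
    rw [I.sum_adj_mul, Finset.mul_sum]
    refine Finset.sum_congr rfl fun e _ => ?_
    rw [hFs (I.tgt e)]
    ring
  have hcard : (Fintype.card I.E : ℝ) = c * (n * (2 ^ k * 2 ^ k)) := by
    rw [hI, card_edges]; push_cast; ring
  rw [hcard, le_div_iff₀ (by positivity)]
  set H := 4 * (m + 1 + 1) with hH
  have h2 : ∀ u, 2 * s * ((m : ℝ) / (m + 1)) - (if ¬ (IsTreeLike σ H u ∧
      ∀ l, IsTreeLike σ H (step σ u l)) then 2 * s + c * 2 ^ k else 0) ≤
      ∑ v, I.adj u v * F u v := by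
    intro u
    by_cases hu : IsTreeLike σ H u ∧ ∀ l, IsTreeLike σ H (step σ u l)
    swap
    · rw [if_pos hu]
      have h3 := neg_le_sum_adj_sdpVector (σ := σ) (m := m) hc hs hsD ξ u
      have h4 : (m : ℝ) / (m + 1) ≤ 1 := div_le_one_of_le₀ (by linarith) (by positivity)
      have h5 : 2 * s * ((m : ℝ) / (m + 1)) ≤ 2 * s := mul_le_of_le_one_right (by positivity) h4
      simp only [hF, hI]
      linarith
    · rw [if_neg (not_not.2 hu), sub_zero]
      exact (sum_adj_sdpVector hc hs hsD ξ hu.1 hu.2).ge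
  have h3 := Finset.sum_le_sum fun u (_ : u ∈ Finset.univ) => h2 u
  rw [h1, Finset.sum_sub_distrib, Finset.sum_const, Finset.card_univ, ← Finset.sum_filter,
    Finset.sum_const, nsmul_eq_mul, nsmul_eq_mul] at h3
  have h4 : ((Finset.univ.filter fun u => ¬ (IsTreeLike σ H u ∧
      ∀ l, IsTreeLike σ H (step σ u l))).card : ℝ) ≤
      (c * 2 ^ k + 1) * (badVertices σ H).card := by
    exact_mod_cast card_not_all_isTreeLike_le σ H
  have hV : (Fintype.card (Var k n) : ℝ) = 2 * 2 ^ k * n := card_var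
  rw [hV] at h3
  set b : ℝ := ((badVertices σ H).card : ℝ) with hb
  set q : ℝ := (m : ℝ) / (m + 1) with hq
  have hb0 : 0 ≤ b := Nat.cast_nonneg _
  have h5 : (2 * s / (c * 2 ^ k) * q -
      (2 * s + c * 2 ^ k) * (c * 2 ^ k + 1) * b / n) * (c * (n * (2 ^ k * 2 ^ k))) =
      2 * 2 ^ k * n * (s * q) -
        (2 * s + c * 2 ^ k) * (c * 2 ^ k + 1) * b * (c * (2 ^ k * 2 ^ k)) := by
    field_simp
  rw [h5]
  have h6 : (1 : ℝ) ≤ c * (2 ^ k * 2 ^ k) := by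
    have := mul_le_mul hD hD zero_le_one (by positivity)
    have := mul_le_mul hc1 this (by norm_num) (by positivity)
    linarith
  have h7 : (2 * s + c * 2 ^ k) * ((c * 2 ^ k + 1) * b) ≤
      (2 * s + c * 2 ^ k) * (c * 2 ^ k + 1) * b * (c * (2 ^ k * 2 ^ k)) := by
    rw [← mul_assoc]
    exact le_mul_of_one_le_right (by positivity) h6
  have h8 := mul_le_mul_of_nonneg_left h4 (show (0 : ℝ) ≤ 2 * s + c * 2 ^ k by positivity)
  nlinarith

end SdpVector

/-! ### Rarity of vertices without a tree-like neighbourhood -/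

open Classical in
theorem card_not_isTreeLike_le [NeZero c] {H : ℕ} (hH : 2 * H ≤ n) (hn : 0 < n) (x : Var k n) :
    ((Finset.univ.filter fun σ : ConstraintLift (ForrVar k) c n => ¬ IsTreeLike σ H x).card : ℝ) ≤
      ((∑ L ∈ Finset.range (H + 1), (2 * Fintype.card (Fin c × ForrVar k) : ℝ) ^ L *
        (2 * ((L : ℝ) + 1))) / n) * Fintype.card (ConstraintLift (ForrVar k) c n) := by
  have hsub : (Finset.univ.filter fun σ : ConstraintLift (ForrVar k) c n => ¬ IsTreeLike σ H x) ⊆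
      (Finset.range (H + 1)).biUnion fun L =>
        Finset.univ.filter (fun σ : ConstraintLift (ForrVar k) c n =>
          ∃ w, w 0 = Sum.inl x ∧ IsWalk σ w L ∧ 1 ≤ collisions w L) := by
    intro σ hσ
    have hσ' := (Finset.mem_filter.1 hσ).2
    unfold IsTreeLike at hσ'
    push Not at hσ'
    obtain ⟨L, hL, w, hw0, hw, hne⟩ := hσ'
    exact Finset.mem_biUnion.2 ⟨L, Finset.mem_range.2 (by omega), Finset.mem_filter.2
      ⟨Finset.mem_univ _, w, hw0, hw, Nat.one_le_iff_ne_zero.2 hne⟩⟩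
  have h1 : ((Finset.univ.filter fun σ : ConstraintLift (ForrVar k) c n =>
      ¬ IsTreeLike σ H x).card : ℝ) ≤ ∑ L ∈ Finset.range (H + 1),
        ((Finset.univ.filter (fun σ : ConstraintLift (ForrVar k) c n =>
          ∃ w, w 0 = Sum.inl x ∧ IsWalk σ w L ∧ 1 ≤ collisions w L)).card : ℝ) := by
    exact_mod_cast (Finset.card_le_card hsub).trans Finset.card_biUnion_le
  refine h1.trans ?_
  rw [Finset.sum_div, Finset.sum_mul]
  refine Finset.sum_le_sum fun L hL => ?_
  rw [Finset.mem_range] at hL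
  refine (card_exists_walk_le_of_two_mul_le (by omega) hn 1 _).trans (le_of_eq ?_)
  rw [pow_one]
  ring

/-- With high probability few vertices have a neighbourhood that is not tree-like. -/
theorem exists_card_many_badVertices_le [NeZero c] (H : ℕ) {a : ℝ} (ha : 0 < a) :
    ∃ C : ℝ, ∀ n, 0 < n → 2 * H ≤ n → ∀ (P : ConstraintLift (ForrVar k) c n → Prop)
      [DecidablePred P], (∀ σ, ¬ P σ → a * n ≤ (badVertices σ H).card) →
      ((Finset.univ.filter fun σ => ¬ P σ).card : ℝ) ≤
        C / n * Fintype.card (ConstraintLift (ForrVar k) c n) := by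
  classical
  set S := ∑ L ∈ Finset.range (H + 1), (2 * Fintype.card (Fin c × ForrVar k) : ℝ) ^ L *
        (2 * ((L : ℝ) + 1)) with hS
  refine ⟨2 * 2 ^ k * S / a, fun n hn hH P _ hP => ?_⟩
  have hn' : (0 : ℝ) < n := by exact_mod_cast hn
  set N : ℝ := (Fintype.card (ConstraintLift (ForrVar k) c n) : ℝ) with hN
  have h1 : ∑ σ : ConstraintLift (ForrVar k) c n, ((badVertices σ H).card : ℝ) ≤
      2 * 2 ^ k * S * N := by
    -- Count the pairs of a lift and a bad vertex in two ways. Each vertex is bad with probability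
    -- of order `1/n`, so the expected number of bad vertices is bounded.
    have h2 : ∑ σ : ConstraintLift (ForrVar k) c n, ((badVertices σ H).card : ℝ) =
        ∑ x : Var k n, ((Finset.univ.filter fun σ : ConstraintLift (ForrVar k) c n =>
          ¬ IsTreeLike σ H x).card : ℝ) := by
      simp only [badVertices, Finset.card_filter]
      push_cast
      rw [Finset.sum_comm]
    rw [h2]
    refine (Finset.sum_le_sum fun x _ => card_not_isTreeLike_le hH hn x).trans (le_of_eq ?_)
    rw [Finset.sum_const, Finset.card_univ, nsmul_eq_mul]
    have hV : (Fintype.card (Var k n) : ℝ) = 2 * 2 ^ k * n := card_var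
    rw [hV, ← hS]
    field_simp
    rw [hN]
  have h3 : (Finset.univ.filter fun σ => ¬ P σ).card * (a * n) ≤
      ∑ σ : ConstraintLift (ForrVar k) c n, ((badVertices σ H).card : ℝ) := by
    rw [← nsmul_eq_mul, ← Finset.sum_const]
    refine (Finset.sum_le_sum fun σ hσ => hP σ (Finset.mem_filter.1 hσ).2).trans ?_
    exact Finset.sum_le_sum_of_subset_of_nonneg (Finset.filter_subset _ _)
      fun _ _ _ => Nat.cast_nonneg _
  have h4 := h3.trans h1
  rw [← le_div_iff₀ (by positivity)] at h4
  refine h4.trans (le_of_eq ?_)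
  field_simp

theorem tendsto_measure_small_sdp (hc : 2 ≤ c) {s ε : ℝ} (hs : 0 < s)
    (hsD : s * s = 2 ^ k * ((c : ℝ) - 1)) (hε : 0 < ε)
    (ν : (n : ℕ) → Fin c × Fin n → Measure (ForrVar k → ℤˣ))
    (hprob : ∀ n f, IsProbabilityMeasure (ν n f)) :
    Tendsto (fun n : ℕ => (randomLiftLaw (ForrVar k) c n (ν n)).real
      {ω | (additiveLift (fun _ => forrelation k) ω.1 ω.2).sdp < 2 * s / (c * 2 ^ k) - ε})
      atTop (𝓝 0) := by
  classical
  have : NeZero c := ⟨by omega⟩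
  have hc0 : (0 : ℝ) < c := by exact_mod_cast (by omega : 0 < c)
  set τ := 2 * s / (c * 2 ^ k) with hτ
  have hτ0 : 0 < τ := by positivity
  -- Half of `ε` pays for the factor `m / (m + 1)`, the other half for the bad vertices, whose
  -- tolerated fraction is `ε / (2 C₀)`.
  obtain ⟨m, hm⟩ := exists_nat_gt (2 * τ / ε)
  have hm' : τ - ε / 2 ≤ τ * (m / (m + 1)) := by
    have h1 : 2 * τ < m * ε := by rwa [div_lt_iff₀ hε] at hm
    have h2 : τ * ((m : ℝ) / (m + 1)) = τ - τ / (m + 1) := by field_simp; ring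
    have h3 : τ / (m + 1) ≤ ε / 2 := by
      rw [div_le_div_iff₀ (by positivity) (by positivity)]
      nlinarith
    linarith
  set C₀ : ℝ := (2 * s + c * 2 ^ k) * (c * 2 ^ k + 1) with hC₀
  have hC₀' : 0 < C₀ := by positivity
  obtain ⟨C, hC⟩ := exists_card_many_badVertices_le (k := k) (c := c) (4 * (m + 1 + 1))
    (a := ε / (2 * C₀)) (by positivity)
  have hlim : Tendsto (fun n : ℕ => C / n + 0) atTop (𝓝 0) := by
    simpa using tendsto_const_div_atTop_nhds_zero_nat C
  refine squeeze_zero' (Eventually.of_forall fun n => measureReal_nonneg) ?_ hlim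
  filter_upwards [eventually_gt_atTop 0, eventually_ge_atTop (2 * (4 * (m + 1 + 1)))] with n hn hn2
  have := hprob n
  have hn' : (0 : ℝ) < n := by exact_mod_cast hn
  refine measureReal_randomLiftLaw_le (ν n) _
    (fun σ => ((badVertices σ (4 * (m + 1 + 1))).card : ℝ) < ε / (2 * C₀) * n) le_rfl
    (hC n hn hn2 _ fun σ hσ => not_lt.1 hσ) fun σ hσ => ?_
  -- Once the lift has few bad vertices, the lower bound holds for every choice of signs.
  have hempty : {ξ | (σ, ξ) ∈ {ω : ConstraintLift (ForrVar k) c n × Negations (ForrVar k) c n |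
      (additiveLift (fun _ => forrelation k) ω.1 ω.2).sdp < τ - ε}} = ∅ := by
    rw [Set.eq_empty_iff_forall_notMem]
    intro ξ hξ
    have h1 : (additiveLift (fun _ => forrelation k) σ ξ).sdp < τ - ε := hξ
    have h2 := le_sdp_additiveLift (σ := σ) hc hs hsD hn ξ m
    have h3 : C₀ * (badVertices σ (4 * (m + 1 + 1))).card / n ≤ ε / 2 := by
      rw [div_le_iff₀ hn']
      calc C₀ * ((badVertices σ (4 * (m + 1 + 1))).card : ℝ) ≤ C₀ * (ε / (2 * C₀) * n) := by
            gcongr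
        _ = ε / 2 * n := by field_simp
    linarith
  rw [hempty, measureReal_empty]

end ForrLift

/-! ### The SDP value is at most the eigenvalue bound -/

namespace XorInstance

variable {V : Type}

theorem adj_isHermitian [DecidableEq V] (I : XorInstance V) : I.adj.IsHermitian := by
  ext u v
  simp only [Matrix.conjTranspose_apply, star_trivial, adj]
  exact Finset.sum_congr rfl fun e _ => if_congr or_comm rfl rfl

section Eigenvalue

variable [Fintype V] [DecidableEq V] (I : XorInstance V)

theorem bddAbove_eigenvalues :
    BddAbove {μ : ℝ | Module.End.HasEigenvalue (Matrix.toLin' I.adj) μ} :=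
  (Module.End.finite_hasEigenvalue _).bddAbove

/-- An eigenvalue `μ` of the difference makes `λ_max - μ` an eigenvalue of the adjacency matrix, so
`μ ≥ 0`. -/
theorem posSemidef_lambdaMax_sub_adj : (I.lambdaMax • (1 : Matrix V V ℝ) - I.adj).PosSemidef := by
  have hH : (I.lambdaMax • (1 : Matrix V V ℝ) - I.adj).IsHermitian :=
    (Matrix.isHermitian_one.smul (IsSelfAdjoint.all I.lambdaMax)).sub I.adj_isHermitian
  rw [hH.posSemidef_iff_eigenvalues_nonneg]
  intro j
  have h1 := hH.mulVec_eigenvectorBasis j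
  set f := (hH.eigenvectorBasis j).ofLp with hf
  have hf0 : f ≠ 0 := by
    intro h
    have h2 := hH.eigenvectorBasis.orthonormal.ne_zero j
    exact h2 (by ext i; exact congrFun h i)
  rw [Matrix.sub_mulVec, Matrix.smul_mulVec, Matrix.one_mulVec] at h1
  have h2 : I.adj *ᵥ f = (I.lambdaMax - hH.eigenvalues j) • f := by
    rw [sub_smul, ← h1]
    abel
  have h3 : Module.End.HasEigenvalue (Matrix.toLin' I.adj) (I.lambdaMax - hH.eigenvalues j) :=
    Module.End.hasEigenvalue_of_hasEigenvector
      ⟨Module.End.mem_eigenspace_iff.2 (by rw [Matrix.toLin'_apply, h2]), hf0⟩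
  have h4 : I.lambdaMax - hH.eigenvalues j ≤ I.lambdaMax := le_csSup I.bddAbove_eigenvalues h3
  simp only [Pi.zero_apply]
  linarith

theorem sum_adj_mul_mul_le (f : V → ℝ) :
    ∑ u, ∑ v, I.adj u v * (f u * f v) ≤ I.lambdaMax * ∑ u, f u * f u := by
  have h := I.posSemidef_lambdaMax_sub_adj.dotProduct_mulVec_nonneg f
  rw [star_trivial, Matrix.sub_mulVec, Matrix.smul_mulVec, Matrix.one_mulVec, dotProduct_sub,
    dotProduct_smul, smul_eq_mul, sub_nonneg] at h
  refine le_trans (le_of_eq ?_) h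
  simp only [dotProduct, Matrix.mulVec, Finset.mul_sum]
  exact Finset.sum_congr rfl fun u _ => Finset.sum_congr rfl fun v _ => by ring

theorem nonempty_sdp {V : Type} (I : XorInstance V) :
    {t : ℝ | ∃ (m : ℕ) (x : V → EuclideanSpace ℝ (Fin m)), (∀ v, ‖x v‖ = 1) ∧
    t = (∑ e : I.E, ((I.sign e : ℤ) : ℝ) * inner ℝ (x (I.src e)) (x (I.tgt e))) /
      (Fintype.card I.E : ℝ)}.Nonempty :=
  ⟨_, 1, fun _ => EuclideanSpace.single 0 1, fun _ => by simp, rfl⟩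

/-- Apply the Rayleigh bound to each coordinate of the vectors and add. The squared coordinates of
unit vectors sum to the number of variables, and the quadratic form counts every edge twice. -/
theorem sdp_le_eig : I.sdp ≤ I.eig := by
  refine csSup_le I.nonempty_sdp ?_
  rintro t ⟨m, x, hx, rfl⟩
  have h1 := I.sum_adj_mul fun u v => inner ℝ (x u) (x v)
  have h2 : ∑ u, ∑ v, I.adj u v * inner ℝ (x u) (x v) =
      2 * ∑ e, ((I.sign e : ℤ) : ℝ) * inner ℝ (x (I.src e)) (x (I.tgt e)) := by
    rw [h1, Finset.mul_sum]
    refine Finset.sum_congr rfl fun e _ => ?_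
    rw [real_inner_comm]
    ring
  have h3 : ∑ u, ∑ v, I.adj u v * inner ℝ (x u) (x v) =
      ∑ i, ∑ u, ∑ v, I.adj u v * (x u i * x v i) := by
    symm
    rw [Finset.sum_comm]
    refine Finset.sum_congr rfl fun u _ => ?_
    rw [Finset.sum_comm]
    refine Finset.sum_congr rfl fun v _ => ?_
    rw [PiLp.inner_apply, Finset.mul_sum]
    exact Finset.sum_congr rfl fun i _ => by simp [mul_comm]
  have h4 : ∑ i, ∑ u, x u i * x u i = Fintype.card V := by
    rw [Finset.sum_comm]
    have : ∀ u, ∑ i, x u i * x u i = 1 := fun u => by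
      have h5 := real_inner_self_eq_norm_sq (x u)
      rw [hx, one_pow, PiLp.inner_apply] at h5
      simpa [pow_two] using h5
    simp [this]
  have h5 : ∑ u, ∑ v, I.adj u v * inner ℝ (x u) (x v) ≤ I.lambdaMax * Fintype.card V := by
    rw [h3, ← h4, Finset.mul_sum]
    exact Finset.sum_le_sum fun i _ => I.sum_adj_mul_mul_le fun u => x u i
  rw [h2] at h5
  rw [eig]
  calc _ ≤ (I.lambdaMax * Fintype.card V / 2) / (Fintype.card I.E : ℝ) := by
        gcongr
        linarith
    _ = _ := by
        rw [mul_comm I.lambdaMax, div_div, div_mul_eq_mul_div]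

end Eigenvalue

/-! ### The quantum value equals the SDP value -/

/-- A quadratic form is implemented by real symmetric matrices with scalar anticommutators. -/
theorem exists_clifford (m : ℕ) : ∃ (T : Type) (_ : Fintype T) (_ : DecidableEq T) (_ : Nonempty T)
    (C : (Fin m → ℝ) → Matrix T T ℂ), (∀ x, (C x).IsHermitian ∧ (C x)ᵀ = C x) ∧
      ∀ x y, C x * C y + C y * C x = (2 * ((∑ i, x i * y i : ℝ) : ℂ)) • 1 := by
  induction m with
  | zero =>
    refine ⟨Unit, inferInstance, inferInstance, inferInstance, fun _ => 0, fun x => ?_, fun x y => ?_⟩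
    · simp
    · simp
  | succ m ih =>
    obtain ⟨T, _, _, _, C, hC, hCC⟩ := ih
    -- One more dimension doubles the size: the new coordinate goes off the diagonal and the old
    -- matrices appear with opposite signs, so the off-diagonal blocks of the anticommutator cancel.
    refine ⟨T ⊕ T, inferInstance, inferInstance, inferInstance,
      fun x => Matrix.fromBlocks (C (Fin.tail x)) ((x 0 : ℂ) • 1) ((x 0 : ℂ) • 1) (-C (Fin.tail x)),
      fun x => ⟨?_, ?_⟩, fun x y => ?_⟩
    · refine Matrix.IsHermitian.fromBlocks (hC _).1 ?_ (hC _).1.neg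
      simp [Matrix.conjTranspose_smul]
    · rw [Matrix.fromBlocks_transpose, (hC _).2, Matrix.transpose_neg, (hC _).2,
        Matrix.transpose_smul, Matrix.transpose_one]
    · have h := hCC (Fin.tail x) (Fin.tail y)
      rw [Matrix.fromBlocks_multiply, Matrix.fromBlocks_multiply, Matrix.fromBlocks_add,
        ← Matrix.fromBlocks_one, Matrix.fromBlocks_smul, Fin.sum_univ_succ]
      have hsum : ∑ i : Fin m, x i.succ * y i.succ = ∑ i, Fin.tail x i * Fin.tail y i := rfl
      rw [hsum]
      have h2 : C (Fin.tail x) * C (Fin.tail y) + ((x 0 : ℂ) • 1) * ((y 0 : ℂ) • 1) +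
          (C (Fin.tail y) * C (Fin.tail x) + ((y 0 : ℂ) • 1) * ((x 0 : ℂ) • 1)) =
          (2 * ((x 0 * y 0 + ∑ i, Fin.tail x i * Fin.tail y i : ℝ) : ℂ)) • (1 : Matrix T T ℂ) := by
        rw [add_add_add_comm, h, Matrix.smul_mul, Matrix.smul_mul, Matrix.one_mul, Matrix.one_mul,
          smul_smul, smul_smul, ← add_smul, ← add_smul]
        congr 1
        push_cast
        ring
      congr 1
      · simp only [Matrix.mul_smul, Matrix.smul_mul, Matrix.mul_one, Matrix.one_mul]
        simp only [smul_neg, smul_zero]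
        abel
      · simp only [Matrix.mul_smul, Matrix.smul_mul, Matrix.mul_one, Matrix.one_mul]
        simp only [smul_neg, smul_zero]
        abel
      · rw [← h2]
        simp only [Matrix.neg_mul, Matrix.mul_neg, neg_neg]
        abel

theorem exists_clifford_fin (m : ℕ) : ∃ (N : ℕ) (_ : 0 < N)
    (C : (Fin m → ℝ) → Matrix (Fin N) (Fin N) ℂ), (∀ x, (C x).IsHermitian ∧ (C x)ᵀ = C x) ∧
      ∀ x y, C x * C y + C y * C x = (2 * ((∑ i, x i * y i : ℝ) : ℂ)) • 1 := by
  obtain ⟨T, _, _, _, C, hC, hCC⟩ := exists_clifford m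
  let e := (Fintype.equivFin T).symm
  refine ⟨Fintype.card T, Fintype.card_pos, fun x => (C x).submatrix e e, fun x => ⟨?_, ?_⟩,
    fun x y => ?_⟩
  · exact (hC x).1.submatrix e
  · rw [Matrix.transpose_submatrix, (hC x).2]
  · rw [Matrix.submatrix_mul_equiv, Matrix.submatrix_mul_equiv]
    refine (congrArg (fun M => Matrix.submatrix M e e) (hCC x y)).trans ?_
    ext i j
    simp [Matrix.one_apply]

/-- The maximally entangled state. -/
noncomputable def maxEntangled (N : ℕ) : Fin N × Fin N → ℂ := fun p =>
  if p.1 = p.2 then ((√(N : ℝ))⁻¹ : ℝ) else 0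

theorem sqrt_inv_mul_self (N : ℕ) :
    (((√(N : ℝ))⁻¹ : ℝ) : ℂ) * (((√(N : ℝ))⁻¹ : ℝ) : ℂ) = (N : ℂ)⁻¹ := by
  rw [← Complex.ofReal_mul, ← mul_inv, Real.mul_self_sqrt (Nat.cast_nonneg N)]
  push_cast
  rfl

theorem maxEntangled_kronecker {N : ℕ} (A B : Matrix (Fin N) (Fin N) ℂ) :
    star (maxEntangled N) ⬝ᵥ ((A ⊗ₖ B) *ᵥ maxEntangled N) = (N : ℂ)⁻¹ * (A * Bᵀ).trace := by
  rw [← sqrt_inv_mul_self N]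
  simp only [dotProduct, Matrix.mulVec, Fintype.sum_prod_type, maxEntangled, Pi.star_apply,
    Matrix.kroneckerMap_apply, Matrix.trace, Matrix.diag, Matrix.mul_apply, Matrix.transpose_apply,
    mul_ite, mul_zero, Finset.sum_ite_eq, Finset.mem_univ, if_true]
  rw [Finset.mul_sum]
  refine Finset.sum_congr rfl fun i _ => ?_
  rw [Finset.sum_eq_single i]
  · simp only [if_true, Finset.mul_sum]
    refine Finset.sum_congr rfl fun j _ => ?_
    rw [Complex.star_def, Complex.conj_ofReal]
    ring
  · intro j _ hj
    rw [if_neg (Ne.symm hj), star_zero, zero_mul]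
  · simp

theorem maxEntangled_normalized {N : ℕ} (hN : 0 < N) :
    star (maxEntangled N) ⬝ᵥ maxEntangled N = 1 := by
  have h := maxEntangled_kronecker (N := N) 1 1
  rw [Matrix.one_kronecker_one, Matrix.one_mulVec, Matrix.transpose_one, Matrix.one_mul,
    Matrix.trace_one, Fintype.card_fin, inv_mul_cancel₀ (by exact_mod_cast hN.ne')] at h
  exact h

/-- Tsirelson's strategy: measure the Clifford matrices of the vectors on a maximally entangled
state. The correlation is the normalized trace of a product, which the anticommutation relation
evaluates as the inner product; symmetry of the matrices removes the transpose. -/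
theorem sdp_subset_quantum (I : XorInstance V) :
    {t : ℝ | ∃ (m : ℕ) (x : V → EuclideanSpace ℝ (Fin m)), (∀ v, ‖x v‖ = 1) ∧
    t = (∑ e : I.E, ((I.sign e : ℤ) : ℝ) * inner ℝ (x (I.src e)) (x (I.tgt e))) /
      (Fintype.card I.E : ℝ)} ⊆
    {t : ℝ | ∃ (p q : ℕ) (ψ : Fin p × Fin q → ℂ)
    (A : V → Matrix (Fin p) (Fin p) ℂ) (B : V → Matrix (Fin q) (Fin q) ℂ),
    star ψ ⬝ᵥ ψ = 1 ∧
    (∀ v, (A v).IsHermitian ∧ A v * A v = 1) ∧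
    (∀ v, (B v).IsHermitian ∧ B v * B v = 1) ∧
    t = (∑ e : I.E, ((I.sign e : ℤ) : ℝ) *
        (star ψ ⬝ᵥ ((A (I.src e) ⊗ₖ B (I.tgt e)) *ᵥ ψ)).re) / (Fintype.card I.E : ℝ)} := by
  rintro t ⟨m, x, hx, rfl⟩
  obtain ⟨N, hN, C, hC, hCC⟩ := exists_clifford_fin m
  have hinner : ∀ u v, ∑ i, x u i * x v i = inner ℝ (x u) (x v) := fun u v => by
    rw [PiLp.inner_apply]
    exact Finset.sum_congr rfl fun i _ => by simp [mul_comm]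
  have hsq : ∀ v, (C (x v)).IsHermitian ∧ C (x v) * C (x v) = 1 := by
    intro v
    refine ⟨(hC _).1, ?_⟩
    have h := hCC (x v) (x v)
    rw [hinner, real_inner_self_eq_norm_sq, hx, one_pow, ← two_smul ℂ, Complex.ofReal_one,
      mul_one] at h
    exact smul_right_injective _ (two_ne_zero (α := ℂ)) h
  refine ⟨N, N, maxEntangled N, fun v => C (x v), fun v => C (x v), maxEntangled_normalized hN,
    hsq, hsq, ?_⟩
  congr 1
  refine Finset.sum_congr rfl fun e _ => ?_
  congr 1
  rw [maxEntangled_kronecker, (hC _).2]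
  have h := congrArg Matrix.trace (hCC (x (I.src e)) (x (I.tgt e)))
  rw [hinner, Matrix.trace_add, Matrix.trace_mul_comm (C (x (I.tgt e))), ← two_mul,
    Matrix.trace_smul, Matrix.trace_one, Fintype.card_fin, smul_eq_mul, mul_assoc] at h
  have h2 := mul_left_cancel₀ two_ne_zero h
  have hN0 : (N : ℂ) ≠ 0 := by exact_mod_cast hN.ne'
  rw [h2, mul_comm _ (N : ℂ), ← mul_assoc, inv_mul_cancel₀ hN0, one_mul, Complex.ofReal_re]

/-- The real and imaginary parts of a complex vector. -/
def realify {W : Type*} (z : W → ℂ) : W ⊕ W → ℝ :=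
  Sum.elim (fun w => (z w).re) (fun w => (z w).im)

theorem sum_realify {W : Type*} [Fintype W] (z z' : W → ℂ) :
    ∑ w, realify z w * realify z' w = (star z ⬝ᵥ z').re := by
  rw [Fintype.sum_sum_type, dotProduct, Complex.re_sum, ← Finset.sum_add_distrib]
  exact Finset.sum_congr rfl fun w _ => by simp [realify]

theorem mulVec_dotProduct_mulVec {W : Type*} [Fintype W] {M N : Matrix W W ℂ} (hM : M.IsHermitian)
    (ψ : W → ℂ) : star (M *ᵥ ψ) ⬝ᵥ (N *ᵥ ψ) = star ψ ⬝ᵥ ((M * N) *ᵥ ψ) := by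
  rw [Matrix.star_mulVec, hM.eq, ← Matrix.dotProduct_mulVec, Matrix.mulVec_mulVec]

/-- The vectors `(A_u ⊗ 1) ψ` and `(1 ⊗ B_v) ψ`, viewed as real vectors of twice the dimension, are
unit vectors whose inner products are the correlations. The side `S` of a variable selects its
operator. -/
theorem quantum_le_sdp (I : XorInstance V) (S : V → Prop) (hsrc : ∀ e, S (I.src e))
    (htgt : ∀ e, ¬ S (I.tgt e)) {p q : ℕ} {ψ : Fin p × Fin q → ℂ}
    {A : V → Matrix (Fin p) (Fin p) ℂ} {B : V → Matrix (Fin q) (Fin q) ℂ}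
    (hψ : star ψ ⬝ᵥ ψ = 1) (hA : ∀ v, (A v).IsHermitian ∧ A v * A v = 1)
    (hB : ∀ v, (B v).IsHermitian ∧ B v * B v = 1) :
    (∑ e : I.E, ((I.sign e : ℤ) : ℝ) *
        (star ψ ⬝ᵥ ((A (I.src e) ⊗ₖ B (I.tgt e)) *ᵥ ψ)).re) / (Fintype.card I.E : ℝ) ≤ I.sdp := by
  classical
  let M : V → Matrix (Fin p × Fin q) (Fin p × Fin q) ℂ := fun v =>
    if S v then A v ⊗ₖ (1 : Matrix (Fin q) (Fin q) ℂ) else (1 : Matrix (Fin p) (Fin p) ℂ) ⊗ₖ B v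
  have hM : ∀ v, (M v).IsHermitian ∧ M v * M v = 1 := by
    intro v
    by_cases hv : S v
    · simp only [M, if_pos hv]
      refine ⟨?_, ?_⟩
      · rw [Matrix.IsHermitian, Matrix.conjTranspose_kronecker, (hA v).1.eq,
          Matrix.conjTranspose_one]
      · rw [← Matrix.mul_kronecker_mul, (hA v).2, Matrix.one_mul, Matrix.one_kronecker_one]
    · simp only [M, if_neg hv]
      refine ⟨?_, ?_⟩
      · rw [Matrix.IsHermitian, Matrix.conjTranspose_kronecker, (hB v).1.eq,
          Matrix.conjTranspose_one]
      · rw [← Matrix.mul_kronecker_mul, (hB v).2, Matrix.one_mul, Matrix.one_kronecker_one]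
  refine le_trans (le_of_eq ?_) (I.le_sdp (fun v => realify (M v *ᵥ ψ)) fun v => ?_)
  · congr 1
    refine Finset.sum_congr rfl fun e _ => ?_
    rw [sum_realify, mulVec_dotProduct_mulVec (hM _).1]
    simp only [M, if_pos (hsrc e), if_neg (htgt e)]
    rw [← Matrix.mul_kronecker_mul, Matrix.mul_one, Matrix.one_mul]
  · rw [sum_realify, mulVec_dotProduct_mulVec (hM _).1, (hM v).2, Matrix.one_mulVec, hψ,
      Complex.one_re]

/-- Tsirelson's theorem: for bipartite instances the quantum value is the SDP value. -/
theorem quantumValue_eq_sdp (I : XorInstance V) (S : V → Prop) (hsrc : ∀ e, S (I.src e))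
    (htgt : ∀ e, ¬ S (I.tgt e)) : I.quantumValue = I.sdp := by
  apply le_antisymm
  · refine csSup_le (I.nonempty_sdp.mono I.sdp_subset_quantum) ?_
    rintro t ⟨p, q, ψ, A, B, hψ, hA, hB, rfl⟩
    exact I.quantum_le_sdp S hsrc htgt hψ hA hB
  · refine csSup_le_csSup ⟨I.sdp, ?_⟩ I.nonempty_sdp I.sdp_subset_quantum
    rintro t ⟨p, q, ψ, A, B, hψ, hA, hB, rfl⟩
    exact I.quantum_le_sdp S hsrc htgt hψ hA hB

end XorInstance

/-! ### The main theorem -/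

namespace ForrLift

variable {k c n : ℕ}

theorem quantumValue_additiveLift (σ : ConstraintLift (ForrVar k) c n)
    (ξ : Negations (ForrVar k) c n) :
    (additiveLift (fun _ => forrelation k) σ ξ).quantumValue =
      (additiveLift (fun _ => forrelation k) σ ξ).sdp :=
  XorInstance.quantumValue_eq_sdp _ (fun v => v.1.isLeft = true) (fun _ => rfl)
    (fun _ => Bool.false_ne_true)

theorem eig_additiveLift (hn : 0 < n) (σ : ConstraintLift (ForrVar k) c n)
    (ξ : Negations (ForrVar k) c n) :
    (additiveLift (fun _ => forrelation k) σ ξ).eig =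
      (additiveLift (fun _ => forrelation k) σ ξ).lambdaMax / (c * 2 ^ k) := by
  have hn' : (0 : ℝ) < n := by exact_mod_cast hn
  have hV : (Fintype.card (ForrVar k × Fin n) : ℝ) = 2 * 2 ^ k * n := card_var
  rw [XorInstance.eig, card_edges, hV]
  push_cast
  rcases Nat.eq_zero_or_pos c with rfl | hc
  · simp
  · have hc' : (0 : ℝ) < c := by exact_mod_cast hc
    field_simp

theorem target_eq (hc : 2 ≤ c) :
    2 * √((c : ℝ) - 1) / ((c : ℝ) * (2 : ℝ) ^ ((k : ℝ) / 2)) =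
      2 * √(2 ^ k * ((c : ℝ) - 1)) / (c * 2 ^ k) := by
  have hc0 : (0 : ℝ) < c := by exact_mod_cast (by omega : 0 < c)
  have h1 : (2 : ℝ) ^ ((k : ℝ) / 2) = √(2 ^ k) := by
    rw [Real.sqrt_eq_rpow, ← Real.rpow_natCast, ← Real.rpow_mul (by norm_num)]
    congr 1
    ring
  have h2 : (0 : ℝ) < √(2 ^ k) := by positivity
  have h3 : √((2 : ℝ) ^ k) * √(2 ^ k) = 2 ^ k := Real.mul_self_sqrt (by positivity)
  rw [h1, Real.sqrt_mul (by positivity), div_eq_div_iff (by positivity) (by positivity)]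
  linear_combination (-2 * √((c : ℝ) - 1) * c) * h3

theorem isProbabilityMeasure_randomLiftLaw (ν : Fin c × Fin n → Measure (ForrVar k → ℤˣ))
    [∀ f, IsProbabilityMeasure (ν f)] : IsProbabilityMeasure (randomLiftLaw (ForrVar k) c n ν) := by
  have := ProbabilityTheory.isProbabilityMeasure_uniformOn
    (Set.finite_univ (α := ConstraintLift (ForrVar k) c n)) Set.univ_nonempty
  unfold randomLiftLaw
  infer_instance

theorem abs_values_le (hn : 0 < n) {s y ε : ℝ} (hc : 2 ≤ c) (hs : 0 < s) (hy : 1 < y)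
    (hyε : s * (y + y⁻¹) ≤ (2 * s / (c * 2 ^ k) + ε) * (c * 2 ^ k))
    {σ : ConstraintLift (ForrVar k) c n} {ξ : Negations (ForrVar k) c n}
    (hlam : ¬ ∃ lam, s * (y + y⁻¹) ≤ lam ∧ Module.End.HasEigenvalue
        (Matrix.toLin' (additiveLift (fun _ => forrelation k) σ ξ).adj) lam)
    (hsdp : ¬ (additiveLift (fun _ => forrelation k) σ ξ).sdp < 2 * s / (c * 2 ^ k) - ε) :
    |(additiveLift (fun _ => forrelation k) σ ξ).sdp - 2 * s / (c * 2 ^ k)| ≤ ε ∧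
    |(additiveLift (fun _ => forrelation k) σ ξ).quantumValue - 2 * s / (c * 2 ^ k)| ≤ ε ∧
    |(additiveLift (fun _ => forrelation k) σ ξ).eig - 2 * s / (c * 2 ^ k)| ≤ ε := by
  have hc0 : (0 : ℝ) < c := by exact_mod_cast (by omega : 0 < c)
  have h1 := (additiveLift (fun _ => forrelation k) σ ξ).sdp_le_eig
  have h2 : (additiveLift (fun _ => forrelation k) σ ξ).lambdaMax ≤ s * (y + y⁻¹) := by
    -- Nonnegativity of the bound covers an empty set of eigenvalues, whose supremum is `0`.
    refine Real.sSup_le (fun lam h => ?_) (by positivity)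
    by_contra! h3
    exact hlam ⟨lam, h3.le, h⟩
  have h3 : (additiveLift (fun _ => forrelation k) σ ξ).eig ≤ 2 * s / (c * 2 ^ k) + ε := by
    rw [eig_additiveLift hn, div_le_iff₀ (by positivity)]
    exact h2.trans hyε
  rw [not_lt] at hsdp
  rw [quantumValue_additiveLift]
  simp only [abs_sub_le_iff]
  refine ⟨⟨?_, ?_⟩, ⟨?_, ?_⟩, ?_, ?_⟩ <;> linarith

end ForrLift

theorem mainTheorem2 (k c : ℕ) (hc : 2 ≤ c)
    (ν : (n : ℕ) → Fin c × Fin n → Measure (ForrVar k → ℤˣ))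
    (hprob : ∀ n f, IsProbabilityMeasure (ν n f))
    (hν : ∀ n f, IsOneWiseUniform (forrelation k) (ν n f))
    (ε : ℝ) (hε : 0 < ε) :
    Tendsto (fun n : ℕ =>
      randomLiftLaw (ForrVar k) c n (ν n)
        {ω | |(additiveLift (fun _ => forrelation k) ω.1 ω.2).sdp
              - 2 * √((c : ℝ) - 1) / ((c : ℝ) * (2 : ℝ) ^ ((k : ℝ) / 2))| ≤ ε ∧
            |(additiveLift (fun _ => forrelation k) ω.1 ω.2).quantumValue
              - 2 * √((c : ℝ) - 1) / ((c : ℝ) * (2 : ℝ) ^ ((k : ℝ) / 2))| ≤ ε ∧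
            |(additiveLift (fun _ => forrelation k) ω.1 ω.2).eig
              - 2 * √((c : ℝ) - 1) / ((c : ℝ) * (2 : ℝ) ^ ((k : ℝ) / 2))| ≤ ε})
      atTop (𝓝 1) := by
  have hc1 : (1 : ℝ) < c := by exact_mod_cast (by omega : 1 < c)
  rw [ForrLift.target_eq hc]
  set s := √(2 ^ k * ((c : ℝ) - 1)) with hsdef
  have hc1' : (0 : ℝ) < (c : ℝ) - 1 := by linarith
  have hs : 0 < s := Real.sqrt_pos.2 (by positivity)
  have hsD : s * s = 2 ^ k * ((c : ℝ) - 1) := Real.mul_self_sqrt (by positivity)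
  -- With `y = 1 + δ` one has `y + y⁻¹ ≤ 2 + δ`, and `δ` is chosen so that `s δ` is exactly the
  -- tolerance `ε` on the scale of the eigenvalues.
  set δ := ε * (c * 2 ^ k) / s with hδ
  have hδ0 : 0 < δ := by positivity
  have hy : 1 < 1 + δ := by linarith
  have hyε : s * ((1 + δ) + (1 + δ)⁻¹) ≤ (2 * s / (c * 2 ^ k) + ε) * (c * 2 ^ k) := by
    have h1 : (1 + δ)⁻¹ ≤ 1 := inv_le_one_of_one_le₀ hy.le
    have h2 : s * δ = ε * (c * 2 ^ k) := by rw [hδ]; field_simp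
    have h3 : (2 * s / (c * 2 ^ k) + ε) * (c * 2 ^ k) = 2 * s + s * δ := by
      rw [h2, add_mul, div_mul_cancel₀ _ (by positivity)]
    rw [h3]
    nlinarith
  have hE := ForrLift.tendsto_measure_large_eigenvalue hc hs hsD hy ν hprob hν
  have hS := ForrLift.tendsto_measure_small_sdp hc hs hsD hε ν hprob
  have := fun n => hprob n
  have := fun n => ForrLift.isProbabilityMeasure_randomLiftLaw (ν n)
  rw [← ENNReal.tendsto_toReal_iff (fun n => measure_ne_top _ _) ENNReal.one_ne_top,
    ENNReal.toReal_one]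
  have hlow : Tendsto (fun n : ℕ => 1 - ((randomLiftLaw (ForrVar k) c n (ν n)).real
      {ω | ∃ lam, s * ((1 + δ) + (1 + δ)⁻¹) ≤ lam ∧ Module.End.HasEigenvalue
        (Matrix.toLin' (additiveLift (fun _ => forrelation k) ω.1 ω.2).adj) lam} +
      (randomLiftLaw (ForrVar k) c n (ν n)).real
      {ω | (additiveLift (fun _ => forrelation k) ω.1 ω.2).sdp < 2 * s / (c * 2 ^ k) - ε}))
      atTop (𝓝 1) := by
    simpa using (hE.add hS).const_sub 1
  refine tendsto_of_tendsto_of_tendsto_of_le_of_le' hlow tendsto_const_nhds ?_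
    (Eventually.of_forall fun n => measureReal_le_one)
  filter_upwards [eventually_gt_atTop 0] with n hn
  have hunion := measureReal_union_le (μ := randomLiftLaw (ForrVar k) c n (ν n))
    {ω | ∃ lam, s * ((1 + δ) + (1 + δ)⁻¹) ≤ lam ∧ Module.End.HasEigenvalue
        (Matrix.toLin' (additiveLift (fun _ => forrelation k) ω.1 ω.2).adj) lam}
    {ω | (additiveLift (fun _ => forrelation k) ω.1 ω.2).sdp < 2 * s / (c * 2 ^ k) - ε}
  refine (sub_le_sub_left hunion 1).trans ?_
  -- Outside the two rare events, a large eigenvalue and a small SDP value, all three estimates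
  -- hold.
  rw [← probReal_compl_eq_one_sub (Set.toFinite _).measurableSet]
  refine measureReal_mono fun ω hω => ?_
  rw [Set.mem_compl_iff, Set.mem_union, not_or] at hω
  exact ForrLift.abs_values_le hn hc hs hy hyε hω.1 hω.2
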